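/- Let $\mathbb{T}^2=(\mathbb{R}/2\pi\mathbb{Z})^2$, $e_n(x)=\frac1{2\pi}e^{in\cdot x}$ and $\langle n\rangle=(1+|n|^2)^{1/2}$ for $n\in\mathbb{Z}^2$, and let $\widehat f(n)=\int_{\mathbb{T}^2}f\,\overline{e_n}\,dx$. Let $W(t)=\sum_{n\in\mathbb{Z}^2}\beta_n(t)e_n$ be a cylindrical Wiener process on $L^2(\mathbb{T}^2)$, that is, $\{\beta_n\}_{n\in\mathbb{Z}^2}$ is a family of mutually independent complex-valued Brownian motions on a probability space $(\Omega,\mathcal F,P)$ conditioned so that $\beta_{-n}=\overline{\beta_n}$ (in particular $\beta_0$ is real-valued), normalized by $\mathrm{Var}(\beta_n(t))=t$. For $\alpha\in\mathbb{R}$ and $N\in\mathbb{N}$ define the truncated stochastic convolution, its Wick square and the truncated second order stochastic term by \[ \Psi_N(t)=\sum_{|n|\le N}e_n\int_0^t\frac{\sin((t-t')\langle n\rangle)}{\langle n\rangle^{1-\alpha}}\,d\beta_n(t'), \qquad {:}\Psi_N^2{:}\,=\Psi_N^2-\sigma_N, \] \[ \sigma_N(t)=\mathbb{E}\big[\Psi_N(t,x)^2\big]=\frac1{4\pi^2}\sum_{|n|\le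 N}\int_0^t\Big[\frac{\sin((t-t')\langle n\rangle)}{\langle n\rangle^{1-\alpha}}\Big]^2dt', \] \[ Y_N(t)=\mathcal I({:}\Psi_N^2{:})(t)=\int_0^t\frac{\sin((t-t')\langle\nabla\rangle)}{\langle\nabla\rangle}\,{:}\Psi_N^2(t'){:}\,dt'. \] Let $\alpha\ge\frac12$. Then, for every $T>0$, almost surely, $\{Y_N\}_{N\in\mathbb{N}}$ is a divergent sequence in $C([0,T];\mathcal D'(\mathbb{T}^2))$; that is, every $Y_N$ belongs to $C([0,T];\mathcal D'(\mathbb{T}^2))$ and the sequence has no limit in this space. In fact, for every $n\in\mathbb{Z}^2$ and every $t>0$, the sequence of Fourier coefficients $\{\widehat{Y_N}(n,t)\}_{N\in\mathbb{N}}$ almost surely has no limit in $\mathbb{C}$. -/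

import Mathlib

open MeasureTheory ProbabilityTheory Filter Topology
open scoped NNReal

noncomputable section

namespace SNLW

/-! ### Fourier analysis on the torus `𝕋² = (ℝ / 2πℤ)²`

Functions on the torus are represented by functions on `ℝ × ℝ` (periodic ones, of period `2π` in
each variable), and integration over the torus is integration over `(0, 2π]²`. -/

/-- The fundamental domain `(0, 2π]²` of the torus. -/
def cell : Set (ℝ × ℝ) := Set.Ioc 0 (2 * Real.pi) ×ˢ Set.Ioc 0 (2 * Real.pi)

/-- The orthonormal Fourier basis `eₙ(x) = (2π)⁻¹ exp(i n · x)`. -/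
def e (n : ℤ × ℤ) (x : ℝ × ℝ) : ℂ :=
  (1 / (2 * Real.pi) : ℂ) * Complex.exp (Complex.I * (n.1 * x.1 + n.2 * x.2))

/-- The Japanese bracket `⟨n⟩ = (1 + |n|²)^(1/2)`. -/
def jb (n : ℤ × ℤ) : ℝ := Real.sqrt (1 + (n.1 : ℝ) ^ 2 + (n.2 : ℝ) ^ 2)

/-- The frequencies `n ∈ ℤ²` with Euclidean length `|n| ≤ N`. -/
def freq (N : ℕ) : Finset (ℤ × ℤ) :=
  (Finset.Icc (-(N : ℤ)) N ×ˢ Finset.Icc (-(N : ℤ)) N).filter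
    fun n => n.1 ^ 2 + n.2 ^ 2 ≤ (N : ℤ) ^ 2

/-- The Fourier coefficient `∫ f(x) conj(eₙ(x)) dx` over the torus. -/
def coeff (f : ℝ × ℝ → ℂ) (n : ℤ × ℤ) : ℂ :=
  ∫ x in cell, f x * (starRingEnd ℂ) (e n x)

/-- The Fourier multiplier operator with symbol `m`. It is only applied to trigonometric
polynomials below, for which the sum has finitely many nonzero terms. -/
def multiplier (m : ℤ × ℤ → ℝ) (f : ℝ × ℝ → ℂ) (x : ℝ × ℝ) : ℂ :=
  ∑' n : ℤ × ℤ, (m n : ℂ) * coeff f n * e n x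

/-- The wave Duhamel operator
`(𝓘 F)(t) = ∫₀ᵗ sin((t - t')⟨∇⟩) / ⟨∇⟩ F(t') dt'`. -/
def duhamel (F : ℝ → ℝ × ℝ → ℂ) (t : ℝ) (x : ℝ × ℝ) : ℂ :=
  ∫ t' in (0 : ℝ)..t, multiplier (fun n => Real.sin ((t - t') * jb n) / jb n) (F t') x

/-! ### Periodic distributions -/

/-- The complex vector space of smooth functions on the torus. -/
def testSubmodule : Submodule ℂ (ℝ × ℝ → ℂ) where
  carrier := {φ | ContDiff ℝ (⊤ : ℕ∞) φ ∧ ∀ (x : ℝ × ℝ) (n : ℤ × ℤ),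
    φ (x.1 + 2 * Real.pi * n.1, x.2 + 2 * Real.pi * n.2) = φ x}
  add_mem' := by
    rintro f g ⟨hf, hf'⟩ ⟨hg, hg'⟩
    exact ⟨hf.add hg, fun x n => by simp only [Pi.add_apply, hf', hg']⟩
  zero_mem' := ⟨contDiff_const, fun _ _ => rfl⟩
  smul_mem' := by
    rintro c f ⟨hf, hf'⟩
    exact ⟨hf.const_smul c, fun x n => by simp only [Pi.smul_apply, hf']⟩

/-- The space `C^∞(𝕋²)` of test functions. -/
def TestFunction : Type := testSubmodule

instance : AddCommGroup TestFunction := inferInstanceAs (AddCommGroup testSubmodule)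

instance : Module ℂ TestFunction := inferInstanceAs (Module ℂ testSubmodule)

instance : CoeFun TestFunction (fun _ => ℝ × ℝ → ℂ) := ⟨fun φ => φ.1⟩

/-- The usual Fréchet topology of `C^∞(𝕋²)`: uniform convergence of the derivatives of every
order. -/
instance : TopologicalSpace TestFunction :=
  ⨅ k : ℕ, TopologicalSpace.induced
    (fun φ : TestFunction => UniformFun.ofFun (iteratedFDeriv ℝ k φ)) inferInstance

/-- The space `𝓓'(𝕋²)` of distributions on the torus: the continuous dual of `C^∞(𝕋²)`, with
the strong dual topology (uniform convergence on bounded sets of test functions). -/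
abbrev TorusDistribution : Type := TestFunction →L[ℂ] ℂ

/-! ### The noise -/

/-- The normalized real components of a family of complex processes indexed by `ℤ²`: for `n = 0`
the real part of the process; for `n` in the upper half-lattice `√2` times the real part; for
`n` in the lower half-lattice `√2` times the imaginary part. -/
def realComponent {Ω : Type*} (β : ℤ × ℤ → ℝ≥0 → Ω → ℂ) (n : ℤ × ℤ) (t : ℝ≥0) (ω : Ω) : ℝ :=
  if n = 0 then (β n t ω).re
  else if 0 < n.1 ∨ (n.1 = 0 ∧ 0 < n.2) then Real.sqrt 2 * (β n t ω).re
  else Real.sqrt 2 * (β n t ω).im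

/-- `β` is the family of Fourier coefficients of a (real) cylindrical Wiener process
`W(t) = ∑ₙ βₙ(t) eₙ` on `L²(𝕋²)`: the `βₙ` are mutually independent complex Brownian motions with
`Var βₙ(t) = t`, conditioned so that `β₋ₙ = conj βₙ` (so `β₀` is real). Since `β₋ₙ` and `βₙ`
have opposite imaginary parts, the independence of the `βₙ` over a half-lattice, of their
real and imaginary parts, and the normalization amount to: the normalized real components are
mutually independent standard real Brownian motions. -/
structure IsCylindricalWiener {Ω : Type*} [MeasurableSpace Ω]
    (β : ℤ × ℤ → ℝ≥0 → Ω → ℂ) (P : Measure Ω) : Prop where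
  conj : ∀ n, ∀ᵐ ω ∂P, ∀ t, β (-n) t ω = (starRingEnd ℂ) (β n t ω)
  brownian : ∀ n, IsBrownianReal (realComponent β n) P
  indep : iIndepFun (fun n ω t => realComponent β n t ω) P

/-! ### The Wiener integral -/

/-- Left-point sums `∑ⱼ f(tⱼ) (b(tⱼ₊₁) - b(tⱼ))` over the points `tⱼ = t j / m`, `j = 0, …, m`. -/
def leftSum (f : ℝ → ℝ) (b : ℝ≥0 → ℂ) (t : ℝ) (m : ℕ) : ℂ :=
  ∑ j ∈ Finset.range m, (f (t * (j / m)) : ℂ) *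
    (b (t * ((j + 1 : ℕ) / m)).toNNReal - b (t * (j / m)).toNNReal)

/-- The stochastic integral `∫₀ᵗ f(t') db(t')` of a deterministic `C¹` function against a
continuous path `b`: the limit of the left-point sums. -/
def wienerIntegral (f : ℝ → ℝ) (b : ℝ≥0 → ℂ) (t : ℝ) : ℂ :=
  limUnder atTop (leftSum f b t)

/-- The left-point sums converge, to the value given by integration by parts. -/
theorem tendsto_leftSum {f : ℝ → ℝ} (hf : ContDiff ℝ 1 f) {b : ℝ≥0 → ℂ} (hb : Continuous b)
    {t : ℝ} (ht : 0 ≤ t) :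
    Tendsto (leftSum f b t) atTop
      (𝓝 (f t * b t.toNNReal - f 0 * b 0
        - ∫ s in (0 : ℝ)..t, ((deriv f s : ℝ) : ℂ) * b s.toNNReal)) := by
  set B : ℝ → ℂ := fun s => b s.toNNReal with hB
  have hBc : Continuous B := hb.comp continuous_real_toNNReal
  have hf' : Continuous (deriv f) := hf.continuous_deriv le_rfl
  have hf'c : Continuous fun s => ((deriv f s : ℝ) : ℂ) := Complex.continuous_ofReal.comp hf'
  obtain ⟨M, hM⟩ := (isCompact_Icc (a := (0 : ℝ)) (b := t)).exists_bound_of_continuousOn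
    hf'.continuousOn
  have hM0 : 0 ≤ M := (norm_nonneg _).trans (hM 0 ⟨le_rfl, ht⟩)
  have huc := (isCompact_Icc (a := (0 : ℝ)) (b := t)).uniformContinuousOn_of_continuous
    hBc.continuousOn
  rw [Metric.tendsto_atTop]
  intro ε hε
  set η : ℝ := ε / (M * t + 1) with hη
  have hMt : 0 < M * t + 1 := by positivity
  have hη0 : 0 < η := by positivity
  obtain ⟨δ, hδ, hδB⟩ := Metric.uniformContinuousOn_iff.1 huc η hη0
  obtain ⟨m₀, hm₀⟩ := exists_nat_gt (t / δ)
  refine ⟨m₀ + 1, fun m hm => ?_⟩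
  have hmpos : (0 : ℝ) < m := by
    have : 0 < m := by omega
    exact_mod_cast this
  have hmδ : t / m < δ := by
    have h1 : (m₀ : ℝ) < m := by
      have : m₀ < m := by omega
      exact_mod_cast this
    rw [div_lt_iff₀ hmpos]
    rw [div_lt_iff₀ hδ] at hm₀
    nlinarith
  set p : ℕ → ℝ := fun j => t * (j / m) with hp
  have hp0 : p 0 = 0 := by simp [hp]
  have hpm : p m = t := by simp [hp, hmpos.ne']
  have hpstep : ∀ j, p (j + 1) - p j = t / m := by
    intro j
    simp only [hp]
    push_cast
    field_simp
    ring
  have hpmono : ∀ j, p j ≤ p (j + 1) := by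
    intro j
    have := hpstep j
    have h2 : 0 ≤ t / m := by positivity
    linarith
  have hpnn : ∀ j, 0 ≤ p j := fun j => by positivity
  have hple : ∀ j, j ≤ m → p j ≤ t := by
    intro j hj
    have : (j : ℝ) / m ≤ 1 := by
      rw [div_le_one hmpos]
      exact_mod_cast hj
    simp only [hp]
    nlinarith
  have hint : ∀ x y : ℝ, IntervalIntegrable (fun s => ((deriv f s : ℝ) : ℂ) * B s) volume x y :=
    fun x y => (hf'c.mul hBc).intervalIntegrable x y
  have hsum : (∫ s in (0 : ℝ)..t, ((deriv f s : ℝ) : ℂ) * B s)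
      = ∑ j ∈ Finset.range m, ∫ s in (p j)..(p (j + 1)), ((deriv f s : ℝ) : ℂ) * B s := by
    rw [intervalIntegral.sum_integral_adjacent_intervals (fun k _ => hint _ _), hp0, hpm]
  have hftc : ∀ j, ((f (p (j + 1)) : ℂ) - f (p j))
      = ∫ s in (p j)..(p (j + 1)), ((deriv f s : ℝ) : ℂ) := by
    intro j
    rw [intervalIntegral.integral_ofReal, intervalIntegral.integral_deriv_eq_sub
      (fun x _ => (hf.differentiable one_ne_zero) x) (hf'.intervalIntegrable _ _)]
    push_cast
    rfl
  have htel : (f t : ℂ) * B t - f 0 * B 0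
      = ∑ j ∈ Finset.range m, ((f (p (j + 1)) : ℂ) * B (p (j + 1)) - f (p j) * B (p j)) := by
    rw [Finset.sum_range_sub (fun j => (f (p j) : ℂ) * B (p j)), hp0, hpm]
  have hB0 : b 0 = B 0 := by simp [hB]
  have hdiff : leftSum f b t m - (f t * b t.toNNReal - f 0 * b 0
        - ∫ s in (0 : ℝ)..t, ((deriv f s : ℝ) : ℂ) * b s.toNNReal)
      = ∑ j ∈ Finset.range m,
        ∫ s in (p j)..(p (j + 1)), ((deriv f s : ℝ) : ℂ) * (B s - B (p (j + 1))) := by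
    have h1 : (f t * b t.toNNReal - f 0 * b 0 : ℂ) = f t * B t - f 0 * B 0 := by
      rw [hB0]
    rw [h1, htel]
    change _ - (_ - ∫ s in (0 : ℝ)..t, ((deriv f s : ℝ) : ℂ) * B s) = _
    rw [hsum]
    unfold leftSum
    rw [← Finset.sum_sub_distrib, ← Finset.sum_sub_distrib]
    refine Finset.sum_congr rfl fun j _ => ?_
    have h2 : (∫ s in (p j)..(p (j + 1)), ((deriv f s : ℝ) : ℂ) * (B s - B (p (j + 1))))
        = (∫ s in (p j)..(p (j + 1)), ((deriv f s : ℝ) : ℂ) * B s)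
          - ((f (p (j + 1)) : ℂ) - f (p j)) * B (p (j + 1)) := by
      have hint2 : IntervalIntegrable (fun s => ((deriv f s : ℝ) : ℂ) * B (p (j + 1))) volume
          (p j) (p (j + 1)) := (hf'c.mul continuous_const).intervalIntegrable _ _
      rw [hftc j, ← intervalIntegral.integral_mul_const,
        ← intervalIntegral.integral_sub (hint _ _) hint2]
      refine intervalIntegral.integral_congr fun s _ => ?_
      simp only [mul_sub]
    rw [h2]
    change (f (p j) : ℂ) * (B (p (j + 1)) - B (p j)) - _ = _
    ring
  rw [dist_eq_norm, hdiff]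
  have hbound : ∀ j ∈ Finset.range m,
      ‖∫ s in (p j)..(p (j + 1)), ((deriv f s : ℝ) : ℂ) * (B s - B (p (j + 1)))‖ ≤ M * η * (t / m) := by
    intro j hj
    have hj' : j + 1 ≤ m := by
      have := Finset.mem_range.1 hj
      omega
    have h3 := intervalIntegral.norm_integral_le_of_norm_le_const (a := p j) (b := p (j + 1))
      (f := fun s => ((deriv f s : ℝ) : ℂ) * (B s - B (p (j + 1)))) (C := M * η) ?_
    · rwa [hpstep, abs_of_nonneg (by positivity)] at h3
    · intro s hs
      rw [Set.uIoc_of_le (hpmono j)] at hs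
      have hs0 : s ∈ Set.Icc (0 : ℝ) t :=
        ⟨(hpnn j).trans hs.1.le, hs.2.trans (hple _ hj')⟩
      have hd : dist s (p (j + 1)) < δ := by
        rw [Real.dist_eq, abs_of_nonpos (by linarith [hs.2])]
        have := hpstep j
        linarith [hs.1]
      have h4 := hδB s hs0 (p (j + 1)) ⟨hpnn _, hple _ hj'⟩ hd
      rw [dist_eq_norm] at h4
      rw [norm_mul, Complex.norm_real]
      exact mul_le_mul (hM s hs0) h4.le (norm_nonneg _) hM0
  calc _ ≤ ∑ j ∈ Finset.range m, M * η * (t / m) :=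
        (norm_sum_le _ _).trans (Finset.sum_le_sum hbound)
    _ = M * t * η := by
        rw [Finset.sum_const, Finset.card_range, nsmul_eq_mul]
        field_simp
    _ < (M * t + 1) * η := by nlinarith
    _ = ε := by
        rw [hη]
        field_simp

/-- The Wiener integral of a `C¹` function against a continuous path, by integration by parts. -/
theorem wienerIntegral_eq {f : ℝ → ℝ} (hf : ContDiff ℝ 1 f) {b : ℝ≥0 → ℂ} (hb : Continuous b)
    {t : ℝ} (ht : 0 ≤ t) :
    wienerIntegral f b t = f t * b t.toNNReal - f 0 * b 0
      - ∫ s in (0 : ℝ)..t, ((deriv f s : ℝ) : ℂ) * b s.toNNReal :=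
  (tendsto_leftSum hf hb ht).limUnder_eq

/-! ### The stochastic terms

Here `α` is the roughness of the noise `⟨∇⟩^α ξ`, `β` the family of Fourier coefficients of the
cylindrical Wiener process, and `N` the truncation parameter. -/

section

variable {Ω : Type*} (α : ℝ) (β : ℤ × ℤ → ℝ≥0 → Ω → ℂ)

/-- The Fourier coefficient
`∫₀ᵗ sin((t - t')⟨n⟩) / ⟨n⟩^(1 - α) dβₙ(t')` of the stochastic convolution. -/
def convCoeff (n : ℤ × ℤ) (t : ℝ) (ω : Ω) : ℂ :=
  wienerIntegral (fun t' => Real.sin ((t - t') * jb n) / jb n ^ (1 - α)) (fun s => β n s ω) t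

/-- The truncated stochastic convolution `∑_{|n| ≤ N} convCoeff(n, t) eₙ(x)`. -/
def stochConv (N : ℕ) (ω : Ω) (t : ℝ) (x : ℝ × ℝ) : ℂ :=
  ∑ n ∈ freq N, convCoeff α β n t ω * e n x

/-- The renormalization constant, the variance of the truncated stochastic convolution:
`σ_N(t) = (4π²)⁻¹ ∑_{|n| ≤ N} ∫₀ᵗ [sin((t - t')⟨n⟩) / ⟨n⟩^(1 - α)]² dt'`. -/
def sigma (N : ℕ) (t : ℝ) : ℝ :=
  1 / (4 * Real.pi ^ 2) * ∑ n ∈ freq N,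
    ∫ t' in (0 : ℝ)..t, (Real.sin ((t - t') * jb n) / jb n ^ (1 - α)) ^ 2

/-- The truncated Wick power: the square of the truncated stochastic convolution minus `σ_N`. -/
def wickSquare (N : ℕ) (ω : Ω) (t : ℝ) (x : ℝ × ℝ) : ℂ :=
  stochConv α β N ω t x ^ 2 - sigma α N t

/-- The truncated second order stochastic term `𝓘(wickSquare)`. -/
def secondOrder (N : ℕ) (ω : Ω) : ℝ → ℝ × ℝ → ℂ :=
  duhamel (wickSquare α β N ω)

end

end SNLW

end

noncomputable section

namespace SNLW

-- Apart from a deterministic constant due to renormalization, the `n`-th Fourier coefficient of the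
-- second order term is a quadratic form in the Gaussian noise, a sum over `k` of Duhamel integrals
-- of products of the stochastic convolutions at frequencies `k` and `n - k`. Its squared
-- Hilbert--Schmidt norm is of order `∑ₖ ⟨k⟩^(2α-2) ⟨n-k⟩^(2α-2)`, and for `α ≥ 1/2` this dominates
-- the logarithmically divergent `∑ₖ ⟨k⟩⁻²` on `ℤ²`.
--
-- The lower bound on each summand comes from resonance. The two waves have frequencies `⟨k⟩` and
-- `⟨n-k⟩` that differ by at most `⟨n⟩`, so their product has a component that oscillates slowly in
-- time, and the Duhamel integral gains nothing on it. `eventually_le_sum_duhamelKernel_sq` makes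
-- this uniform in `k` by testing the kernel against `cos ⊗ cos + sin ⊗ sin`. Summands with
-- different `k` do not interfere, because the complex Brownian motions are obtained from
-- independent real ones by orthonormal rows (`compMatrix_orthonormal`, `sum_norm_quadMatrix_sq`).
--
-- A divergent variance alone does not exclude convergence, so characteristic functions are used.
-- Diagonalizing a real symmetric form `A` in standard Gaussians bounds the modulus of its
-- characteristic function at `ξ` by `(1 + 4 ξ² ‖A‖²)^(-1/4)`
-- (`norm_integral_cexp_quadraticForm_le`). Hence at every `ξ ≠ 0` the real or the imaginary part of
-- the coefficient eventually has a small characteristic function. If the coefficients converged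
-- almost surely, even after deterministic centring, these functions would converge to those of the
-- limit, which are close to `1` near `ξ = 0`: a contradiction (`not_ae_tendsto_pathQuad`).
-- Convergence is a tail event of the independent components, so Kolmogorov's zero-one law upgrades
-- "not almost surely convergent" to "almost surely not convergent" (`ae_not_tendsto_pathQuad`).
--
-- To work with finitely many Gaussians, the paths are sampled on the mesh `T/m`, and `m → ∞` is
-- taken path by path with the truncation `N` fixed. Divergence in the space of distributions
-- follows by testing against a constant function at time `T`.

-- Characteristic functions of Gaussian quadratic forms.

theorem one_add_sum_le_prod_one_add {ι : Type*} (s : Finset ι) {f : ι → ℝ} (hf : ∀ i, 0 ≤ f i) :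
    1 + ∑ i ∈ s, f i ≤ ∏ i ∈ s, (1 + f i) := by
  classical
  induction s using Finset.induction_on with
  | empty => simp
  | insert a s ha ih =>
    rw [Finset.sum_insert ha, Finset.prod_insert ha]
    have := hf a
    have h2 : 0 ≤ ∑ i ∈ s, f i := Finset.sum_nonneg fun i _ => hf i
    nlinarith [mul_le_mul_of_nonneg_left ih (by positivity : 0 ≤ 1 + f a), mul_nonneg this h2]

/-- The characteristic function of the square of a standard normal variable has modulus
`(1 + 4 c²)^(-1/4)`. -/
theorem norm_integral_cexp_sq_gaussianReal (c : ℝ) :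
    ‖∫ x, Complex.exp (Complex.I * (c * x ^ 2 : ℝ)) ∂(gaussianReal 0 1)‖ ^ 4 * (1 + 4 * c ^ 2) = 1 := by
  have h1 : (∫ x, Complex.exp (Complex.I * (c * x ^ 2 : ℝ)) ∂(gaussianReal 0 1))
      = (Real.sqrt (2 * Real.pi))⁻¹ * (Real.pi / (1 / 2 - Complex.I * c)) ^ (1 / 2 : ℂ) := by
    rw [← integral_gaussian_complex (by simp), integral_gaussianReal_eq_integral_smul (by simp),
      ← integral_const_mul]
    refine integral_congr_ae (Eventually.of_forall fun x => ?_)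
    simp only [gaussianPDFReal, NNReal.coe_one, mul_one, sub_zero, Complex.real_smul]
    push_cast
    rw [mul_assoc, ← Complex.exp_add]
    congr 2
    ring
  have h2 : ‖(1 / 2 - Complex.I * c : ℂ)‖ ^ 2 = 1 / 4 + c ^ 2 := by
    rw [← Complex.normSq_eq_norm_sq, Complex.normSq_apply]
    simp
    ring
  -- The fourth power removes both the complex square root and the square root in the modulus of
  -- `1/2 - ic`.
  have h3 : ‖((Real.pi / (1 / 2 - Complex.I * c)) ^ (1 / 2 : ℂ) : ℂ)‖ ^ 4
      = Real.pi ^ 2 / (1 / 4 + c ^ 2) := by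
    have : ‖((Real.pi / (1 / 2 - Complex.I * c)) ^ (1 / 2 : ℂ) : ℂ)‖ ^ 4
        = ‖(((Real.pi / (1 / 2 - Complex.I * c)) ^ (((2 : ℕ) : ℂ)⁻¹)) ^ 2 : ℂ)‖ ^ 2 := by
      rw [norm_pow, ← pow_mul]
      norm_num
    rw [this, Complex.cpow_nat_inv_pow _ (by norm_num), norm_div, div_pow, h2]
    simp
  rw [h1, norm_mul, mul_pow, h3, Complex.norm_real, Real.norm_of_nonneg (by positivity),
    inv_pow, show Real.sqrt (2 * Real.pi) ^ 4 = (Real.sqrt (2 * Real.pi) ^ 2) ^ 2 by ring,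
    Real.sq_sqrt (by positivity)]
  have : (0 : ℝ) < 1 / 4 + c ^ 2 := by positivity
  field_simp
  ring

/-- A Gaussian quadratic form with large Hilbert--Schmidt norm has a small characteristic
function. -/
theorem norm_integral_cexp_quadraticForm_le {ι : Type*} [Fintype ι] [DecidableEq ι]
    {A : Matrix ι ι ℝ} (hA : A.IsHermitian) (ξ : ℝ) :
    ‖∫ x : ι → ℝ, Complex.exp (Complex.I * (ξ * ∑ i, ∑ j, A i j * x i * x j : ℝ))
      ∂(Measure.pi fun _ => gaussianReal 0 1)‖ ^ 4 * (1 + 4 * ξ ^ 2 * ∑ i, ∑ j, A i j ^ 2) ≤ 1 := by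
  set μ : Measure (ι → ℝ) := Measure.pi fun _ => gaussianReal 0 1
  set b := hA.eigenvectorBasis
  set lam := hA.eigenvalues
  have hHS : ∑ i, ∑ j, A i j ^ 2 = ∑ i, lam i ^ 2 := by
    have h1 : (A * A).trace = ∑ i, ∑ j, A i j ^ 2 := by
      simp only [Matrix.trace, Matrix.diag_apply, Matrix.mul_apply]
      refine Finset.sum_congr rfl fun i _ => Finset.sum_congr rfl fun j _ => ?_
      have := hA.apply i j
      simp only [star_trivial] at this
      rw [this, sq]
    rw [← h1]
    have h2 := hA.spectral_theorem
    conv_lhs => rw [h2]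
    rw [← map_mul, Unitary.conjStarAlgAut_apply, Matrix.trace_mul_comm, ← mul_assoc]
    simp [Matrix.trace, sq, lam]
  set F : EuclideanSpace ℝ ι → ℂ := fun v =>
    Complex.exp (Complex.I * (ξ * ∑ i, ∑ j, A i j * v i * v j : ℝ)) with hF
  have hFc : Continuous F := by
    simp only [hF]
    fun_prop
  -- By rotation invariance of the standard Gaussian, the coordinates may be taken along the
  -- eigenbasis of `A`, where the form is diagonal and the integral factorizes.
  have h1 : (∫ x : ι → ℝ, Complex.exp (Complex.I * (ξ * ∑ i, ∑ j, A i j * x i * x j : ℝ)) ∂μ)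
      = ∫ x : ι → ℝ, F (∑ i, x i • b i) ∂μ := by
    have e1 : (∫ x : ι → ℝ, Complex.exp (Complex.I * (ξ * ∑ i, ∑ j, A i j * x i * x j : ℝ)) ∂μ)
        = ∫ v, F v ∂(stdGaussian (EuclideanSpace ℝ ι)) := by
      rw [← map_pi_eq_stdGaussian, integral_map (by fun_prop) hFc.aestronglyMeasurable]
    rw [e1, stdGaussian_eq_map_pi_orthonormalBasis b,
      integral_map (Measurable.aemeasurable (by fun_prop)) hFc.aestronglyMeasurable]
  have hquad : ∀ x : ι → ℝ, ∑ i, ∑ j, A i j * (∑ l, x l • b l : EuclideanSpace ℝ ι) i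
      * (∑ l, x l • b l : EuclideanSpace ℝ ι) j = ∑ l, lam l * x l ^ 2 := by
    intro x
    set v : EuclideanSpace ℝ ι := ∑ l, x l • b l with hv
    have e2 : WithLp.toLp 2 (A.mulVec v) = ∑ l, (lam l * x l) • b l := by
      have : ∀ u : EuclideanSpace ℝ ι, WithLp.toLp 2 (A.mulVec u) = Matrix.toEuclideanLin A u :=
        fun u => rfl
      rw [this, hv, map_sum]
      refine Finset.sum_congr rfl fun l _ => ?_
      rw [map_smul, ← this, hA.mulVec_eigenvectorBasis l]
      rw [WithLp.toLp_smul, smul_smul, mul_comm]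
    have e3 : ∑ i, ∑ j, A i j * v i * v j = inner ℝ v (WithLp.toLp 2 (A.mulVec v)) := by
      simp only [PiLp.inner_apply, Matrix.mulVec, dotProduct, RCLike.inner_apply, conj_trivial,
        Finset.sum_mul]
      refine Finset.sum_congr rfl fun i _ => Finset.sum_congr rfl fun j _ => ?_
      ring
    rw [e3, e2, hv, b.orthonormal.inner_sum]
    simp only [conj_trivial]
    refine Finset.sum_congr rfl fun i _ => ?_
    ring
  have h2 : (∫ x : ι → ℝ, F (∑ i, x i • b i) ∂μ)
      = ∏ l, ∫ y, Complex.exp (Complex.I * ((ξ * lam l) * y ^ 2 : ℝ)) ∂(gaussianReal 0 1) := by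
    rw [← integral_fintype_prod_eq_prod
      (f := fun l y => Complex.exp (Complex.I * ((ξ * lam l) * y ^ 2 : ℝ)))]
    refine integral_congr_ae (Eventually.of_forall fun x => ?_)
    simp only [hF]
    rw [hquad, ← Complex.exp_sum, ← Finset.mul_sum, Finset.mul_sum]
    push_cast
    congr 2
    refine Finset.sum_congr rfl fun i _ => ?_
    ring
  rw [h1, h2, norm_prod, ← Finset.prod_pow, hHS]
  -- Keeping only the constant and linear terms of the product leaves the Hilbert--Schmidt norm,
  -- with no need to control individual eigenvalues.
  have h3 : 1 + 4 * ξ ^ 2 * ∑ i, lam i ^ 2 ≤ ∏ i, (1 + 4 * (ξ * lam i) ^ 2) := by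
    rw [Finset.mul_sum]
    have := one_add_sum_le_prod_one_add Finset.univ
      (f := fun i => 4 * (ξ * lam i) ^ 2) (fun i => by positivity)
    refine le_trans (le_of_eq ?_) this
    congr 1
    refine Finset.sum_congr rfl fun i _ => ?_
    ring
  refine (mul_le_mul_of_nonneg_left h3 (by positivity)).trans (le_of_eq ?_)
  rw [← Finset.prod_mul_distrib]
  exact Finset.prod_eq_one fun i _ => norm_integral_cexp_sq_gaussianReal _

-- Right-point Riemann sums.

/-- The right end point of the cell of the mesh `T/m` containing `r > 0`. -/
def meshCeil (T : ℝ) (m : ℕ) (r : ℝ) : ℝ := ⌈r * m / T⌉₊ * (T / m)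

theorem tendsto_meshCeil {T : ℝ} (hT : 0 < T) {r : ℝ} (hr : 0 ≤ r) :
    Tendsto (fun m => meshCeil T m r) atTop (𝓝 r) := by
  have h0 : Tendsto (fun m : ℕ => r + T / m) atTop (𝓝 r) := by
    simpa using tendsto_const_nhds.add (tendsto_const_div_atTop_nhds_zero_nat T)
  refine tendsto_of_tendsto_of_tendsto_of_le_of_le' tendsto_const_nhds h0 ?_ ?_
  · filter_upwards [eventually_gt_atTop 0] with m hm
    have hm' : (0 : ℝ) < m := by exact_mod_cast hm
    have h1 := Nat.le_ceil (r * m / T)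
    calc r = r * m / T * (T / m) := by field_simp
      _ ≤ _ := mul_le_mul_of_nonneg_right h1 (by positivity)
  · filter_upwards [eventually_gt_atTop 0] with m hm
    have hm' : (0 : ℝ) < m := by exact_mod_cast hm
    have h1 := (Nat.ceil_lt_add_one (a := r * m / T) (by positivity)).le
    calc _ ≤ (r * m / T + 1) * (T / m) := mul_le_mul_of_nonneg_right h1 (by positivity)
      _ = r + T / m := by field_simp

/-- On each half-open cell `meshCeil` is constant, equal to the right end point. Writing the sum as
an integral over a fixed interval makes dominated convergence available. -/
theorem rightSum_eq_integral {F : ℝ → ℝ} {T : ℝ} (hT : 0 < T) {m : ℕ} (hm : 0 < m) :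
    T / m * ∑ j ∈ Finset.range m, F ((j + 1) * (T / m)) = ∫ r in (0 : ℝ)..T, F (meshCeil T m r) := by
  have hm' : (0 : ℝ) < m := by exact_mod_cast hm
  have hcell : ∀ j : ℕ, ∀ r ∈ Set.uIoc ((j : ℝ) * (T / m)) ((j + 1 : ℕ) * (T / m)),
      F (meshCeil T m r) = F ((j + 1) * (T / m)) := by
    intro j r hr
    rw [Set.uIoc_of_le (by gcongr; simp)] at hr
    have h1 : ⌈r * m / T⌉₊ = j + 1 := by
      rw [Nat.ceil_eq_iff (by simp)]
      constructor
      · have := hr.1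
        rw [← mul_div_assoc, div_lt_iff₀ hm'] at this
        rw [lt_div_iff₀ hT]
        simpa using this
      · have := hr.2
        rw [← mul_div_assoc, le_div_iff₀ hm'] at this
        rw [div_le_iff₀ hT]
        simpa using this
    simp only [meshCeil, h1]
    push_cast
    rfl
  have hint : ∀ j : ℕ, IntervalIntegrable (fun r => F (meshCeil T m r)) volume
      ((j : ℝ) * (T / m)) ((j + 1 : ℕ) * (T / m)) := by
    intro j
    refine (intervalIntegrable_const (c := F ((j + 1) * (T / m)))).congr ?_
    intro r hr
    exact (hcell j r hr).symm
  have h1 := intervalIntegral.sum_integral_adjacent_intervals (a := fun j : ℕ => (j : ℝ) * (T / m))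
    (n := m) (f := fun r => F (meshCeil T m r)) (μ := volume) (fun j _ => hint j)
  simp only [Nat.cast_zero, zero_mul] at h1
  rw [show (m : ℝ) * (T / m) = T by field_simp] at h1
  rw [← h1, Finset.mul_sum]
  refine Finset.sum_congr rfl fun j _ => ?_
  rw [intervalIntegral.integral_congr_ae (g := fun _ => F ((j + 1) * (T / m)))
    (Eventually.of_forall fun r hr => hcell j r hr), intervalIntegral.integral_const]
  push_cast
  rw [smul_eq_mul]
  ring

/-- Right-point Riemann sums of a bounded function with at most one discontinuity converge. -/
theorem tendsto_rightSum {F : ℝ → ℝ} {T C a : ℝ} (hT : 0 < T) (hF : Measurable F)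
    (hC : ∀ r, |F r| ≤ C) (hc : ∀ r, r ≠ a → ContinuousAt F r) :
    Tendsto (fun m : ℕ => T / m * ∑ j ∈ Finset.range m, F ((j + 1) * (T / m))) atTop
      (𝓝 (∫ r in (0 : ℝ)..T, F r)) := by
  have h1 : Tendsto (fun m : ℕ => ∫ r in (0 : ℝ)..T, F (meshCeil T m r)) atTop
      (𝓝 (∫ r in (0 : ℝ)..T, F r)) := by
    refine intervalIntegral.tendsto_integral_filter_of_dominated_convergence (fun _ => C) ?_ ?_ ?_ ?_
    · refine Eventually.of_forall fun m => Measurable.aestronglyMeasurable ?_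
      refine hF.comp ?_
      unfold meshCeil
      fun_prop
    · exact Eventually.of_forall fun m => Eventually.of_forall fun r _ => hC _
    · exact intervalIntegrable_const
    · have : ∀ᵐ r : ℝ, r ≠ a := by
        simp [ae_iff]
      filter_upwards [this] with r hr hr'
      rw [Set.uIoc_of_le hT.le] at hr'
      exact (hc r hr).tendsto.comp (tendsto_meshCeil hT hr'.1.le)
  refine h1.congr' ?_
  filter_upwards [eventually_gt_atTop 0] with m hm
  rw [rightSum_eq_integral hT hm]

-- The causal sine and its pairings with oscillating test functions.

/-- The causal sine `sin((t - r)₊ κ)`. -/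
def waveSin (κ t r : ℝ) : ℝ := Real.sin (max (t - r) 0 * κ)

theorem continuous_waveSin (κ : ℝ) : Continuous fun p : ℝ × ℝ => waveSin κ p.1 p.2 := by
  unfold waveSin
  fun_prop

theorem abs_waveSin_le (κ t r : ℝ) : |waveSin κ t r| ≤ 1 := Real.abs_sin_le_one _

theorem waveSin_of_le {κ t r : ℝ} (h : r ≤ t) : waveSin κ t r = Real.sin ((t - r) * κ) := by
  rw [waveSin, max_eq_left (by linarith)]

theorem waveSin_of_ge {κ t r : ℝ} (h : t ≤ r) : waveSin κ t r = 0 := by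
  rw [waveSin, max_eq_right (by linarith)]
  simp

/-- By the product-to-sum formula the integrand splits into a part whose phase `(T - t)κ` does not
depend on `s`, which gives the main term, and a part with phase `(t + T - 2s)κ`, whose primitive is
`O(1/κ)`. -/
theorem abs_integral_sin_mul_cos_add_le {κ : ℝ} (hκ : 0 < κ) (a t T : ℝ) :
    |(∫ s in a..t, Real.sin ((t - s) * κ) * Real.cos ((T - s) * κ))
      + (t - a) / 2 * Real.sin ((T - t) * κ)| ≤ 1 / (2 * κ) := by
  have hd : ∀ s ∈ Set.uIcc a t, HasDerivAt (fun s => -(s / 2 * Real.sin ((T - t) * κ))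
      + Real.cos ((t + T - 2 * s) * κ) / (4 * κ))
      (Real.sin ((t - s) * κ) * Real.cos ((T - s) * κ)) s := by
    intro s _
    have h1 : HasDerivAt (fun s : ℝ => (t + T - 2 * s) * κ) (-(2 * 1) * κ) s :=
      (((hasDerivAt_id s).const_mul 2).const_sub (t + T)).mul_const κ
    have h2 := ((((hasDerivAt_id s).div_const 2).mul_const (Real.sin ((T - t) * κ))).neg).add
      (h1.cos.div_const (4 * κ))
    refine h2.congr_deriv ?_
    have e1 : (t + T - 2 * s) * κ = (t - s) * κ + (T - s) * κ := by ring
    have e2 : (T - t) * κ = (T - s) * κ - (t - s) * κ := by ring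
    rw [e1, e2, Real.sin_add, Real.sin_sub]
    field_simp
    ring
  rw [intervalIntegral.integral_eq_sub_of_hasDerivAt hd
    (Continuous.intervalIntegrable (by fun_prop) _ _)]
  have h1 := Real.abs_cos_le_one ((t + T - 2 * t) * κ)
  have h2 := Real.abs_cos_le_one ((t + T - 2 * a) * κ)
  have h3 : (1 : ℝ) / (2 * κ) = 1 / (4 * κ) + 1 / (4 * κ) := by field_simp; ring
  have h4 : ∀ x : ℝ, |x| ≤ 1 → |x / (4 * κ)| ≤ 1 / (4 * κ) := by
    intro x hx
    rw [abs_div, abs_of_pos (by positivity : 0 < 4 * κ)]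
    gcongr
  have h5 := abs_le.1 (h4 _ h1)
  have h6 := abs_le.1 (h4 _ h2)
  rw [abs_le]
  constructor <;> linarith [h5.1, h5.2, h6.1, h6.2]

theorem abs_integral_sin_mul_sin_sub_le {κ : ℝ} (hκ : 0 < κ) (a t T : ℝ) :
    |(∫ s in a..t, Real.sin ((t - s) * κ) * Real.sin ((T - s) * κ))
      - (t - a) / 2 * Real.cos ((T - t) * κ)| ≤ 1 / (2 * κ) := by
  have hd : ∀ s ∈ Set.uIcc a t, HasDerivAt (fun s => s / 2 * Real.cos ((T - t) * κ)
      + Real.sin ((t + T - 2 * s) * κ) / (4 * κ))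
      (Real.sin ((t - s) * κ) * Real.sin ((T - s) * κ)) s := by
    intro s _
    have h1 : HasDerivAt (fun s : ℝ => (t + T - 2 * s) * κ) (-(2 * 1) * κ) s :=
      (((hasDerivAt_id s).const_mul 2).const_sub (t + T)).mul_const κ
    have h2 := (((hasDerivAt_id s).div_const 2).mul_const (Real.cos ((T - t) * κ))).add
      (h1.sin.div_const (4 * κ))
    refine h2.congr_deriv ?_
    have e1 : (t + T - 2 * s) * κ = (t - s) * κ + (T - s) * κ := by ring
    have e2 : (T - t) * κ = (T - s) * κ - (t - s) * κ := by ring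
    rw [e1, e2, Real.cos_add, Real.cos_sub]
    field_simp
    ring
  rw [intervalIntegral.integral_eq_sub_of_hasDerivAt hd
    (Continuous.intervalIntegrable (by fun_prop) _ _)]
  have h1 := Real.abs_sin_le_one ((t + T - 2 * t) * κ)
  have h2 := Real.abs_sin_le_one ((t + T - 2 * a) * κ)
  have h3 : (1 : ℝ) / (2 * κ) = 1 / (4 * κ) + 1 / (4 * κ) := by field_simp; ring
  have h4 : ∀ x : ℝ, |x| ≤ 1 → |x / (4 * κ)| ≤ 1 / (4 * κ) := by
    intro x hx
    rw [abs_div, abs_of_pos (by positivity : 0 < 4 * κ)]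
    gcongr
  have h5 := abs_le.1 (h4 _ h1)
  have h6 := abs_le.1 (h4 _ h2)
  rw [abs_le]
  constructor <;> linarith [h5.1, h5.2, h6.1, h6.2]

/-- The pairing of the causal sine with a function on `[a, ∞)`. -/
theorem integral_waveSin_mul_indicator {f : ℝ → ℝ} (hf : Continuous f) {κ a t T : ℝ} (ha : 0 ≤ a)
    (hat : a ≤ t) (htT : t ≤ T) :
    ∫ r in (0 : ℝ)..T, waveSin κ t r * (Set.Ici a).indicator f r
      = ∫ r in a..t, Real.sin ((t - r) * κ) * f r := by
  have hm : Measurable fun r => waveSin κ t r * (Set.Ici a).indicator f r := by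
    refine Measurable.mul ?_ (hf.measurable.indicator measurableSet_Ici)
    exact ((continuous_waveSin κ).comp (Continuous.prodMk_right t)).measurable
  have e1 : Set.EqOn (fun r => waveSin κ t r * (Set.Ici a).indicator f r) (fun _ => 0)
      (Set.uIoo 0 a) := by
    intro r hr
    rw [Set.uIoo_of_le ha] at hr
    simp [Set.indicator_of_notMem (show r ∉ Set.Ici a by simpa using hr.2)]
  have e2 : Set.EqOn (fun r => waveSin κ t r * (Set.Ici a).indicator f r)
      (fun r => Real.sin ((t - r) * κ) * f r) (Set.uIoo a t) := by
    intro r hr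
    rw [Set.uIoo_of_le hat] at hr
    simp only [Set.indicator_of_mem (show r ∈ Set.Ici a from hr.1.le), waveSin_of_le hr.2.le]
  have e3 : Set.EqOn (fun r => waveSin κ t r * (Set.Ici a).indicator f r) (fun _ => 0)
      (Set.uIoo t T) := by
    intro r hr
    rw [Set.uIoo_of_le htT] at hr
    simp [waveSin_of_ge hr.1.le]
  have i1 : IntervalIntegrable (fun r => waveSin κ t r * (Set.Ici a).indicator f r) volume 0 a :=
    (intervalIntegrable_const (c := (0 : ℝ))).congr_uIoo e1.symm
  have i2 : IntervalIntegrable (fun r => waveSin κ t r * (Set.Ici a).indicator f r) volume a t :=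
    (Continuous.intervalIntegrable (by fun_prop) _ _).congr_uIoo e2.symm
  have i3 : IntervalIntegrable (fun r => waveSin κ t r * (Set.Ici a).indicator f r) volume t T :=
    (intervalIntegrable_const (c := (0 : ℝ))).congr_uIoo e3.symm
  rw [← intervalIntegral.integral_add_adjacent_intervals (i1.trans i2) i3,
    ← intervalIntegral.integral_add_adjacent_intervals i1 i2,
    intervalIntegral.integral_congr_uIoo e1, intervalIntegral.integral_congr_uIoo e2,
    intervalIntegral.integral_congr_uIoo e3]
  simp

theorem integral_waveSin_mul_indicator_of_le {f : ℝ → ℝ} {κ a t T : ℝ} (hta : t ≤ a) :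
    ∫ r in (0 : ℝ)..T, waveSin κ t r * (Set.Ici a).indicator f r = 0 := by
  rw [intervalIntegral.integral_congr (g := fun _ => 0)]
  · simp
  · intro r _
    by_cases h : a ≤ r
    · simp [waveSin_of_ge (hta.trans h)]
    · simp [Set.indicator_of_notMem (show r ∉ Set.Ici a by simpa using h)]

@[fun_prop]
theorem continuous_waveSin_left (κ s : ℝ) : Continuous fun t => waveSin κ t s := by
  unfold waveSin
  fun_prop

@[fun_prop]
theorem continuous_waveSin_right (κ t : ℝ) : Continuous fun s => waveSin κ t s := by
  unfold waveSin
  fun_prop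

/-- The limit of the pairings of the causal sine with a test function on `[a, ∞)`. -/
def pairing (T a κ : ℝ) (f : ℝ → ℝ) (t : ℝ) : ℝ :=
  ∫ r in (0 : ℝ)..T, waveSin κ t r * (Set.Ici a).indicator f r

/-- Right-point sums approximating `pairing`. -/
def pairingSum (T a κ : ℝ) (f : ℝ → ℝ) (m : ℕ) (t : ℝ) : ℝ :=
  T / m * ∑ j ∈ Finset.range m,
    waveSin κ t ((j + 1) * (T / m)) * (Set.Ici a).indicator f ((j + 1) * (T / m))

theorem abs_indicator_le_one {f : ℝ → ℝ} (hf1 : ∀ r, |f r| ≤ 1) (a r : ℝ) :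
    |(Set.Ici a).indicator f r| ≤ 1 := by
  by_cases h : r ∈ Set.Ici a
  · rw [Set.indicator_of_mem h]
    exact hf1 r
  · rw [Set.indicator_of_notMem h]
    simp

theorem abs_waveSin_mul_indicator_le {f : ℝ → ℝ} (hf1 : ∀ r, |f r| ≤ 1) (κ t a r : ℝ) :
    |waveSin κ t r * (Set.Ici a).indicator f r| ≤ 1 := by
  rw [abs_mul]
  exact mul_le_one₀ (abs_waveSin_le _ _ _) (abs_nonneg _) (abs_indicator_le_one hf1 a r)

theorem measurable_waveSin_mul_indicator {f : ℝ → ℝ} (hf : Continuous f) (κ t a : ℝ) :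
    Measurable fun r => waveSin κ t r * (Set.Ici a).indicator f r := by
  refine Measurable.mul ?_ (hf.measurable.indicator measurableSet_Ici)
  exact (continuous_waveSin_right κ t).measurable

theorem tendsto_pairingSum {f : ℝ → ℝ} (hf : Continuous f) (hf1 : ∀ r, |f r| ≤ 1) {T : ℝ}
    (hT : 0 < T) (a κ t : ℝ) :
    Tendsto (fun m => pairingSum T a κ f m t) atTop (𝓝 (pairing T a κ f t)) := by
  refine tendsto_rightSum (F := fun r => waveSin κ t r * (Set.Ici a).indicator f r) (C := 1)
    (a := a) hT (measurable_waveSin_mul_indicator hf κ t a)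
    (abs_waveSin_mul_indicator_le hf1 κ t a) ?_
  intro r hr
  have h1 : ContinuousAt (fun r => waveSin κ t r) r :=
    (continuous_waveSin_right κ t).continuousAt
  refine h1.mul ?_
  rcases lt_or_gt_of_ne hr with h | h
  · refine (continuousAt_const (y := (0 : ℝ))).congr ?_
    filter_upwards [Iio_mem_nhds h] with x hx
    rw [Set.indicator_of_notMem (by simpa using hx)]
  · refine hf.continuousAt.congr ?_
    filter_upwards [Ioi_mem_nhds h] with x hx
    rw [Set.indicator_of_mem (Set.Ioi_subset_Ici_self hx)]

theorem continuous_pairing {f : ℝ → ℝ} (hf : Continuous f) (hf1 : ∀ r, |f r| ≤ 1) (T a κ : ℝ) :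
    Continuous (pairing T a κ f) := by
  refine intervalIntegral.continuous_of_dominated_interval (bound := fun _ => 1) ?_ ?_ ?_ ?_
  · exact fun t => (measurable_waveSin_mul_indicator hf κ t a).aestronglyMeasurable
  · exact fun t => Eventually.of_forall fun r _ => abs_waveSin_mul_indicator_le hf1 κ t a r
  · exact intervalIntegrable_const
  · refine Eventually.of_forall fun r _ => (continuous_waveSin_left κ r).mul continuous_const

theorem continuous_pairingSum (f : ℝ → ℝ) (T a κ : ℝ) (m : ℕ) :
    Continuous (pairingSum T a κ f m) := by
  unfold pairingSum
  fun_prop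

theorem abs_pairingSum_le {f : ℝ → ℝ} (hf1 : ∀ r, |f r| ≤ 1) {T : ℝ} (hT : 0 < T) (a κ : ℝ) (m : ℕ)
    (t : ℝ) : |pairingSum T a κ f m t| ≤ T := by
  rcases Nat.eq_zero_or_pos m with rfl | hm
  · simp [pairingSum, hT.le]
  have hm' : (0 : ℝ) < m := by exact_mod_cast hm
  rw [pairingSum, abs_mul, abs_of_pos (by positivity)]
  calc T / m * _ ≤ T / m * ∑ j ∈ Finset.range m, (1 : ℝ) := by
        gcongr
        refine (Finset.abs_sum_le_sum_abs _ _).trans (Finset.sum_le_sum fun j _ => ?_)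
        exact abs_waveSin_mul_indicator_le hf1 _ _ _ _
    _ = T := by
        simp
        field_simp

/-- With `d = (t - a)/2`, the cosine pairings are `-d sin((T - t)κ)` and `-d sin((T - t)l)`, and the
sine pairings `d cos((T - t)κ)` and `d cos((T - t)l)`, up to `O(1/L)`. Each product separately
contains the fast phase `κ + l`; in the sum it cancels and only the difference `κ - l` survives. -/
theorem abs_pairing_products_sub_le {T a t κ l L : ℝ} (ha : 0 ≤ a) (hat : a ≤ t) (htT : t ≤ T)
    (hL : 1 ≤ L) (hκ : L ≤ κ) (hl : L ≤ l) :
    |pairing T a κ (fun r => Real.cos ((T - r) * κ)) t * pairing T a l (fun r => Real.cos ((T - r) * l)) t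
      + pairing T a κ (fun r => Real.sin ((T - r) * κ)) t * pairing T a l (fun r => Real.sin ((T - r) * l)) t
      - (t - a) ^ 2 / 4 * Real.cos ((T - t) * (κ - l))| ≤ (t - a + 1) / L := by
  unfold pairing
  rw [integral_waveSin_mul_indicator (by fun_prop) ha hat htT,
    integral_waveSin_mul_indicator (by fun_prop) ha hat htT,
    integral_waveSin_mul_indicator (by fun_prop) ha hat htT,
    integral_waveSin_mul_indicator (by fun_prop) ha hat htT]
  have hL0 : 0 < L := by linarith
  have hb : ∀ x, L ≤ x → 1 / (2 * x) ≤ 1 / (2 * L) := fun x hx => by gcongr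
  have b1 := (abs_integral_sin_mul_cos_add_le (by linarith : 0 < κ) a t T).trans (hb κ hκ)
  have b2 := (abs_integral_sin_mul_cos_add_le (by linarith : 0 < l) a t T).trans (hb l hl)
  have b3 := (abs_integral_sin_mul_sin_sub_le (by linarith : 0 < κ) a t T).trans (hb κ hκ)
  have b4 := (abs_integral_sin_mul_sin_sub_le (by linarith : 0 < l) a t T).trans (hb l hl)
  set p1 := ∫ s in a..t, Real.sin ((t - s) * κ) * Real.cos ((T - s) * κ)
  set p2 := ∫ s in a..t, Real.sin ((t - s) * l) * Real.cos ((T - s) * l)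
  set p3 := ∫ s in a..t, Real.sin ((t - s) * κ) * Real.sin ((T - s) * κ)
  set p4 := ∫ s in a..t, Real.sin ((t - s) * l) * Real.sin ((T - s) * l)
  set d := (t - a) / 2 with hd
  have hd0 : 0 ≤ d := by rw [hd]; linarith
  set h := 1 / (2 * L) with hh
  have hh0 : 0 ≤ h := by positivity
  have c1 := Real.abs_sin_le_one ((T - t) * κ)
  have c2 := Real.abs_sin_le_one ((T - t) * l)
  have c3 := Real.abs_cos_le_one ((T - t) * κ)
  have c4 := Real.abs_cos_le_one ((T - t) * l)
  have hcos : Real.cos ((T - t) * (κ - l)) = Real.cos ((T - t) * κ) * Real.cos ((T - t) * l)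
      + Real.sin ((T - t) * κ) * Real.sin ((T - t) * l) := by
    rw [mul_sub, Real.cos_sub]
  set e1 := p1 + d * Real.sin ((T - t) * κ)
  set e2 := p2 + d * Real.sin ((T - t) * l)
  set e3 := p3 - d * Real.cos ((T - t) * κ)
  set e4 := p4 - d * Real.cos ((T - t) * l)
  have key : p1 * p2 + p3 * p4 - (t - a) ^ 2 / 4 * Real.cos ((T - t) * (κ - l))
      = (-(d * (Real.sin ((T - t) * κ) * e2)) - d * (Real.sin ((T - t) * l) * e1) + e1 * e2)
        + (d * (Real.cos ((T - t) * κ) * e4) + d * (Real.cos ((T - t) * l) * e3) + e3 * e4) := by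
    rw [hcos]
    simp only [e1, e2, e3, e4, hd]
    ring
  have hm : ∀ x y : ℝ, |x| ≤ 1 → |y| ≤ h → |d * (x * y)| ≤ d * h := by
    intro x y hx hy
    rw [abs_mul, abs_mul, abs_of_nonneg hd0]
    have : |x| * |y| ≤ 1 * h := mul_le_mul hx hy (abs_nonneg _) (by norm_num)
    nlinarith
  have hm2 : ∀ x y : ℝ, |x| ≤ h → |y| ≤ h → |x * y| ≤ h * h := by
    intro x y hx hy
    rw [abs_mul]
    exact mul_le_mul hx hy (abs_nonneg _) hh0
  have f1 := abs_le.1 (hm _ _ c1 b2)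
  have f2 := abs_le.1 (hm _ _ c2 b1)
  have f3 := abs_le.1 (hm2 _ _ b1 b2)
  have f4 := abs_le.1 (hm _ _ c3 b4)
  have f5 := abs_le.1 (hm _ _ c4 b3)
  have f6 := abs_le.1 (hm2 _ _ b3 b4)
  have htot : 4 * (d * h) + 2 * (h * h) ≤ (t - a + 1) / L := by
    have h1 : h ≤ 1 := by
      rw [hh, div_le_one (by positivity)]
      linarith
    have h2 : (t - a + 1) / L = 4 * (d * h) + 2 * h := by
      rw [hd, hh]
      field_simp
      ring
    rw [h2]
    nlinarith
  rw [key, abs_le]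
  constructor <;> linarith [f1.1, f1.2, f2.1, f2.2, f3.1, f3.2, f4.1, f4.2, f5.1, f5.2, f6.1, f6.2]

-- The Duhamel kernel and its resonant lower bound.

/-- The kernel of the Duhamel integral of the product of two stochastic convolutions, as a double
Wiener integral. -/
def duhamelKernel (l₀ T κ l s s' : ℝ) : ℝ :=
  ∫ t in (0 : ℝ)..T, Real.sin ((T - t) * l₀) / l₀ * (waveSin κ t s * waveSin l t s')

/-- For fixed `t` the integrand of the kernel is a product in `s` and `s'`, so testing against a
tensor product factorizes under the time integral. -/
theorem sum_duhamelKernel_mul (l₀ T a κ l : ℝ) (f g : ℝ → ℝ) (m : ℕ) :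
    (T / m) ^ 2 * ∑ i ∈ Finset.range m, ∑ j ∈ Finset.range m,
      duhamelKernel l₀ T κ l ((i + 1) * (T / m)) ((j + 1) * (T / m))
        * ((Set.Ici a).indicator f ((i + 1) * (T / m)) * (Set.Ici a).indicator g ((j + 1) * (T / m)))
      = ∫ t in (0 : ℝ)..T, Real.sin ((T - t) * l₀) / l₀ *
          (pairingSum T a κ f m t * pairingSum T a l g m t) := by
  set S : ℝ → ℝ := fun t => Real.sin ((T - t) * l₀) / l₀ with hS
  have hSc : Continuous S := by fun_prop
  have h1 : ∀ t, S t * (pairingSum T a κ f m t * pairingSum T a l g m t)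
      = ∑ i ∈ Finset.range m, ∑ j ∈ Finset.range m,
        (S t * (waveSin κ t ((i + 1) * (T / m)) * waveSin l t ((j + 1) * (T / m)))) *
        ((T / m) ^ 2 * ((Set.Ici a).indicator f ((i + 1) * (T / m))
          * (Set.Ici a).indicator g ((j + 1) * (T / m)))) := by
    intro t
    rw [pairingSum, pairingSum, mul_mul_mul_comm, Finset.sum_mul_sum, Finset.mul_sum,
      Finset.mul_sum]
    refine Finset.sum_congr rfl fun i _ => ?_
    rw [Finset.mul_sum, Finset.mul_sum]
    refine Finset.sum_congr rfl fun j _ => ?_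
    ring
  have h2 : (∫ t in (0 : ℝ)..T, S t * (pairingSum T a κ f m t * pairingSum T a l g m t))
      = ∫ t in (0 : ℝ)..T, ∑ i ∈ Finset.range m, ∑ j ∈ Finset.range m,
        (S t * (waveSin κ t ((i + 1) * (T / m)) * waveSin l t ((j + 1) * (T / m)))) *
        ((T / m) ^ 2 * ((Set.Ici a).indicator f ((i + 1) * (T / m))
          * (Set.Ici a).indicator g ((j + 1) * (T / m)))) :=
    intervalIntegral.integral_congr fun t _ => h1 t
  have hci : ∀ s s' c, Continuous fun t => S t * (waveSin κ t s * waveSin l t s') * c := by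
    intro s s' c
    fun_prop
  rw [h2, intervalIntegral.integral_finsetSum fun i _ => Continuous.intervalIntegrable
    (continuous_finsetSum _ fun j _ => hci _ _ _) _ _, Finset.mul_sum]
  refine Finset.sum_congr rfl fun i _ => ?_
  rw [intervalIntegral.integral_finsetSum fun j _ => Continuous.intervalIntegrable
    (hci _ _ _) _ _, Finset.mul_sum]
  refine Finset.sum_congr rfl fun j _ => ?_
  rw [intervalIntegral.integral_mul_const]
  unfold duhamelKernel
  ring

theorem tendsto_integral_pairingSum_mul {f g : ℝ → ℝ} (hf : Continuous f) (hf1 : ∀ r, |f r| ≤ 1)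
    (hg : Continuous g) (hg1 : ∀ r, |g r| ≤ 1) {T : ℝ} (hT : 0 < T) (l₀ a κ l : ℝ) :
    Tendsto (fun m => ∫ t in (0 : ℝ)..T, Real.sin ((T - t) * l₀) / l₀ *
        (pairingSum T a κ f m t * pairingSum T a l g m t)) atTop
      (𝓝 (∫ t in (0 : ℝ)..T, Real.sin ((T - t) * l₀) / l₀ *
        (pairing T a κ f t * pairing T a l g t))) := by
  have hS : Continuous fun t => Real.sin ((T - t) * l₀) / l₀ := by fun_prop
  refine intervalIntegral.tendsto_integral_filter_of_dominated_convergence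
    (fun t => |Real.sin ((T - t) * l₀) / l₀| * (T * T)) ?_ ?_ ?_ ?_
  · exact Eventually.of_forall fun m => (hS.mul ((continuous_pairingSum _ _ _ _ _).mul
      (continuous_pairingSum _ _ _ _ _))).aestronglyMeasurable
  · refine Eventually.of_forall fun m => Eventually.of_forall fun t _ => ?_
    rw [norm_mul, norm_mul]
    simp only [Real.norm_eq_abs]
    gcongr
    · exact abs_pairingSum_le hf1 hT _ _ _ _
    · exact abs_pairingSum_le hg1 hT _ _ _ _
  · exact Continuous.intervalIntegrable (by fun_prop) _ _
  · refine Eventually.of_forall fun t _ => ?_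
    exact tendsto_const_nhds.mul ((tendsto_pairingSum hf hf1 hT _ _ _).mul
      (tendsto_pairingSum hg hg1 hT _ _ _))

theorem half_le_sin {x : ℝ} (h0 : 0 ≤ x) (h1 : x ≤ 1) : x / 2 ≤ Real.sin x := by
  have h2 := Real.mul_le_sin h0 (h1.trans (by linarith [Real.pi_gt_three]))
  refine le_trans ?_ h2
  have h3 : (1 : ℝ) / 2 ≤ 2 / Real.pi := by
    rw [div_le_div_iff₀ (by norm_num) Real.pi_pos]
    linarith [Real.pi_le_four]
  nlinarith

theorem half_le_cos {x : ℝ} (h : |x| ≤ 1) : 1 / 2 ≤ Real.cos x := by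
  have h1 := Real.one_sub_sq_div_two_le_cos (x := x)
  have h2 : x ^ 2 ≤ 1 := by
    rw [← sq_abs]
    exact pow_le_one₀ (abs_nonneg _) h
  linarith

/-- The limit of the pairing of the Duhamel kernel with the resonant test function. -/
theorem resonant_pairing_lower_bound {T l₀ δ κ l L : ℝ} (hl₀ : 0 < l₀) (hδ : 0 < δ) (hδT : δ ≤ T)
    (hδl : δ * l₀ ≤ 1) (hL : 1 ≤ L) (hκ : L ≤ κ) (hl : L ≤ l) (hκl : |κ - l| ≤ l₀) :
    δ ^ 4 / 192 - δ ^ 2 * (δ + 1) / L ≤ ∫ t in (0 : ℝ)..T, Real.sin ((T - t) * l₀) / l₀ *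
      (pairing T (T - δ) κ (fun r => Real.cos ((T - r) * κ)) t
          * pairing T (T - δ) l (fun r => Real.cos ((T - r) * l)) t
        + pairing T (T - δ) κ (fun r => Real.sin ((T - r) * κ)) t
          * pairing T (T - δ) l (fun r => Real.sin ((T - r) * l)) t) := by
  set a := T - δ with ha
  have ha0 : 0 ≤ a := by linarith
  have haT : a ≤ T := by linarith
  have hL0 : 0 < L := by linarith
  set G : ℝ → ℝ := fun t => pairing T a κ (fun r => Real.cos ((T - r) * κ)) t
          * pairing T a l (fun r => Real.cos ((T - r) * l)) t
        + pairing T a κ (fun r => Real.sin ((T - r) * κ)) t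
          * pairing T a l (fun r => Real.sin ((T - r) * l)) t with hG
  have hGc : Continuous G := by
    have hcos : ∀ x : ℝ, Continuous (pairing T a x (fun r => Real.cos ((T - r) * x))) :=
      fun x => continuous_pairing (by fun_prop) (fun r => Real.abs_cos_le_one _) _ _ _
    have hsin : ∀ x : ℝ, Continuous (pairing T a x (fun r => Real.sin ((T - r) * x))) :=
      fun x => continuous_pairing (by fun_prop) (fun r => Real.abs_sin_le_one _) _ _ _
    exact ((hcos κ).mul (hcos l)).add ((hsin κ).mul (hsin l))
  have hSG : Continuous fun t => Real.sin ((T - t) * l₀) / l₀ * G t := by fun_prop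
  have h0 : ∫ t in (0 : ℝ)..a, Real.sin ((T - t) * l₀) / l₀ * G t = 0 := by
    rw [intervalIntegral.integral_congr (g := fun _ => 0)]
    · simp
    · intro t ht
      rw [Set.uIcc_of_le ha0] at ht
      simp [hG, pairing, integral_waveSin_mul_indicator_of_le ht.2]
  rw [← intervalIntegral.integral_add_adjacent_intervals (hSG.intervalIntegrable 0 a)
    (hSG.intervalIntegrable a T), h0, zero_add]
  -- The pointwise lower bound: `(T - t)/2` bounds the Duhamel factor, and `(t - a)²/8` the main
  -- term of `G`. The integral of `(T - t)(t - a)²` over `[a, T]` is `δ⁴/12`.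
  have hpoly : ∫ t in a..T, ((T - t) * (t - a) ^ 2 / 16 - δ * (δ + 1) / L)
      = δ ^ 4 / 192 - δ ^ 2 * (δ + 1) / L := by
    have hd : ∀ t ∈ Set.uIcc a T, HasDerivAt (fun t => (δ * (t - a) ^ 3 / 3 - (t - a) ^ 4 / 4) / 16
        - δ * (δ + 1) / L * t) ((T - t) * (t - a) ^ 2 / 16 - δ * (δ + 1) / L) t := by
      intro t _
      have h1 := (hasDerivAt_id t).sub_const a
      have h2 := (((((h1.pow 3).const_mul δ).div_const 3).sub ((h1.pow 4).div_const 4)).div_const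
        16).sub ((hasDerivAt_id t).const_mul (δ * (δ + 1) / L))
      refine h2.congr_deriv ?_
      simp only [id, ha]
      ring
    rw [intervalIntegral.integral_eq_sub_of_hasDerivAt hd
      (Continuous.intervalIntegrable (by fun_prop) _ _)]
    simp only [ha]
    field_simp
    ring
  rw [← hpoly]
  refine intervalIntegral.integral_mono_on haT (Continuous.intervalIntegrable (by fun_prop) _ _)
    (hSG.intervalIntegrable a T) fun t ht => ?_
  have hTt : 0 ≤ T - t := by linarith [ht.2]
  have hTtδ : T - t ≤ δ := by linarith [ht.1]
  have hta : 0 ≤ t - a := by linarith [ht.1]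
  have hx0 : 0 ≤ (T - t) * l₀ := by positivity
  have hx1 : (T - t) * l₀ ≤ 1 := le_trans (by gcongr) hδl
  have hS1 : (T - t) / 2 ≤ Real.sin ((T - t) * l₀) / l₀ := by
    rw [le_div_iff₀ hl₀]
    have := half_le_sin hx0 hx1
    linarith
  have hS2 : Real.sin ((T - t) * l₀) / l₀ ≤ δ := by
    rw [div_le_iff₀ hl₀]
    exact (Real.sin_le hx0).trans (by gcongr)
  have hcos : 1 / 2 ≤ Real.cos ((T - t) * (κ - l)) := by
    refine half_le_cos ?_
    rw [abs_mul, abs_of_nonneg hTt]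
    exact le_trans (by gcongr) hx1
  have hGb := (abs_le.1 (abs_pairing_products_sub_le ha0 ht.1 ht.2 hL hκ hl)).1
  have hG1 : (t - a) ^ 2 / 8 - (δ + 1) / L ≤ G t := by
    have e1 : (t - a + 1) / L ≤ (δ + 1) / L := by
      gcongr
      linarith [ht.2]
    have e2 : (t - a) ^ 2 / 8 ≤ (t - a) ^ 2 / 4 * Real.cos ((T - t) * (κ - l)) := by
      nlinarith [sq_nonneg (t - a)]
    simp only [hG]
    linarith
  have hS0 : 0 ≤ Real.sin ((T - t) * l₀) / l₀ := le_trans (by linarith) hS1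
  calc (T - t) * (t - a) ^ 2 / 16 - δ * (δ + 1) / L
      = (T - t) / 2 * ((t - a) ^ 2 / 8) - δ * ((δ + 1) / L) := by ring
    _ ≤ Real.sin ((T - t) * l₀) / l₀ * ((t - a) ^ 2 / 8)
        - Real.sin ((T - t) * l₀) / l₀ * ((δ + 1) / L) := by
        gcongr
    _ = Real.sin ((T - t) * l₀) / l₀ * ((t - a) ^ 2 / 8 - (δ + 1) / L) := by ring
    _ ≤ _ := mul_le_mul_of_nonneg_left hG1 hS0

/-- The Duhamel integral does not gain on the product of two high frequency waves: the
Hilbert--Schmidt norm of its (discretized) kernel is bounded below. -/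
theorem eventually_le_sum_duhamelKernel_sq {T l₀ : ℝ} (hT : 0 < T) (hl₀ : 0 < l₀) :
    ∃ c > 0, ∃ L ≥ 1, ∀ κ l : ℝ, L ≤ κ → L ≤ l → |κ - l| ≤ l₀ → ∀ᶠ m : ℕ in atTop,
      c ≤ (T / m) ^ 2 * ∑ i ∈ Finset.range m, ∑ j ∈ Finset.range m,
        duhamelKernel l₀ T κ l ((i + 1) * (T / m)) ((j + 1) * (T / m)) ^ 2 := by
  -- The window `[T - δ, T]` is so short that both `(T - t) l₀` and `(T - t)|κ - l|` stay at most
  -- `1`: the Duhamel sine is then comparable to its argument and the resonant cosine is at least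
  -- `1/2`.
  set δ := min T (1 / l₀) with hδ
  have hδ0 : 0 < δ := by positivity
  have hδT : δ ≤ T := min_le_left _ _
  have hδl : δ * l₀ ≤ 1 := by
    rw [← le_div_iff₀ hl₀]
    exact min_le_right _ _
  set c₀ := δ ^ 4 / 384 with hc₀
  have hc₀0 : 0 < c₀ := by positivity
  -- This threshold makes the `O(1/L)` error at most half of the main term `δ⁴/192`.
  set L := max 1 (384 * (δ + 1) / δ ^ 2) with hL
  have hL1 : 1 ≤ L := le_max_left _ _
  have hL2 : 384 * (δ + 1) / δ ^ 2 ≤ L := le_max_right _ _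
  have hJ0 : c₀ ≤ δ ^ 4 / 192 - δ ^ 2 * (δ + 1) / L := by
    have : δ ^ 2 * (δ + 1) / L ≤ δ ^ 4 / 384 := by
      rw [div_le_iff₀ (by linarith)]
      rw [div_le_iff₀ (by positivity)] at hL2
      nlinarith [sq_nonneg δ]
    rw [hc₀]
    linarith
  -- Cauchy--Schwarz against the test function `H`: the pairing is at least `c₀/2` for large `m`,
  -- and `|H| ≤ 2` gives `(T/m)² ∑ H² ≤ 4T²`.
  refine ⟨(c₀ / 2) ^ 2 / (4 * T ^ 2), by positivity, L, hL1, fun κ l hκ hl hκl => ?_⟩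
  set a := T - δ with ha
  have hJ := hJ0.trans (resonant_pairing_lower_bound hl₀ hδ0 hδT hδl hL1 hκ hl hκl)
  rw [← ha] at hJ
  set fc : ℝ → ℝ → ℝ := fun x r => Real.cos ((T - r) * x) with hfc
  set fs : ℝ → ℝ → ℝ := fun x r => Real.sin ((T - r) * x) with hfs
  have hfcc : ∀ x, Continuous (fc x) := fun x => by simp only [hfc]; fun_prop
  have hfsc : ∀ x, Continuous (fs x) := fun x => by simp only [hfs]; fun_prop
  have hfc1 : ∀ x r, |fc x r| ≤ 1 := fun x r => Real.abs_cos_le_one _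
  have hfs1 : ∀ x r, |fs x r| ≤ 1 := fun x r => Real.abs_sin_le_one _
  have hlim := (tendsto_integral_pairingSum_mul (hfcc κ) (hfc1 κ) (hfcc l) (hfc1 l) hT l₀ a κ l).add
    (tendsto_integral_pairingSum_mul (hfsc κ) (hfs1 κ) (hfsc l) (hfs1 l) hT l₀ a κ l)
  have hlimit : c₀ ≤ (∫ t in (0 : ℝ)..T, Real.sin ((T - t) * l₀) / l₀ *
        (pairing T a κ (fc κ) t * pairing T a l (fc l) t))
      + ∫ t in (0 : ℝ)..T, Real.sin ((T - t) * l₀) / l₀ *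
        (pairing T a κ (fs κ) t * pairing T a l (fs l) t) := by
    refine hJ.trans (le_of_eq ?_)
    have h1 := fun x => continuous_pairing (hfcc x) (hfc1 x) T a x
    have h2 := fun x => continuous_pairing (hfsc x) (hfs1 x) T a x
    have h3 := h1 κ
    have h4 := h1 l
    have h5 := h2 κ
    have h6 := h2 l
    rw [← intervalIntegral.integral_add (Continuous.intervalIntegrable (by fun_prop) _ _)
      (Continuous.intervalIntegrable (by fun_prop) _ _)]
    refine intervalIntegral.integral_congr fun t _ => ?_
    simp only [mul_add]
    rfl
  filter_upwards [hlim.eventually (eventually_ge_nhds (lt_of_lt_of_le (half_lt_self hc₀0) hlimit)),eventually_gt_atTop 0]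
    with m hm hm0
  have hm' : (0 : ℝ) < m := by exact_mod_cast hm0
  set s : ℕ → ℝ := fun i => (i + 1) * (T / m) with hs
  set Q : ℕ × ℕ → ℝ := fun p => duhamelKernel l₀ T κ l (s p.1) (s p.2) with hQ
  set H : ℕ × ℕ → ℝ := fun p => (Set.Ici a).indicator (fc κ) (s p.1) * (Set.Ici a).indicator (fc l) (s p.2)
    + (Set.Ici a).indicator (fs κ) (s p.1) * (Set.Ici a).indicator (fs l) (s p.2) with hH
  have hJm : c₀ / 2 ≤ (T / m) ^ 2 * ∑ p ∈ Finset.range m ×ˢ Finset.range m, Q p * H p := by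
    refine hm.trans (le_of_eq ?_)
    rw [← sum_duhamelKernel_mul, ← sum_duhamelKernel_mul, ← mul_add, Finset.sum_product,
      ← Finset.sum_add_distrib]
    congr 1
    refine Finset.sum_congr rfl fun i _ => ?_
    rw [← Finset.sum_add_distrib]
    refine Finset.sum_congr rfl fun j _ => ?_
    simp only [hQ, hH, hs]
    ring
  have hH2 : ∑ p ∈ Finset.range m ×ˢ Finset.range m, H p ^ 2 ≤ 4 * m ^ 2 := by
    calc _ ≤ ∑ p ∈ Finset.range m ×ˢ Finset.range m, (4 : ℝ) := by
          refine Finset.sum_le_sum fun p _ => ?_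
          have h1 : |H p| ≤ 2 := by
            have e1 : ∀ x y : ℝ, |x| ≤ 1 → |y| ≤ 1 → |x * y| ≤ 1 := fun x y hx hy => by
              rw [abs_mul]
              exact mul_le_one₀ hx (abs_nonneg _) hy
            refine (abs_add_le _ _).trans ?_
            have e2 := e1 _ _ (abs_indicator_le_one (hfc1 κ) a (s p.1))
              (abs_indicator_le_one (hfc1 l) a (s p.2))
            have e3 := e1 _ _ (abs_indicator_le_one (hfs1 κ) a (s p.1))
              (abs_indicator_le_one (hfs1 l) a (s p.2))
            linarith
          rw [← sq_abs]
          nlinarith [abs_nonneg (H p)]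
      _ = 4 * m ^ 2 := by
          simp [Finset.card_product]
          ring
  have hCS := Finset.sum_mul_sq_le_sq_mul_sq (Finset.range m ×ˢ Finset.range m) Q H
  have hQ2 : ∑ i ∈ Finset.range m, ∑ j ∈ Finset.range m,
        duhamelKernel l₀ T κ l ((i + 1) * (T / m)) ((j + 1) * (T / m)) ^ 2
      = ∑ p ∈ Finset.range m ×ˢ Finset.range m, Q p ^ 2 := by
    rw [Finset.sum_product]
  rw [hQ2, div_le_iff₀ (by positivity)]
  have hQ0 : 0 ≤ ∑ p ∈ Finset.range m ×ˢ Finset.range m, Q p ^ 2 :=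
    Finset.sum_nonneg fun _ _ => sq_nonneg _
  calc (c₀ / 2) ^ 2 ≤ ((T / m) ^ 2 * ∑ p ∈ Finset.range m ×ˢ Finset.range m, Q p * H p) ^ 2 := by
        gcongr
    _ = (T / m) ^ 4 * (∑ p ∈ Finset.range m ×ˢ Finset.range m, Q p * H p) ^ 2 := by ring
    _ ≤ (T / m) ^ 4 * ((∑ p ∈ Finset.range m ×ˢ Finset.range m, Q p ^ 2) * (4 * m ^ 2)) := by
        refine mul_le_mul_of_nonneg_left (hCS.trans ?_) (by positivity)
        exact mul_le_mul_of_nonneg_left hH2 hQ0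
    _ = _ := by
        field_simp

-- The Japanese bracket.

theorem jb_sq (n : ℤ × ℤ) : jb n ^ 2 = 1 + (n.1 : ℝ) ^ 2 + (n.2 : ℝ) ^ 2 :=
  Real.sq_sqrt (by positivity)

theorem one_le_jb (n : ℤ × ℤ) : 1 ≤ jb n := by
  rw [jb, Real.one_le_sqrt]
  nlinarith [sq_nonneg (n.1 : ℝ), sq_nonneg (n.2 : ℝ)]

theorem jb_pos (n : ℤ × ℤ) : 0 < jb n := zero_lt_one.trans_le (one_le_jb n)

theorem jb_neg (n : ℤ × ℤ) : jb (-n) = jb n := by simp [jb]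

theorem jb_add_le (k n : ℤ × ℤ) : jb (k + n) ≤ jb k + jb n := by
  refine abs_le_of_sq_le_sq' ?_ (by linarith [jb_pos k, jb_pos n]) |>.2
  rw [add_sq, jb_sq, jb_sq, jb_sq]
  have h1 : (k.1 * n.1 + k.2 * n.2 : ℝ) ≤ jb k * jb n := by
    refine abs_le_of_sq_le_sq' ?_ (by have := jb_pos k; have := jb_pos n; positivity) |>.2
    rw [mul_pow, jb_sq, jb_sq]
    nlinarith [sq_nonneg (k.1 * n.2 - k.2 * n.1 : ℝ), sq_nonneg (k.1 : ℝ), sq_nonneg (k.2 : ℝ),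
      sq_nonneg (n.1 : ℝ), sq_nonneg (n.2 : ℝ)]
  simp only [Prod.fst_add, Prod.snd_add]
  push_cast
  nlinarith

/-- The resonance condition: the frequency difference of the two interacting waves stays bounded as
`k → ∞`. -/
theorem abs_jb_sub_jb_le (n k : ℤ × ℤ) : |jb k - jb (n - k)| ≤ jb n := by
  have h1 := jb_add_le (-(n - k)) n
  have h2 := jb_add_le (-k) n
  rw [jb_neg] at h1 h2
  rw [show -(n - k) + n = k by abel] at h1
  rw [show -k + n = n - k by abel] at h2
  rw [abs_le]
  constructor <;> linarith

-- Stochastic convolutions along a path and along its samples.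

/-- The stochastic convolution at frequency `κ` against a path vanishing at `0`, after integration
by parts. -/
def pathConv (α κ : ℝ) (b : ℝ → ℂ) (t : ℝ) : ℂ :=
  (κ ^ α : ℝ) * ∫ s in (0 : ℝ)..t, (Real.cos ((t - s) * κ) : ℂ) * b s

/-- The stochastic convolution against the path sampled on the mesh `T/m`. -/
def meshConv (α κ T : ℝ) (m : ℕ) (b : ℝ → ℂ) (t : ℝ) : ℂ :=
  (κ ^ (α - 1) : ℝ) * ∑ j ∈ Finset.range m,
    (waveSin κ t ((j + 1) * (T / m)) : ℂ) * (b ((j + 1) * (T / m)) - b (j * (T / m)))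

/-- The left end point of the cell of the mesh `T/m` containing `s ≥ 0`. -/
def meshFloor (T : ℝ) (m : ℕ) (s : ℝ) : ℝ := ⌊s * m / T⌋₊ * (T / m)

theorem meshFloor_nonneg {T : ℝ} (hT : 0 < T) (m : ℕ) (s : ℝ) : 0 ≤ meshFloor T m s := by
  unfold meshFloor
  positivity

theorem meshFloor_le {T : ℝ} (hT : 0 < T) {m : ℕ} (hm : 0 < m) {s : ℝ} (hs : 0 ≤ s) :
    meshFloor T m s ≤ s := by
  have hm' : (0 : ℝ) < m := by exact_mod_cast hm
  calc _ ≤ s * m / T * (T / m) :=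
        mul_le_mul_of_nonneg_right (Nat.floor_le (by positivity)) (by positivity)
    _ = s := by field_simp

theorem tendsto_meshFloor {T : ℝ} (hT : 0 < T) {s : ℝ} (hs : 0 ≤ s) :
    Tendsto (fun m => meshFloor T m s) atTop (𝓝 s) := by
  have h0 : Tendsto (fun m : ℕ => s - T / m) atTop (𝓝 s) := by
    simpa using tendsto_const_nhds.sub (tendsto_const_div_atTop_nhds_zero_nat T)
  refine tendsto_of_tendsto_of_tendsto_of_le_of_le' h0 tendsto_const_nhds ?_ ?_
  · filter_upwards [eventually_gt_atTop 0] with m hm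
    have hm' : (0 : ℝ) < m := by exact_mod_cast hm
    have h1 := (Nat.sub_one_lt_floor (s * m / T)).le
    calc s - T / m = (s * m / T - 1) * (T / m) := by field_simp
      _ ≤ _ := mul_le_mul_of_nonneg_right h1 (by positivity)
  · filter_upwards [eventually_gt_atTop 0] with m hm
    exact meshFloor_le hT hm hs

theorem measurable_meshFloor (T : ℝ) (m : ℕ) : Measurable (meshFloor T m) := by
  unfold meshFloor
  fun_prop

/-- A path sampled on the mesh is a sum of jumps. -/
theorem comp_meshFloor_eq_sum {b : ℝ → ℂ} (hb0 : b 0 = 0) {T : ℝ} (hT : 0 < T) {m : ℕ} (hm : 0 < m)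
    {s : ℝ} (hs : 0 ≤ s) (hsT : s ≤ T) :
    b (meshFloor T m s) = ∑ j ∈ Finset.range m,
      (Set.Ici ((j + 1) * (T / m))).indicator (fun _ => (1 : ℂ)) s
        * (b ((j + 1) * (T / m)) - b (j * (T / m))) := by
  have hm' : (0 : ℝ) < m := by exact_mod_cast hm
  set q := ⌊s * m / T⌋₊ with hq
  have hqm : q ≤ m := by
    rw [hq]
    refine Nat.floor_le_of_le ?_
    rw [div_le_iff₀ hT]
    nlinarith
  -- The increment over cell `j` is released at the right end of that cell, so exactly the first `q`
  -- increments have occurred by time `s`.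
  have hmem : ∀ j : ℕ, s ∈ Set.Ici ((j + 1) * (T / m)) ↔ j < q := by
    intro j
    rw [Set.mem_Ici, ← mul_div_assoc, div_le_iff₀ hm', ← Nat.succ_le_iff, hq,
      Nat.le_floor_iff (by positivity), le_div_iff₀ hT]
    push_cast
    rfl
  have h1 : ∀ j ∈ Finset.range m, (Set.Ici ((j + 1) * (T / m))).indicator (fun _ => (1 : ℂ)) s
        * (b ((j + 1) * (T / m)) - b (j * (T / m)))
      = if j < q then b ((j + 1) * (T / m)) - b (j * (T / m)) else 0 := by
    intro j _
    by_cases h : j < q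
    · rw [Set.indicator_of_mem ((hmem j).2 h), if_pos h, one_mul]
    · rw [Set.indicator_of_notMem (fun h' => h ((hmem j).1 h')), if_neg h, zero_mul]
  rw [Finset.sum_congr rfl h1, ← Finset.sum_filter]
  have h2 : (Finset.range m).filter (fun j => j < q) = Finset.range q := by
    ext j
    simp only [Finset.mem_filter, Finset.mem_range]
    omega
  rw [h2]
  have h3 := Finset.sum_range_sub (fun j : ℕ => b (j * (T / m))) q
  simp only [Nat.cast_zero, zero_mul, hb0, sub_zero] at h3
  push_cast at h3
  rw [h3]
  rfl

/-- The response to a unit jump at time `r`; it undoes the integration by parts for step paths. -/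
theorem integral_cos_mul_indicator {κ t r : ℝ} (hκ : 0 < κ) (hr : 0 ≤ r) (ht : 0 ≤ t) :
    ∫ s in (0 : ℝ)..t, (Real.cos ((t - s) * κ) : ℂ) * (Set.Ici r).indicator (fun _ => (1 : ℂ)) s
      = ((waveSin κ t r / κ : ℝ) : ℂ) := by
  rcases le_total t r with h | h
  · rw [waveSin_of_ge h, intervalIntegral.integral_congr_uIoo (g := fun _ => 0)]
    · simp
    · intro s hs
      rw [Set.uIoo_of_le ht] at hs
      simp [Set.indicator_of_notMem (show s ∉ Set.Ici r by simpa using hs.2.trans_le h)]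
  · have e1 : Set.EqOn (fun s => (Real.cos ((t - s) * κ) : ℂ) *
        (Set.Ici r).indicator (fun _ => (1 : ℂ)) s) (fun _ => 0) (Set.uIoo 0 r) := by
      intro s hs
      rw [Set.uIoo_of_le hr] at hs
      simp [Set.indicator_of_notMem (show s ∉ Set.Ici r by simpa using hs.2)]
    have e2 : Set.EqOn (fun s => (Real.cos ((t - s) * κ) : ℂ) *
        (Set.Ici r).indicator (fun _ => (1 : ℂ)) s)
        (fun s => ((Real.cos ((t - s) * κ) : ℝ) : ℂ)) (Set.uIoo r t) := by
      intro s hs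
      rw [Set.uIoo_of_le h] at hs
      simp only [Set.indicator_of_mem (show s ∈ Set.Ici r from hs.1.le), mul_one]
    have i1 := (intervalIntegrable_const (μ := volume) (a := 0) (b := r) (c := (0 : ℂ))).congr_uIoo
      e1.symm
    have i2 := (Continuous.intervalIntegrable (μ := volume) (by fun_prop : Continuous fun s =>
      ((Real.cos ((t - s) * κ) : ℝ) : ℂ)) r t).congr_uIoo e2.symm
    rw [← intervalIntegral.integral_add_adjacent_intervals i1 i2,
      intervalIntegral.integral_congr_uIoo e1, intervalIntegral.integral_congr_uIoo e2,
      intervalIntegral.integral_zero, zero_add, intervalIntegral.integral_ofReal, waveSin_of_le h]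
    congr 1
    have hd : ∀ s ∈ Set.uIcc r t, HasDerivAt (fun s => -(Real.sin ((t - s) * κ) / κ))
        (Real.cos ((t - s) * κ)) s := by
      intro s _
      have h1 : HasDerivAt (fun s : ℝ => (t - s) * κ) (-1 * κ) s :=
        ((hasDerivAt_id s).const_sub t).mul_const κ
      refine ((h1.sin.div_const κ).neg).congr_deriv ?_
      field_simp
    rw [intervalIntegral.integral_eq_sub_of_hasDerivAt hd
      (Continuous.intervalIntegrable (by fun_prop) _ _)]
    simp

/-- The sampled convolution is `pathConv` applied to the step path `b ∘ meshFloor`. Bounds uniform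
in `m` and convergence then need only boundedness and continuity of `b`, not finite variation. -/
theorem meshConv_eq_integral {b : ℝ → ℂ} (hb0 : b 0 = 0) {T : ℝ} (hT : 0 < T) {m : ℕ} (hm : 0 < m)
    {α κ t : ℝ} (hκ : 0 < κ) (ht : 0 ≤ t) (htT : t ≤ T) :
    meshConv α κ T m b t
      = (κ ^ α : ℝ) * ∫ s in (0 : ℝ)..t, (Real.cos ((t - s) * κ) : ℂ) * b (meshFloor T m s) := by
  have hm' : (0 : ℝ) < m := by exact_mod_cast hm
  have h1 : (∫ s in (0 : ℝ)..t, (Real.cos ((t - s) * κ) : ℂ) * b (meshFloor T m s))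
      = ∫ s in (0 : ℝ)..t, ∑ j ∈ Finset.range m, ((Real.cos ((t - s) * κ) : ℂ) *
        (Set.Ici ((j + 1) * (T / m))).indicator (fun _ => (1 : ℂ)) s) *
        (b ((j + 1) * (T / m)) - b (j * (T / m))) := by
    refine intervalIntegral.integral_congr fun s hs => ?_
    rw [Set.uIcc_of_le ht] at hs
    rw [comp_meshFloor_eq_sum hb0 hT hm hs.1 (hs.2.trans htT), Finset.mul_sum]
    refine Finset.sum_congr rfl fun j _ => ?_
    ring
  have hint : ∀ r, IntervalIntegrable (fun s => (Real.cos ((t - s) * κ) : ℂ) *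
      (Set.Ici r).indicator (fun _ => (1 : ℂ)) s) volume 0 t := by
    intro r
    refine (intervalIntegrable_const (c := (1 : ℝ))).mono_fun ?_ (Eventually.of_forall fun s => ?_)
    · refine Measurable.aestronglyMeasurable ?_
      refine Measurable.mul (by fun_prop) (measurable_const.indicator measurableSet_Ici)
    · simp only
      rw [norm_mul, norm_one, Complex.norm_real]
      refine mul_le_one₀ (Real.abs_cos_le_one _) (norm_nonneg _) ?_
      exact (norm_indicator_le_norm_self _ _).trans (by simp)
  rw [h1, intervalIntegral.integral_finsetSum fun j _ => (hint _).mul_const _, meshConv,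
    Real.rpow_sub_one hκ.ne', Finset.mul_sum, Finset.mul_sum]
  refine Finset.sum_congr rfl fun j _ => ?_
  rw [intervalIntegral.integral_mul_const, integral_cos_mul_indicator hκ (by positivity) ht]
  push_cast
  ring

theorem norm_meshConv_le {b : ℝ → ℂ} (hb0 : b 0 = 0) {T : ℝ} (hT : 0 < T) {m : ℕ} (hm : 0 < m)
    {α κ t C : ℝ} (hκ : 0 < κ) (ht : 0 ≤ t) (htT : t ≤ T) (hC : ∀ s ∈ Set.Icc 0 T, ‖b s‖ ≤ C) :
    ‖meshConv α κ T m b t‖ ≤ κ ^ α * (C * T) := by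
  have hC0 : 0 ≤ C := (norm_nonneg _).trans (hC 0 ⟨le_rfl, hT.le⟩)
  rw [meshConv_eq_integral hb0 hT hm hκ ht htT, norm_mul, Complex.norm_real,
    Real.norm_of_nonneg (by positivity)]
  refine mul_le_mul_of_nonneg_left ?_ (by positivity)
  have h1 := intervalIntegral.norm_integral_le_of_norm_le_const (a := 0) (b := t) (C := C)
    (f := fun s => (Real.cos ((t - s) * κ) : ℂ) * b (meshFloor T m s)) ?_
  · refine h1.trans ?_
    rw [sub_zero, abs_of_nonneg ht]
    gcongr
  · intro s hs
    rw [Set.uIoc_of_le ht] at hs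
    rw [norm_mul, Complex.norm_real]
    have h2 := hC (meshFloor T m s) ⟨meshFloor_nonneg hT _ _,
      (meshFloor_le hT hm hs.1.le).trans (hs.2.trans htT)⟩
    have h3 : ‖Real.cos ((t - s) * κ)‖ ≤ 1 := Real.abs_cos_le_one _
    nlinarith [norm_nonneg (b (meshFloor T m s)), norm_nonneg (Real.cos ((t - s) * κ))]

theorem tendsto_meshConv {b : ℝ → ℂ} (hb : Continuous b) (hb0 : b 0 = 0) {T : ℝ} (hT : 0 < T)
    {α κ t : ℝ} (hκ : 0 < κ) (ht : 0 ≤ t) (htT : t ≤ T) :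
    Tendsto (fun m => meshConv α κ T m b t) atTop (𝓝 (pathConv α κ b t)) := by
  obtain ⟨C, hC⟩ := (isCompact_Icc (a := (0 : ℝ)) (b := T)).exists_bound_of_continuousOn
    hb.continuousOn
  have h1 : Tendsto (fun m => ((κ ^ α : ℝ) : ℂ) * ∫ s in (0 : ℝ)..t,
      (Real.cos ((t - s) * κ) : ℂ) * b (meshFloor T m s)) atTop (𝓝 (pathConv α κ b t)) := by
    refine tendsto_const_nhds.mul ?_
    refine intervalIntegral.tendsto_integral_filter_of_dominated_convergence (fun _ => C) ?_ ?_ ?_ ?_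
    · refine Eventually.of_forall fun m => Measurable.aestronglyMeasurable ?_
      exact Measurable.mul (by fun_prop) (hb.measurable.comp (measurable_meshFloor T m))
    · filter_upwards [eventually_gt_atTop 0] with m hm
      refine Eventually.of_forall fun s hs => ?_
      rw [Set.uIoc_of_le ht] at hs
      rw [norm_mul, Complex.norm_real]
      have h2 := hC (meshFloor T m s) ⟨meshFloor_nonneg hT _ _,
        (meshFloor_le hT hm hs.1.le).trans (hs.2.trans htT)⟩
      have h3 : ‖Real.cos ((t - s) * κ)‖ ≤ 1 := Real.abs_cos_le_one _
      nlinarith [norm_nonneg (b (meshFloor T m s)), norm_nonneg (Real.cos ((t - s) * κ))]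
    · exact intervalIntegrable_const
    · refine Eventually.of_forall fun s hs => ?_
      rw [Set.uIoc_of_le ht] at hs
      exact tendsto_const_nhds.mul ((hb.tendsto s).comp (tendsto_meshFloor hT hs.1.le))
  refine h1.congr' ?_
  filter_upwards [eventually_gt_atTop 0] with m hm
  rw [meshConv_eq_integral hb0 hT hm hκ ht htT]

theorem continuous_pathConv {b : ℝ → ℂ} (hb : Continuous b) (α κ : ℝ) :
    Continuous (pathConv α κ b) := by
  unfold pathConv
  refine continuous_const.mul ?_
  exact intervalIntegral.continuous_parametric_intervalIntegral_of_continuous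
    (f := fun t s => (Real.cos ((t - s) * κ) : ℂ) * b s) (by fun_prop) continuous_id

theorem continuous_meshConv (α κ T : ℝ) (m : ℕ) (b : ℝ → ℂ) : Continuous (meshConv α κ T m b) := by
  unfold meshConv
  fun_prop

-- Duhamel integrals of products.

/-- The Duhamel integral at time `T` of the product of two stochastic convolutions. -/
def duhamelProduct (α l₀ T κ l : ℝ) (b b' : ℝ → ℂ) : ℂ :=
  ∫ t in (0 : ℝ)..T, ((Real.sin ((T - t) * l₀) / l₀ : ℝ) : ℂ) *
    (pathConv α κ b t * pathConv α l b' t)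

/-- The Duhamel integral at time `T` of the product of two sampled stochastic convolutions. -/
def meshDuhamelProduct (α l₀ T κ l : ℝ) (m : ℕ) (b b' : ℝ → ℂ) : ℂ :=
  ∫ t in (0 : ℝ)..T, ((Real.sin ((T - t) * l₀) / l₀ : ℝ) : ℂ) *
    (meshConv α κ T m b t * meshConv α l T m b' t)

theorem tendsto_meshDuhamelProduct {b b' : ℝ → ℂ} (hb : Continuous b) (hb0 : b 0 = 0)
    (hb' : Continuous b') (hb0' : b' 0 = 0) {T : ℝ} (hT : 0 < T) {α l₀ κ l : ℝ} (hκ : 0 < κ)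
    (hl : 0 < l) :
    Tendsto (fun m => meshDuhamelProduct α l₀ T κ l m b b') atTop
      (𝓝 (duhamelProduct α l₀ T κ l b b')) := by
  obtain ⟨C, hC⟩ := (isCompact_Icc (a := (0 : ℝ)) (b := T)).exists_bound_of_continuousOn
    hb.continuousOn
  obtain ⟨C', hC'⟩ := (isCompact_Icc (a := (0 : ℝ)) (b := T)).exists_bound_of_continuousOn
    hb'.continuousOn
  have hC0 : 0 ≤ C := (norm_nonneg _).trans (hC 0 ⟨le_rfl, hT.le⟩)
  refine intervalIntegral.tendsto_integral_filter_of_dominated_convergence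
    (fun t => |Real.sin ((T - t) * l₀) / l₀| * (κ ^ α * (C * T) * (l ^ α * (C' * T)))) ?_ ?_ ?_ ?_
  · refine Eventually.of_forall fun m => Continuous.aestronglyMeasurable ?_
    exact Continuous.mul (by fun_prop) ((continuous_meshConv _ _ _ _ _).mul
      (continuous_meshConv _ _ _ _ _))
  · filter_upwards [eventually_gt_atTop 0] with m hm
    refine Eventually.of_forall fun t ht => ?_
    rw [Set.uIoc_of_le hT.le] at ht
    rw [norm_mul, norm_mul, Complex.norm_real, Real.norm_eq_abs]
    gcongr
    · exact norm_meshConv_le hb0 hT hm hκ ht.1.le ht.2 hC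
    · exact norm_meshConv_le hb0' hT hm hl ht.1.le ht.2 hC'
  · exact Continuous.intervalIntegrable (by fun_prop) _ _
  · refine Eventually.of_forall fun t ht => ?_
    rw [Set.uIoc_of_le hT.le] at ht
    exact tendsto_const_nhds.mul ((tendsto_meshConv hb hb0 hT hκ ht.1.le ht.2).mul
      (tendsto_meshConv hb' hb0' hT hl ht.1.le ht.2))

theorem meshDuhamelProduct_eq_sum (α l₀ T κ l : ℝ) (m : ℕ) (b b' : ℝ → ℂ) :
    meshDuhamelProduct α l₀ T κ l m b b' = ∑ i ∈ Finset.range m, ∑ j ∈ Finset.range m,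
      ((κ ^ (α - 1) * l ^ (α - 1)
        * duhamelKernel l₀ T κ l ((i + 1) * (T / m)) ((j + 1) * (T / m)) : ℝ) : ℂ)
      * ((b ((i + 1) * (T / m)) - b (i * (T / m))) * (b' ((j + 1) * (T / m)) - b' (j * (T / m)))) := by
  set S : ℝ → ℝ := fun t => Real.sin ((T - t) * l₀) / l₀ with hS
  have hSc : Continuous S := by fun_prop
  have h1 : ∀ t, (S t : ℂ) * (meshConv α κ T m b t * meshConv α l T m b' t)
      = ∑ i ∈ Finset.range m, ∑ j ∈ Finset.range m,
        ((S t * (waveSin κ t ((i + 1) * (T / m)) * waveSin l t ((j + 1) * (T / m))) : ℝ) : ℂ) *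
        (((κ ^ (α - 1) * l ^ (α - 1) : ℝ) : ℂ) * ((b ((i + 1) * (T / m)) - b (i * (T / m)))
          * (b' ((j + 1) * (T / m)) - b' (j * (T / m))))) := by
    intro t
    rw [meshConv, meshConv, mul_mul_mul_comm, Finset.sum_mul_sum, Finset.mul_sum,
      Finset.mul_sum]
    refine Finset.sum_congr rfl fun i _ => ?_
    rw [Finset.mul_sum, Finset.mul_sum]
    refine Finset.sum_congr rfl fun j _ => ?_
    push_cast
    ring
  have h2 : meshDuhamelProduct α l₀ T κ l m b b'
      = ∫ t in (0 : ℝ)..T, ∑ i ∈ Finset.range m, ∑ j ∈ Finset.range m,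
        ((S t * (waveSin κ t ((i + 1) * (T / m)) * waveSin l t ((j + 1) * (T / m))) : ℝ) : ℂ) *
        (((κ ^ (α - 1) * l ^ (α - 1) : ℝ) : ℂ) * ((b ((i + 1) * (T / m)) - b (i * (T / m)))
          * (b' ((j + 1) * (T / m)) - b' (j * (T / m))))) :=
    intervalIntegral.integral_congr fun t _ => h1 t
  have hci : ∀ (s s' : ℝ) (c : ℂ), Continuous fun t =>
      ((S t * (waveSin κ t s * waveSin l t s') : ℝ) : ℂ) * c := by
    intro s s' c
    fun_prop
  rw [h2, intervalIntegral.integral_finsetSum fun i _ => Continuous.intervalIntegrable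
    (continuous_finsetSum _ fun j _ => hci _ _ _) _ _]
  refine Finset.sum_congr rfl fun i _ => ?_
  rw [intervalIntegral.integral_finsetSum fun j _ => Continuous.intervalIntegrable
    (hci _ _ _) _ _]
  refine Finset.sum_congr rfl fun j _ => ?_
  rw [intervalIntegral.integral_mul_const, intervalIntegral.integral_ofReal]
  unfold duhamelKernel
  push_cast
  ring

-- Frequency pairs and the passage from real to complex components.

theorem mem_freq {N : ℕ} {n : ℤ × ℤ} : n ∈ freq N ↔ n.1 ^ 2 + n.2 ^ 2 ≤ (N : ℤ) ^ 2 := by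
  simp only [freq, Finset.mem_filter, Finset.mem_product, Finset.mem_Icc, and_iff_right_iff_imp]
  intro h
  have h1 : n.1 ^ 2 ≤ (N : ℤ) ^ 2 := by nlinarith [sq_nonneg n.2]
  have h2 : n.2 ^ 2 ≤ (N : ℤ) ^ 2 := by nlinarith [sq_nonneg n.1]
  exact ⟨abs_le_of_sq_le_sq' h1 (by positivity), abs_le_of_sq_le_sq' h2 (by positivity)⟩

theorem neg_mem_freq {N : ℕ} {n : ℤ × ℤ} (h : n ∈ freq N) : -n ∈ freq N := by
  rw [mem_freq] at h ⊢
  simpa using h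

theorem eventually_mem_freq (n : ℤ × ℤ) : ∀ᶠ N in atTop, n ∈ freq N := by
  filter_upwards [eventually_ge_atTop (n.1.natAbs + n.2.natAbs)] with N hN
  rw [mem_freq]
  have h1 : |n.1| + |n.2| ≤ (N : ℤ) := by
    rw [Int.abs_eq_natAbs, Int.abs_eq_natAbs]
    omega
  calc n.1 ^ 2 + n.2 ^ 2 ≤ (|n.1| + |n.2|) ^ 2 := by
        rw [add_sq, sq_abs, sq_abs]
        nlinarith [mul_nonneg (abs_nonneg n.1) (abs_nonneg n.2)]
    _ ≤ _ := by gcongr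

/-- The frequencies `k` such that both `k` and `n - k` have length at most `N`. -/
def pairs (n : ℤ × ℤ) (N : ℕ) : Finset (ℤ × ℤ) := (freq N).filter fun k => n - k ∈ freq N

theorem mem_pairs {n : ℤ × ℤ} {N : ℕ} {k : ℤ × ℤ} : k ∈ pairs n N ↔ k ∈ freq N ∧ n - k ∈ freq N :=
  Finset.mem_filter

theorem sub_mem_pairs {n : ℤ × ℤ} {N : ℕ} {k : ℤ × ℤ} (h : k ∈ pairs n N) : n - k ∈ pairs n N := by
  rw [mem_pairs] at h ⊢
  exact ⟨h.2, by simpa using h.1⟩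

theorem eventually_mem_pairs (n k : ℤ × ℤ) : ∀ᶠ N in atTop, k ∈ pairs n N := by
  filter_upwards [eventually_mem_freq k, eventually_mem_freq (n - k)] with N h1 h2
  exact mem_pairs.2 ⟨h1, h2⟩

/-- The coefficient of the real component `k` in the complex Brownian motion `k`. -/
def selfCoef (k : ℤ × ℤ) : ℂ :=
  if k = 0 then 1
  else if 0 < k.1 ∨ (k.1 = 0 ∧ 0 < k.2) then ((Real.sqrt 2)⁻¹ : ℝ)
  else Complex.I * ((Real.sqrt 2)⁻¹ : ℝ)

/-- The coefficient of the real component `-k` in the complex Brownian motion `k`. -/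
def negCoef (k : ℤ × ℤ) : ℂ :=
  if k = 0 then 0
  else if 0 < k.1 ∨ (k.1 = 0 ∧ 0 < k.2) then -(Complex.I * ((Real.sqrt 2)⁻¹ : ℝ))
  else ((Real.sqrt 2)⁻¹ : ℝ)

/-- The complex path at frequency `k` with the given real components. -/
def fourierPath (w : ℤ × ℤ → ℝ → ℝ) (k : ℤ × ℤ) (s : ℝ) : ℂ :=
  selfCoef k * w k s + negCoef k * w (-k) s

/-- The matrix expressing the complex paths through their real components. -/
def compMatrix (k p : ℤ × ℤ) : ℂ :=
  (if p = k then selfCoef k else 0) + (if p = -k then negCoef k else 0)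

theorem sum_compMatrix_mul {F : Finset (ℤ × ℤ)} {k : ℤ × ℤ} (hk : k ∈ F) (hk' : -k ∈ F)
    (f : ℤ × ℤ → ℂ) :
    ∑ p ∈ F, compMatrix k p * f p = selfCoef k * f k + negCoef k * f (-k) := by
  simp only [compMatrix, add_mul, Finset.sum_add_distrib, ite_mul, zero_mul, Finset.sum_ite_eq',
    hk, hk', if_true]

theorem halfPlane_neg_iff {k : ℤ × ℤ} (hk : k ≠ 0) :
    (0 < (-k).1 ∨ ((-k).1 = 0 ∧ 0 < (-k).2)) ↔ ¬(0 < k.1 ∨ (k.1 = 0 ∧ 0 < k.2)) := by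
  have : k.1 ≠ 0 ∨ k.2 ≠ 0 := by
    by_contra! h
    exact hk (Prod.ext h.1 h.2)
  simp only [Prod.fst_neg, Prod.snd_neg]
  omega

theorem inv_sqrt_two_mul_self : (((Real.sqrt 2)⁻¹ : ℝ) : ℂ) * ((Real.sqrt 2)⁻¹ : ℝ) = 1 / 2 := by
  rw [← Complex.ofReal_mul, ← mul_inv, Real.mul_self_sqrt (by norm_num)]
  norm_num

/-- For `k` in the upper half-lattice the rows of `k` and `-k` live on the columns `k, -k` and are
`(1, -i)/√2` and `(1, i)/√2`; the row of `0` is a unit vector. All other pairs of rows have disjoint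
supports. -/
theorem compMatrix_orthonormal {F : Finset (ℤ × ℤ)} (hF : ∀ k ∈ F, -k ∈ F) {k l : ℤ × ℤ}
    (hk : k ∈ F) :
    ∑ p ∈ F, compMatrix k p * (starRingEnd ℂ) (compMatrix l p) = if k = l then 1 else 0 := by
  rw [sum_compMatrix_mul hk (hF k hk)]
  have hs := inv_sqrt_two_mul_self
  by_cases hk0 : k = 0
  · subst hk0
    by_cases hl : l = 0
    · subst hl
      simp [compMatrix, selfCoef, negCoef]
    · simp [compMatrix, selfCoef, negCoef, Ne.symm hl]
      exact fun h h' => absurd h h'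
  · have hkk : k ≠ -k := by
      intro h
      apply hk0
      have h1 := congrArg Prod.fst h
      have h2 := congrArg Prod.snd h
      simp only [Prod.fst_neg, Prod.snd_neg] at h1 h2
      exact Prod.ext (by simp only [Prod.fst_zero]; omega) (by simp only [Prod.snd_zero]; omega)
    by_cases hkl : k = l
    · subst hkl
      simp only [compMatrix, if_true, if_neg hkk, if_neg hkk.symm, add_zero, zero_add, selfCoef,
        negCoef, if_neg hk0]
      split_ifs
      · simp only [map_neg, map_mul, Complex.conj_I, Complex.conj_ofReal]
        linear_combination 2 * hs - ((Real.sqrt 2)⁻¹ : ℝ) * ((Real.sqrt 2)⁻¹ : ℝ) * Complex.I_mul_I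
      · simp only [map_mul, Complex.conj_I, Complex.conj_ofReal]
        linear_combination 2 * hs - ((Real.sqrt 2)⁻¹ : ℝ) * ((Real.sqrt 2)⁻¹ : ℝ) * Complex.I_mul_I
    · by_cases hkl' : l = -k
      · subst hkl'
        have h1 := halfPlane_neg_iff hk0
        have hk0' : -k ≠ 0 := by simpa using hk0
        simp only [compMatrix, neg_neg, if_true, if_neg hkk, if_neg hkk.symm, add_zero, zero_add,
          selfCoef, negCoef, if_neg hk0, if_neg hk0', h1]
        by_cases h2 : 0 < k.1 ∨ (k.1 = 0 ∧ 0 < k.2)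
        · simp only [h2, not_true, if_true, if_false]
          simp only [map_mul, Complex.conj_I, Complex.conj_ofReal]
          linear_combination ((Real.sqrt 2)⁻¹ : ℝ) * ((Real.sqrt 2)⁻¹ : ℝ) * Complex.I_mul_I
        · simp only [h2, not_false_eq_true, if_true, if_false]
          simp only [map_mul, map_neg, Complex.conj_I, Complex.conj_ofReal]
          linear_combination ((Real.sqrt 2)⁻¹ : ℝ) * ((Real.sqrt 2)⁻¹ : ℝ) * Complex.I_mul_I
      · have h3 : k ≠ -l := fun h => hkl' (by rw [h, neg_neg])
        have h4 : -k ≠ l := fun h => hkl' h.symm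
        simp [compMatrix, hkl, h3, h4]

/-- The Hilbert--Schmidt norm is invariant under a change of basis by orthonormal families. -/
theorem sum_norm_sq_of_orthonormal {ι κ : Type*} [DecidableEq ι] (K : Finset ι) (P : Finset κ)
    (U V : ι → κ → ℂ) (D : ι → ℝ)
    (hU : ∀ k ∈ K, ∀ l ∈ K, ∑ p ∈ P, U k p * (starRingEnd ℂ) (U l p) = if k = l then 1 else 0)
    (hV : ∀ k ∈ K, ∑ p ∈ P, V k p * (starRingEnd ℂ) (V k p) = 1) :
    ∑ p ∈ P, ∑ q ∈ P, ‖∑ k ∈ K, U k p * V k q * D k‖ ^ 2 = ∑ k ∈ K, D k ^ 2 := by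
  have h1 : ∑ p ∈ P, ∑ q ∈ P, ((‖∑ k ∈ K, U k p * V k q * D k‖ ^ 2 : ℝ) : ℂ)
      = ∑ k ∈ K, ((D k ^ 2 : ℝ) : ℂ) := by
    have h2 : ∀ p q, ((‖∑ k ∈ K, U k p * V k q * D k‖ ^ 2 : ℝ) : ℂ)
        = ∑ k ∈ K, ∑ l ∈ K, (D k * D l : ℂ) * ((U k p * (starRingEnd ℂ) (U l p))
          * (V k q * (starRingEnd ℂ) (V l q))) := by
      intro p q
      rw [← Complex.normSq_eq_norm_sq, ← Complex.mul_conj, map_sum, Finset.sum_mul_sum]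
      refine Finset.sum_congr rfl fun k _ => Finset.sum_congr rfl fun l _ => ?_
      simp only [map_mul, Complex.conj_ofReal]
      ring
    simp_rw [h2]
    calc _ = ∑ k ∈ K, ∑ l ∈ K, (D k * D l : ℂ) * ((∑ p ∈ P, U k p * (starRingEnd ℂ) (U l p))
          * (∑ q ∈ P, V k q * (starRingEnd ℂ) (V l q))) := by
          have e1 : ∀ p ∈ P, ∑ q ∈ P, ∑ k ∈ K, ∑ l ∈ K, (D k * D l : ℂ) *
              ((U k p * (starRingEnd ℂ) (U l p)) * (V k q * (starRingEnd ℂ) (V l q)))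
              = ∑ k ∈ K, ∑ l ∈ K, ∑ q ∈ P, (D k * D l : ℂ) *
              ((U k p * (starRingEnd ℂ) (U l p)) * (V k q * (starRingEnd ℂ) (V l q))) := by
            intro p _
            rw [Finset.sum_comm]
            exact Finset.sum_congr rfl fun k _ => Finset.sum_comm
          rw [Finset.sum_congr rfl e1, Finset.sum_comm]
          refine Finset.sum_congr rfl fun k _ => ?_
          rw [Finset.sum_comm]
          refine Finset.sum_congr rfl fun l _ => ?_
          rw [Finset.sum_mul_sum, Finset.mul_sum]
          refine Finset.sum_congr rfl fun p _ => ?_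
          rw [Finset.mul_sum]
      _ = _ := by
          refine Finset.sum_congr rfl fun k hk => ?_
          -- Orthogonality of the `U` factors alone removes the terms `l ≠ k`, so of `V` only the
          -- normalization is needed.
          rw [Finset.sum_eq_single_of_mem k hk]
          · rw [hU k hk k hk, hV k hk]
            push_cast
            simp only [if_true]
            ring
          · intro l hl hlk
            rw [hU k hk l hl, if_neg hlk.symm]
            ring
  exact_mod_cast h1

theorem duhamelKernel_comm (l₀ T κ l s s' : ℝ) :
    duhamelKernel l₀ T κ l s s' = duhamelKernel l₀ T l κ s' s := by
  unfold duhamelKernel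
  refine intervalIntegral.integral_congr fun t _ => ?_
  ring

-- The Fourier coefficient as a quadratic form.

/-- The renormalized Fourier coefficient of the Duhamel integral of the squared stochastic
convolution, up to a deterministic constant. -/
def pathQuad (α : ℝ) (n : ℤ × ℤ) (T : ℝ) (w : ℤ × ℤ → ℝ → ℝ) (N : ℕ) : ℂ :=
  ((2 * Real.pi)⁻¹ : ℝ) * ∑ k ∈ pairs n N,
    duhamelProduct α (jb n) T (jb k) (jb (n - k)) (fourierPath w k) (fourierPath w (n - k))

/-- The functional `pathQuad` of the paths sampled on the mesh `T/m`. -/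
def meshQuad (α : ℝ) (n : ℤ × ℤ) (T : ℝ) (w : ℤ × ℤ → ℝ → ℝ) (N m : ℕ) : ℂ :=
  ((2 * Real.pi)⁻¹ : ℝ) * ∑ k ∈ pairs n N,
    meshDuhamelProduct α (jb n) T (jb k) (jb (n - k)) m (fourierPath w k) (fourierPath w (n - k))

theorem continuous_fourierPath {w : ℤ × ℤ → ℝ → ℝ} (hw : ∀ k, Continuous (w k)) (k : ℤ × ℤ) :
    Continuous (fourierPath w k) := by
  have h1 := hw k
  have h2 := hw (-k)
  unfold fourierPath
  fun_prop

theorem fourierPath_zero {w : ℤ × ℤ → ℝ → ℝ} (hw0 : ∀ k, w k 0 = 0) (k : ℤ × ℤ) :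
    fourierPath w k 0 = 0 := by
  simp [fourierPath, hw0]

theorem tendsto_meshQuad {w : ℤ × ℤ → ℝ → ℝ} (hw : ∀ k, Continuous (w k)) (hw0 : ∀ k, w k 0 = 0)
    {T : ℝ} (hT : 0 < T) (α : ℝ) (n : ℤ × ℤ) (N : ℕ) :
    Tendsto (fun m => meshQuad α n T w N m) atTop (𝓝 (pathQuad α n T w N)) :=
  tendsto_const_nhds.mul (tendsto_finsetSum _ fun k _ => tendsto_meshDuhamelProduct
    (continuous_fourierPath hw k) (fourierPath_zero hw0 k) (continuous_fourierPath hw _)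
    (fourierPath_zero hw0 _) hT (jb_pos _) (jb_pos _))

/-- The kernel of the product of the stochastic convolutions at frequencies `k` and `n - k`. -/
def pairKernel (α : ℝ) (n : ℤ × ℤ) (T : ℝ) (m : ℕ) (k : ℤ × ℤ) (i j : ℕ) : ℝ :=
  (2 * Real.pi)⁻¹ * (jb k ^ (α - 1) * jb (n - k) ^ (α - 1)
    * duhamelKernel (jb n) T (jb k) (jb (n - k)) ((i + 1) * (T / m)) ((j + 1) * (T / m)))

/-- The matrix of `meshQuad` as a quadratic form in the increments of the real components. -/
def quadMatrix (α : ℝ) (n : ℤ × ℤ) (T : ℝ) (N m : ℕ) :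
    Matrix (freq N × Fin m) (freq N × Fin m) ℂ :=
  fun x y => ∑ k ∈ pairs n N, compMatrix k x.1 * compMatrix (n - k) y.1
    * pairKernel α n T m k x.2 y.2

/-- The involution `k ↦ n - k` of `pairs n N` swaps the two factors. Symmetry without conjugation
makes the real and imaginary parts real symmetric matrices, to which the spectral theorem applies.
-/
theorem quadMatrix_comm (α : ℝ) (n : ℤ × ℤ) (T : ℝ) (N m : ℕ) (x y : freq N × Fin m) :
    quadMatrix α n T N m x y = quadMatrix α n T N m y x := by
  unfold quadMatrix
  refine Finset.sum_bij' (fun k _ => n - k) (fun k _ => n - k) (fun k hk => sub_mem_pairs hk)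
    (fun k hk => sub_mem_pairs hk) (fun k _ => by simp) (fun k _ => by simp) fun k _ => ?_
  simp only [pairKernel, sub_sub_cancel]
  rw [duhamelKernel_comm]
  push_cast
  ring

/-- Orthonormality of the rows of `compMatrix` removes all cross terms between different `k`, so the
lower bounds for single kernels add up. -/
theorem sum_norm_quadMatrix_sq (α : ℝ) (n : ℤ × ℤ) (T : ℝ) (N m : ℕ) :
    ∑ x, ∑ y, ‖quadMatrix α n T N m x y‖ ^ 2
      = ∑ k ∈ pairs n N, ∑ i ∈ Finset.range m, ∑ j ∈ Finset.range m, pairKernel α n T m k i j ^ 2 := by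
  have h1 : ∀ i j : ℕ, ∑ p ∈ freq N, ∑ q ∈ freq N, ‖∑ k ∈ pairs n N,
      compMatrix k p * compMatrix (n - k) q * pairKernel α n T m k i j‖ ^ 2
      = ∑ k ∈ pairs n N, pairKernel α n T m k i j ^ 2 := by
    intro i j
    refine sum_norm_sq_of_orthonormal (pairs n N) (freq N) compMatrix
      (fun k => compMatrix (n - k)) (fun k => pairKernel α n T m k i j) ?_ ?_
    · intro k hk l _
      exact compMatrix_orthonormal (fun k hk => neg_mem_freq hk) (mem_pairs.1 hk).1
    · intro k hk
      have := compMatrix_orthonormal (l := n - k) (fun k hk => neg_mem_freq hk) (mem_pairs.1 hk).2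
      rwa [if_pos rfl] at this
  have h2 : ∀ i j : ℕ, ∑ p : freq N, ∑ q : freq N, ‖∑ k ∈ pairs n N,
      compMatrix k p * compMatrix (n - k) q * pairKernel α n T m k i j‖ ^ 2
      = ∑ k ∈ pairs n N, pairKernel α n T m k i j ^ 2 := by
    intro i j
    rw [← h1 i j, ← Finset.sum_coe_sort (freq N)]
    refine Finset.sum_congr rfl fun p _ => ?_
    rw [← Finset.sum_coe_sort (freq N)]
  unfold quadMatrix
  simp_rw [Fintype.sum_prod_type]
  calc _ = ∑ i : Fin m, ∑ j : Fin m, ∑ p : freq N, ∑ q : freq N, ‖∑ k ∈ pairs n N,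
      compMatrix k p * compMatrix (n - k) q * pairKernel α n T m k i j‖ ^ 2 := by
        rw [Finset.sum_comm]
        refine Finset.sum_congr rfl fun i _ => ?_
        simp_rw [Finset.sum_comm (s := (Finset.univ : Finset (freq N))) (t := (Finset.univ : Finset (Fin m)))]
    _ = _ := by
        simp_rw [h2]
        simp_rw [Finset.sum_range]
        rw [Finset.sum_comm (s := pairs n N)]
        refine Finset.sum_congr rfl fun i _ => ?_
        rw [Finset.sum_comm (s := pairs n N)]

theorem meshQuad_eq_sum (α : ℝ) (n : ℤ × ℤ) (T : ℝ) (w : ℤ × ℤ → ℝ → ℝ) (N m : ℕ) :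
    meshQuad α n T w N m = ∑ x, ∑ y, quadMatrix α n T N m x y
      * (w x.1 ((x.2 + 1) * (T / m)) - w x.1 (x.2 * (T / m)) : ℝ)
      * (w y.1 ((y.2 + 1) * (T / m)) - w y.1 (y.2 * (T / m)) : ℝ) := by
  set d : ℤ × ℤ → ℕ → ℂ := fun p i => ((w p ((i + 1) * (T / m)) - w p (i * (T / m)) : ℝ) : ℂ)
    with hd
  have hb : ∀ k ∈ freq N, ∀ i : ℕ, fourierPath w k ((i + 1) * (T / m))
      - fourierPath w k (i * (T / m)) = ∑ p : freq N, compMatrix k p * d p i := by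
    intro k hk i
    rw [Finset.sum_coe_sort (freq N) (fun p => compMatrix k p * d p i),
      sum_compMatrix_mul hk (neg_mem_freq hk)]
    simp only [fourierPath, hd]
    push_cast
    ring
  have h1 : meshQuad α n T w N m = ∑ k ∈ pairs n N, ∑ i : Fin m, ∑ j : Fin m,
      ∑ p : freq N, ∑ q : freq N, compMatrix k p * compMatrix (n - k) q
        * pairKernel α n T m k i j * d p i * d q j := by
    rw [meshQuad, Finset.mul_sum]
    refine Finset.sum_congr rfl fun k hk => ?_
    rw [meshDuhamelProduct_eq_sum, Finset.sum_range, Finset.mul_sum]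
    refine Finset.sum_congr rfl fun i _ => ?_
    rw [Finset.sum_range, Finset.mul_sum]
    refine Finset.sum_congr rfl fun j _ => ?_
    rw [hb k (mem_pairs.1 hk).1, hb (n - k) (mem_pairs.1 hk).2, Finset.sum_mul_sum,
      Finset.mul_sum, Finset.mul_sum]
    refine Finset.sum_congr rfl fun p _ => ?_
    rw [Finset.mul_sum, Finset.mul_sum]
    refine Finset.sum_congr rfl fun q _ => ?_
    simp only [pairKernel]
    push_cast
    ring
  rw [h1]
  simp_rw [Fintype.sum_prod_type, quadMatrix, Finset.sum_mul]
  calc _ = ∑ i : Fin m, ∑ j : Fin m, ∑ p : freq N, ∑ q : freq N, ∑ k ∈ pairs n N,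
        compMatrix k p * compMatrix (n - k) q * pairKernel α n T m k i j * d p i * d q j := by
        rw [Finset.sum_comm]
        refine Finset.sum_congr rfl fun i _ => ?_
        rw [Finset.sum_comm]
        refine Finset.sum_congr rfl fun j _ => ?_
        rw [Finset.sum_comm]
        refine Finset.sum_congr rfl fun p _ => ?_
        rw [Finset.sum_comm]
    _ = _ := by
        symm
        rw [Finset.sum_comm]
        refine Finset.sum_congr rfl fun i _ => ?_
        simp_rw [Finset.sum_comm (s := (Finset.univ : Finset (freq N)))
          (t := (Finset.univ : Finset (Fin m)))]
        rfl

-- Divergence of the Hilbert--Schmidt norm.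

/-- The sum of `⟨k⟩⁻²` over `ℤ²` diverges. -/
theorem not_summable_inv_jb_sq : ¬ Summable fun k : ℤ × ℤ => (jb k ^ 2)⁻¹ := by
  intro h
  -- The triangle `0 ≤ x ≤ y`: row `y` has `y + 1` points with bracket squared at most `2(y + 1)²`,
  -- which leaves half the harmonic series.
  set g : (Σ y : ℕ, Fin (y + 1)) → ℤ × ℤ := fun z => ((z.2 : ℕ), (z.1 : ℕ)) with hg
  have hinj : Function.Injective g := by
    rintro ⟨y, x⟩ ⟨y', x'⟩ hz
    simp only [hg, Prod.mk.injEq, Nat.cast_inj] at hz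
    obtain ⟨h1, h2⟩ := hz
    subst h2
    rw [Fin.ext h1]
  have h1 := (h.comp_injective hinj).sigma
  refine Real.not_summable_one_div_natCast ?_
  rw [← summable_nat_add_iff 1]
  refine Summable.of_nonneg_of_le (fun y => by positivity) (fun y => ?_) (h1.mul_left 2)
  simp only [Function.comp, tsum_fintype]
  have h2 : ∀ x : Fin (y + 1), (2 * ((y : ℝ) + 1) ^ 2)⁻¹ ≤ (jb (g ⟨y, x⟩) ^ 2)⁻¹ := by
    intro x
    have hx : ((x : ℕ) : ℝ) ≤ y := by exact_mod_cast Nat.lt_succ_iff.1 x.2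
    have hx0 : (0 : ℝ) ≤ ((x : ℕ) : ℝ) := by positivity
    refine inv_anti₀ (pow_pos (jb_pos _) 2) ?_
    rw [jb_sq]
    simp only [hg]
    push_cast
    nlinarith
  have h3 := Finset.sum_le_sum fun x (_ : x ∈ (Finset.univ : Finset (Fin (y + 1)))) => h2 x
  rw [Finset.sum_const, Finset.card_univ, Fintype.card_fin, nsmul_eq_mul] at h3
  refine le_trans (le_of_eq ?_) (mul_le_mul_of_nonneg_left h3 (by norm_num))
  push_cast
  field_simp

theorem finite_jb_lt (R : ℝ) : {k : ℤ × ℤ | jb k < R}.Finite := by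
  obtain ⟨N, hN⟩ := exists_nat_gt R
  refine (freq N).finite_toSet.subset fun k hk => ?_
  rw [Finset.mem_coe, mem_freq]
  have h1 : jb k ^ 2 ≤ (N : ℝ) ^ 2 := by
    have := jb_pos k
    have h2 : jb k < R := hk
    gcongr
    linarith
  rw [jb_sq] at h1
  have h2 : ((k.1 : ℝ)) ^ 2 + (k.2 : ℝ) ^ 2 ≤ (N : ℝ) ^ 2 := by linarith
  exact_mod_cast h2

/-- Finite sets of high frequencies with a large sum of `⟨k⟩⁻²`. -/
theorem exists_finset_sum_inv_jb_sq (R V : ℝ) :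
    ∃ B : Finset (ℤ × ℤ), (∀ k ∈ B, R ≤ jb k) ∧ V < ∑ k ∈ B, (jb k ^ 2)⁻¹ := by
  by_contra! h
  refine not_summable_inv_jb_sq ?_
  have hs : Summable fun k : ℤ × ℤ => if R ≤ jb k then (jb k ^ 2)⁻¹ else 0 := by
    refine summable_of_sum_le (c := V) (fun k => ?_) fun u => ?_
    · have := jb_pos k
      simp only [Pi.zero_apply]
      split_ifs <;> positivity
    · rw [← Finset.sum_filter]
      exact h _ fun k hk => (Finset.mem_filter.1 hk).2
  refine (summable_congr_cofinite ?_).1 hs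
  rw [EventuallyEq, eventually_cofinite]
  refine (finite_jb_lt R).subset fun k hk => ?_
  by_contra hk'
  exact hk (if_pos (not_lt.1 hk'))

/-- This is where the threshold `α ≥ 1/2` enters: it says `2(α - 1) ≥ -1`. -/
theorem sq_rpow_ge {x α : ℝ} (hx : 1 ≤ x) (hα : 1 / 2 ≤ α) : x⁻¹ ≤ (x ^ (α - 1)) ^ 2 := by
  rw [← Real.rpow_natCast, ← Real.rpow_mul (by linarith), ← Real.rpow_neg_one]
  refine Real.rpow_le_rpow_of_exponent_le hx ?_
  push_cast
  linarith

/-- The Hilbert--Schmidt norm of the quadratic form diverges with the truncation parameter. -/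
theorem eventually_le_sum_norm_quadMatrix_sq {α : ℝ} (hα : 1 / 2 ≤ α) (n : ℤ × ℤ) {T : ℝ}
    (hT : 0 < T) (V : ℝ) :
    ∀ᶠ N : ℕ in atTop, ∀ᶠ m : ℕ in atTop,
      V ≤ (T / m) ^ 2 * ∑ x, ∑ y, ‖quadMatrix α n T N m x y‖ ^ 2 := by
  obtain ⟨c, hc, L, hL, hcL⟩ := eventually_le_sum_duhamelKernel_sq hT (jb_pos n)
  set c' := ((2 * Real.pi)⁻¹) ^ 2 * (c / 2) with hc'
  have hc'0 : 0 < c' := by positivity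
  -- The shift by `⟨n⟩` keeps `⟨n-k⟩ ≥ L` as well. It also gives `⟨n-k⟩ ≤ 2⟨k⟩`, the source of the
  -- factor `1/2` in `c'`.
  obtain ⟨B, hB, hBV⟩ := exists_finset_sum_inv_jb_sq (L + jb n) (V / c')
  have hB' : ∀ᶠ N in atTop, B ⊆ pairs n N := by
    have := (Finset.eventually_all B).2 fun k _ => eventually_mem_pairs n k
    filter_upwards [this] with N hN k hk using hN k hk
  filter_upwards [hB'] with N hN
  have hlow : ∀ k ∈ B, L ≤ jb (n - k) := by
    intro k hk
    have h1 := (abs_le.1 (abs_jb_sub_jb_le n k)).2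
    have h2 := hB k hk
    linarith
  have hm := (Finset.eventually_all B).2 fun k hk => hcL (jb k) (jb (n - k))
    (by linarith [hB k hk, jb_pos n]) (hlow k hk) (abs_jb_sub_jb_le n k)
  filter_upwards [hm] with m hm
  rw [sum_norm_quadMatrix_sq]
  have hterm : ∀ k ∈ B, c' * (jb k ^ 2)⁻¹ ≤ (T / m) ^ 2 *
      ∑ i ∈ Finset.range m, ∑ j ∈ Finset.range m, pairKernel α n T m k i j ^ 2 := by
    intro k hk
    have hk1 := hm k hk
    have e1 : (T / m) ^ 2 * ∑ i ∈ Finset.range m, ∑ j ∈ Finset.range m, pairKernel α n T m k i j ^ 2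
        = ((2 * Real.pi)⁻¹) ^ 2 * ((jb k ^ (α - 1)) ^ 2 * (jb (n - k) ^ (α - 1)) ^ 2)
          * ((T / m) ^ 2 * ∑ i ∈ Finset.range m, ∑ j ∈ Finset.range m,
            duhamelKernel (jb n) T (jb k) (jb (n - k)) ((i + 1) * (T / m)) ((j + 1) * (T / m)) ^ 2) := by
      simp only [pairKernel, mul_pow, ← Finset.mul_sum]
      ring
    rw [e1]
    have e2 : (jb k ^ 2)⁻¹ / 2 ≤ (jb k ^ (α - 1)) ^ 2 * (jb (n - k) ^ (α - 1)) ^ 2 := by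
      have f1 := sq_rpow_ge (one_le_jb k) hα
      have f2 := sq_rpow_ge (one_le_jb (n - k)) hα
      have f3 : (2 * jb k)⁻¹ ≤ (jb (n - k))⁻¹ := by
        refine inv_anti₀ (jb_pos _) ?_
        have := (abs_le.1 (abs_jb_sub_jb_le n k)).1
        have := hB k hk
        linarith
      have hp := jb_pos k
      have hp' := jb_pos (n - k)
      calc (jb k ^ 2)⁻¹ / 2 = (jb k)⁻¹ * (2 * jb k)⁻¹ := by field_simp
        _ ≤ (jb k ^ (α - 1)) ^ 2 * (jb (n - k) ^ (α - 1)) ^ 2 :=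
          mul_le_mul f1 (f3.trans f2) (by positivity) (by positivity)
    have hp := jb_pos k
    calc c' * (jb k ^ 2)⁻¹ = ((2 * Real.pi)⁻¹) ^ 2 * ((jb k ^ 2)⁻¹ / 2) * c := by
          rw [hc']
          ring
      _ ≤ _ := by gcongr
  calc V ≤ c' * ∑ k ∈ B, (jb k ^ 2)⁻¹ := by
        rw [div_lt_iff₀ hc'0] at hBV
        linarith
    _ ≤ ∑ k ∈ B, (T / m) ^ 2 *
      ∑ i ∈ Finset.range m, ∑ j ∈ Finset.range m, pairKernel α n T m k i j ^ 2 := by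
        rw [Finset.mul_sum]
        exact Finset.sum_le_sum hterm
    _ ≤ ∑ k ∈ pairs n N, (T / m) ^ 2 *
      ∑ i ∈ Finset.range m, ∑ j ∈ Finset.range m, pairKernel α n T m k i j ^ 2 :=
        Finset.sum_le_sum_of_subset_of_nonneg hN fun k _ _ => mul_nonneg (sq_nonneg _)
          (Finset.sum_nonneg fun i _ => Finset.sum_nonneg fun j _ => sq_nonneg _)
    _ = _ := by rw [Finset.mul_sum]

-- The Gaussian noise and measurability.

/-- The normalized increments on the mesh `T/m` of independent Brownian motions are independent
standard normal variables. -/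
theorem hasLaw_increments {Ω ι : Type*} [MeasurableSpace Ω] {P : Measure Ω} [IsProbabilityMeasure P]
    {w : ι → ℝ≥0 → Ω → ℝ} (hm : ∀ k t, Measurable (w k t))
    (hB : ∀ k, IsPreBrownianReal (w k) P) (hI : iIndepFun (fun k ω t => w k t ω) P)
    (F : Finset ι) {T : ℝ} (hT : 0 < T) {m : ℕ} (hm0 : 0 < m) :
    HasLaw (fun ω (x : F × Fin m) => (Real.sqrt (T / m))⁻¹ *
      (w x.1 ((x.2 + 1) * (T / m)).toNNReal ω - w x.1 (x.2 * (T / m)).toNNReal ω))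
      (Measure.pi fun _ => gaussianReal 0 1) P := by
  have hm' : (0 : ℝ) < m := by exact_mod_cast hm0
  set c : ℝ := Real.sqrt (T / m) with hc
  have hc0 : 0 < c := Real.sqrt_pos.2 (by positivity)
  set τ : ℕ → ℝ≥0 := fun i => ((i : ℝ) * (T / m)).toNNReal with hτ
  have hτm : Monotone τ := by
    intro i j hij
    refine Real.toNNReal_mono ?_
    gcongr
  set X : F → Fin m → Ω → ℝ := fun k i ω => c⁻¹ * (w k (τ (i + 1)) ω - w k (τ i) ω) with hX
  have hXm : ∀ k i, Measurable (X k i) := fun k i =>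
    ((hm k _).sub (hm k _)).const_mul _
  have h1 : iIndepFun (fun (k : F) ω i => X k i ω) P := by
    have e1 : iIndepFun (fun (k : F) ω t => w k t ω) P :=
      hI.precomp (g := fun k : F => (k : ι)) Subtype.val_injective
    exact e1.comp (fun (k : F) (p : ℝ≥0 → ℝ) (i : Fin m) => c⁻¹ * (p (τ (i + 1)) - p (τ i)))
      (fun k => by fun_prop)
  have h2 : ∀ k, iIndepFun (X k) P := by
    intro k
    have e1 := ((hB k).hasIndepIncrements.nat hτm).precomp (g := fun i : Fin m => (i : ℕ))
      Fin.val_injective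
    exact e1.comp (fun _ x => c⁻¹ * x) (fun _ => by fun_prop)
  -- Independence across paths and independence of increments within each path combine into
  -- independence of the whole array.
  have h3 := iIndepFun_uncurry' hXm h1 h2
  have hlaw : ∀ x : F × Fin m, HasLaw (fun ω => X x.1 x.2 ω) (gaussianReal 0 1) P := by
    intro x
    have e1 := (hB x.1).hasLaw_sub (τ (x.2 + 1)) (τ x.2)
    have e2 := gaussianReal_const_mul e1 c⁻¹
    refine ⟨(hXm _ _).aemeasurable, ?_⟩
    have e3 := e2.map_eq
    rw [mul_zero] at e3
    have e4 : (.mk (c⁻¹ ^ 2) (sq_nonneg _) : ℝ≥0) * nndist (τ (x.2 + 1)).1 (τ x.2).1 = 1 := by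
      ext
      rw [NNReal.coe_mul, coe_nndist, Real.dist_eq]
      have f1 : ((τ (x.2 + 1)) : ℝ) = ((x.2 + 1 : ℕ) : ℝ) * (T / m) := Real.coe_toNNReal _ (by positivity)
      have f2 : ((τ x.2) : ℝ) = ((x.2 : ℕ) : ℝ) * (T / m) := Real.coe_toNNReal _ (by positivity)
      change c⁻¹ ^ 2 * |((τ (x.2 + 1)) : ℝ) - (τ x.2 : ℝ)| = 1
      rw [f1, f2, ← sub_mul]
      push_cast
      rw [add_sub_cancel_left, one_mul, abs_of_pos (by positivity), inv_pow, hc,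
        Real.sq_sqrt (by positivity)]
      field_simp
    rw [e4] at e3
    exact e3
  have h4 := h3.hasLaw_pi hlaw
  convert h4 using 4 with ω x
  simp [hτ]

/-- The real paths, parametrized by `ℝ`. -/
def pathOf {Ω : Type*} (w : ℤ × ℤ → ℝ≥0 → Ω → ℝ) (ω : Ω) (k : ℤ × ℤ) (s : ℝ) : ℝ :=
  w k s.toNNReal ω

/-- Independent Brownian motions indexed by `ℤ²`, all of whose paths are continuous and start from
`0`. -/
structure IsContinuousNoise {Ω : Type*} [MeasurableSpace Ω] (w : ℤ × ℤ → ℝ≥0 → Ω → ℝ)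
    (P : Measure Ω) : Prop where
  measurable : ∀ k t, Measurable (w k t)
  continuous : ∀ k ω, Continuous fun t => w k t ω
  zero : ∀ k ω, w k 0 ω = 0
  brownian : ∀ k, IsPreBrownianReal (w k) P
  indep : iIndepFun (fun k ω t => w k t ω) P

/-- One of the components at `k` and `-k` records the real part; the other records the imaginary
part of whichever number sits in the lower half-lattice, which explains the signs in `negCoef`. -/
theorem eq_selfCoef_mul_add {z z' : ℂ} (h : z' = (starRingEnd ℂ) z) {k : ℤ × ℤ}
    (hk : k = 0 → z' = z) {x y : ℝ}
    (hx : x = if k = 0 then z.re else if 0 < k.1 ∨ (k.1 = 0 ∧ 0 < k.2) then Real.sqrt 2 * z.re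
      else Real.sqrt 2 * z.im)
    (hy : y = if -k = 0 then z'.re else if 0 < (-k).1 ∨ ((-k).1 = 0 ∧ 0 < (-k).2) then
      Real.sqrt 2 * z'.re else Real.sqrt 2 * z'.im) :
    z = selfCoef k * x + negCoef k * y := by
  by_cases hk0 : k = 0
  · have h3 := hk hk0
    rw [h] at h3
    rw [if_pos hk0] at hx
    rw [hx, selfCoef, negCoef, if_pos hk0, if_pos hk0, zero_mul, add_zero, one_mul]
    exact (Complex.conj_eq_iff_re.1 h3).symm
  · have hk0' : ¬ -k = 0 := by simpa using hk0
    rw [if_neg hk0] at hx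
    simp only [if_neg hk0', halfPlane_neg_iff hk0] at hy
    rw [selfCoef, negCoef, if_neg hk0, if_neg hk0]
    by_cases hu : 0 < k.1 ∨ (k.1 = 0 ∧ 0 < k.2)
    · rw [if_pos hu] at hx ⊢
      rw [if_neg (not_not.2 hu), h, Complex.conj_im] at hy
      rw [if_pos hu, hx, hy]
      apply Complex.ext
      · simp [← mul_assoc]
      · simp [← mul_assoc]
    · rw [if_neg hu] at hx ⊢
      rw [if_pos hu, h, Complex.conj_re] at hy
      rw [if_neg hu, hx, hy]
      apply Complex.ext
      · simp [← mul_assoc]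
      · simp [← mul_assoc]

/-- The real components of a cylindrical Wiener process have a version with continuous paths. -/
theorem IsCylindricalWiener.exists_continuousNoise {Ω : Type*} [MeasurableSpace Ω] {P : Measure Ω}
    [IsProbabilityMeasure P] {β : ℤ × ℤ → ℝ≥0 → Ω → ℂ} (hβ : IsCylindricalWiener β P) :
    ∃ w : ℤ × ℤ → ℝ≥0 → Ω → ℝ, IsContinuousNoise w P ∧
      ∀ᵐ ω ∂P, ∀ k, ∀ s : ℝ, β k s.toNNReal ω = fourierPath (pathOf w ω) k s := by
  set h := realComponent β with hh
  have hBp : ∀ k, IsPreBrownianReal (h k) P := fun k => (hβ.brownian k).toIsPreBrownianReal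
  -- At each time the components are only almost everywhere measurable. Agreement with measurable
  -- versions can be demanded on a single full-measure set at countably many times, and continuity
  -- extends measurability to all times.
  set d := TopologicalSpace.denseSeq ℝ≥0
  have hae : ∀ᵐ ω ∂P, (∀ k, Continuous fun t => h k t ω) ∧ (∀ k, h k 0 ω = 0) ∧
      (∀ k j, h k (d j) ω = ((hBp k).aemeasurable (d j)).mk _ ω) ∧
      (∀ k t, β (-k) t ω = (starRingEnd ℂ) (β k t ω)) := by
    refine (ae_all_iff.2 fun k => (hβ.brownian k).cont).and
      ((ae_all_iff.2 fun k => (hBp k).eval_zero_ae_eq_zero).and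
      ((ae_all_iff.2 fun k => ae_all_iff.2 fun j => ((hBp k).aemeasurable (d j)).ae_eq_mk).and
      (ae_all_iff.2 hβ.conj)))
  obtain ⟨Gc, hGc, hGm, hG0⟩ := exists_measurable_superset_of_null hae
  set G := Gcᶜ with hG
  have hGmeas : MeasurableSet G := hGm.compl
  have hGae : ∀ᵐ ω ∂P, ω ∈ G := by
    rw [ae_iff]
    simpa [hG] using hG0
  have hGprop : ∀ ω ∈ G, (∀ k, Continuous fun t => h k t ω) ∧ (∀ k, h k 0 ω = 0) ∧
      (∀ k j, h k (d j) ω = ((hBp k).aemeasurable (d j)).mk _ ω) ∧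
      (∀ k t, β (-k) t ω = (starRingEnd ℂ) (β k t ω)) := by
    intro ω hω
    by_contra h'
    exact hω (hGc h')
  -- Off the good measurable set all paths are replaced by `0`, so continuity and the initial value
  -- hold for every `ω`.
  set w : ℤ × ℤ → ℝ≥0 → Ω → ℝ := fun k t => G.indicator (h k t) with hw
  have hwG : ∀ k t ω, ω ∈ G → w k t ω = h k t ω := fun k t ω hω => Set.indicator_of_mem hω _
  have hwN : ∀ k t ω, ω ∉ G → w k t ω = 0 := fun k t ω hω => Set.indicator_of_notMem hω _
  have hcont : ∀ k ω, Continuous fun t => w k t ω := by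
    intro k ω
    by_cases hω : ω ∈ G
    · simp only [hwG k _ ω hω]
      exact (hGprop ω hω).1 k
    · simp only [hwN k _ ω hω]
      exact continuous_const
  have hdm : ∀ k j, Measurable (w k (d j)) := by
    intro k j
    have : w k (d j) = G.indicator (((hBp k).aemeasurable (d j)).mk _) := by
      ext ω
      by_cases hω : ω ∈ G
      · rw [hwG k _ ω hω, Set.indicator_of_mem hω, (hGprop ω hω).2.2.1 k j]
      · rw [hwN k _ ω hω, Set.indicator_of_notMem hω]
    rw [this]
    exact ((hBp k).aemeasurable (d j)).measurable_mk.indicator hGmeas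
  refine ⟨w, ⟨?_, hcont, ?_, ?_, ?_⟩, ?_⟩
  · intro k t
    obtain ⟨x, hx, hxt⟩ := mem_closure_iff_seq_limit.1 (TopologicalSpace.denseRange_denseSeq ℝ≥0 t)
    refine measurable_of_tendsto_metrizable (f := fun j => w k (x j)) (fun j => ?_) ?_
    · obtain ⟨i, hi⟩ := hx j
      rw [← hi]
      exact hdm k i
    · exact tendsto_pi_nhds.2 fun ω => ((hcont k ω).tendsto t).comp hxt
  · intro k ω
    by_cases hω : ω ∈ G
    · rw [hwG k _ ω hω]
      exact (hGprop ω hω).2.1 k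
    · exact hwN k _ ω hω
  · intro k
    refine (hBp k).congr fun t => ?_
    filter_upwards [hGae] with ω hω using (hwG k t ω hω).symm
  · refine hβ.indep.congr fun k => ?_
    filter_upwards [hGae] with ω hω
    ext t
    exact (hwG k t ω hω).symm
  · filter_upwards [hGae] with ω hω k s
    have hconj := (hGprop ω hω).2.2.2
    have hk : k = 0 → β (-k) s.toNNReal ω = β k s.toNNReal ω := by
      rintro rfl
      rw [neg_zero]
    exact eq_selfCoef_mul_add (hconj k s.toNNReal) hk (hwG k _ ω hω) (hwG (-k) _ ω hω)

section

variable {Ω : Type*} {w : ℤ × ℤ → ℝ≥0 → Ω → ℝ}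

theorem continuous_pathOf (hc : ∀ k ω, Continuous fun t => w k t ω) (ω : Ω) (k : ℤ × ℤ) :
    Continuous (pathOf w ω k) :=
  (hc k ω).comp continuous_real_toNNReal

theorem pathOf_zero (h0 : ∀ k ω, w k 0 ω = 0) (ω : Ω) (k : ℤ × ℤ) : pathOf w ω k 0 = 0 := by
  simp [pathOf, h0]

theorem measurable_meshQuad {mΩ : MeasurableSpace Ω} (hm : ∀ k t, Measurable (w k t)) (α : ℝ)
    (n : ℤ × ℤ) (T : ℝ) (N m : ℕ) : Measurable fun ω => meshQuad α n T (pathOf w ω) N m := by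
  simp only [meshQuad_eq_sum, pathOf]
  fun_prop

theorem measurable_pathQuad {mΩ : MeasurableSpace Ω} (hm : ∀ k t, Measurable (w k t))
    (hc : ∀ k ω, Continuous fun t => w k t ω) (h0 : ∀ k ω, w k 0 ω = 0) (α : ℝ)
    (n : ℤ × ℤ) {T : ℝ} (hT : 0 < T) (N : ℕ) :
    Measurable fun ω => pathQuad α n T (pathOf w ω) N :=
  measurable_of_tendsto_metrizable (fun m => measurable_meshQuad hm α n T N m)
    (tendsto_pi_nhds.2 fun ω => tendsto_meshQuad (continuous_pathOf hc ω) (pathOf_zero h0 ω) hT α n N)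

end

/-- The increments of the paths on the mesh `T/m`. -/
def meshIncrement {Ω : Type*} (w : ℤ × ℤ → ℝ≥0 → Ω → ℝ) (T : ℝ) (N m : ℕ) (ω : Ω)
    (x : freq N × Fin m) : ℝ :=
  pathOf w ω x.1 ((x.2 + 1) * (T / m)) - pathOf w ω x.1 (x.2 * (T / m))

section

variable {Ω : Type*} [MeasurableSpace Ω] {P : Measure Ω} [IsProbabilityMeasure P]
  {w : ℤ × ℤ → ℝ≥0 → Ω → ℝ}

/-- Increments are `√(T/m)` times standard normals; the rescaled matrix `(T/m) A` produces the
factor `(T/m)²`, the area of a mesh cell in a double integral. -/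
theorem norm_integral_cexp_increments_le (hw : IsContinuousNoise w P) {T : ℝ} (hT : 0 < T) {N m : ℕ}
    (hm : 0 < m) (A : Matrix (freq N × Fin m) (freq N × Fin m) ℝ) (hA : ∀ x y, A x y = A y x)
    (ξ : ℝ) :
    ‖∫ ω, Complex.exp (Complex.I * (ξ * ∑ x, ∑ y, A x y * meshIncrement w T N m ω x
      * meshIncrement w T N m ω y : ℝ)) ∂P‖ ^ 4
      * (1 + 4 * ξ ^ 2 * ((T / m) ^ 2 * ∑ x, ∑ y, A x y ^ 2)) ≤ 1 := by
  have hm' : (0 : ℝ) < m := by exact_mod_cast hm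
  have hlaw := hasLaw_increments hw.measurable hw.brownian hw.indep (freq N) hT hm
  set B : Matrix (freq N × Fin m) (freq N × Fin m) ℝ := fun x y => T / m * A x y with hB
  have hBh : B.IsHermitian := by
    ext x y
    rw [Matrix.conjTranspose_apply, star_trivial]
    simp only [hB, hA x y]
  have h1 := norm_integral_cexp_quadraticForm_le hBh ξ
  have hsq : Real.sqrt (T / m) * Real.sqrt (T / m) = T / m :=
    Real.mul_self_sqrt (by positivity)
  have hs0 : Real.sqrt (T / m) ≠ 0 := (Real.sqrt_pos.2 (by positivity)).ne'
  have h2 : (∫ ω, Complex.exp (Complex.I * (ξ * ∑ x, ∑ y, A x y * meshIncrement w T N m ω x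
      * meshIncrement w T N m ω y : ℝ)) ∂P)
      = ∫ g : freq N × Fin m → ℝ, Complex.exp (Complex.I * (ξ * ∑ x, ∑ y, B x y * g x * g y : ℝ))
        ∂(Measure.pi fun _ => gaussianReal 0 1) := by
    rw [← hlaw.map_eq, integral_map hlaw.aemeasurable
      (Continuous.aestronglyMeasurable (by fun_prop))]
    refine integral_congr_ae (Eventually.of_forall fun ω => ?_)
    simp only [hB]
    congr 4
    refine Finset.sum_congr rfl fun x _ => Finset.sum_congr rfl fun y _ => ?_
    have e1 : ∀ c p q r : ℝ, r ≠ 0 → c * p * q = r * r * c * (r⁻¹ * p) * (r⁻¹ * q) := by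
      intro c p q r hr
      field_simp
    have e2 := e1 (A x y) (meshIncrement w T N m ω x) (meshIncrement w T N m ω y) _ hs0
    rw [hsq] at e2
    exact e2
  have h3 : ∑ x, ∑ y, B x y ^ 2 = (T / m) ^ 2 * ∑ x, ∑ y, A x y ^ 2 := by
    simp only [hB, mul_pow, Finset.mul_sum]
  rw [h2, ← h3]
  exact h1

theorem measurable_cexp_I_mul {g : Ω → ℝ} (hg : Measurable g) (ξ : ℝ) :
    Measurable fun ω => Complex.exp (Complex.I * (ξ * g ω : ℝ)) := by
  fun_prop

theorem meshQuad_eq_sum_meshIncrement {Ω : Type*} {w : ℤ × ℤ → ℝ≥0 → Ω → ℝ} (α : ℝ) (n : ℤ × ℤ) (T : ℝ) (N m : ℕ) (ω : Ω) :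
    meshQuad α n T (pathOf w ω) N m = ∑ x, ∑ y, quadMatrix α n T N m x y
      * meshIncrement w T N m ω x * meshIncrement w T N m ω y :=
  meshQuad_eq_sum α n T (pathOf w ω) N m

-- Failure of almost sure convergence.

/-- The characteristic functions of the real and imaginary parts of the Fourier coefficients are
not both large. -/
theorem eventually_norm_integral_cexp_le (hw : IsContinuousNoise w P) {α : ℝ} (hα : 1 / 2 ≤ α)
    (n : ℤ × ℤ) {T : ℝ} (hT : 0 < T) {ξ : ℝ} (hξ : ξ ≠ 0) :
    ∀ᶠ N in atTop,
      ‖∫ ω, Complex.exp (Complex.I * (ξ * (pathQuad α n T (pathOf w ω) N).re : ℝ)) ∂P‖ ≤ 1 / 2 ∨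
      ‖∫ ω, Complex.exp (Complex.I * (ξ * (pathQuad α n T (pathOf w ω) N).im : ℝ)) ∂P‖ ≤ 1 / 2 := by
  -- If both moduli exceeded `1/2`, each of the two parts would contribute at most `15` to `4ξ²`
  -- times the scaled squared norm, while the level `8/ξ²` forces at least `32`.
  filter_upwards [eventually_le_sum_norm_quadMatrix_sq hα n hT (8 / ξ ^ 2)] with N hN
  by_contra! hcon
  obtain ⟨hre, him⟩ := hcon
  have hlim : ∀ f : ℂ → ℝ, Continuous f →
      Tendsto (fun m => ‖∫ ω, Complex.exp (Complex.I *
        (ξ * f (meshQuad α n T (pathOf w ω) N m) : ℝ)) ∂P‖) atTop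
      (𝓝 ‖∫ ω, Complex.exp (Complex.I * (ξ * f (pathQuad α n T (pathOf w ω) N) : ℝ)) ∂P‖) := by
    intro f hf
    refine Tendsto.norm ?_
    refine tendsto_integral_of_dominated_convergence (fun _ => 1) (fun m => ?_)
      (integrable_const _) (fun m => Eventually.of_forall fun ω => ?_)
      (Eventually.of_forall fun ω => ?_)
    · exact (measurable_cexp_I_mul (hf.measurable.comp
        (measurable_meshQuad hw.measurable α n T N m)) ξ).aestronglyMeasurable
    · rw [mul_comm, Complex.norm_exp_ofReal_mul_I]
    · have h1 := tendsto_meshQuad (continuous_pathOf hw.continuous ω) (pathOf_zero hw.zero ω)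
        hT α n N
      have h2 : Continuous fun z : ℂ => Complex.exp (Complex.I * (ξ * f z : ℝ)) := by fun_prop
      exact (h2.tendsto _).comp h1
  have hre' := (hlim Complex.re Complex.continuous_re).eventually (lt_mem_nhds hre)
  have him' := (hlim Complex.im Complex.continuous_im).eventually (lt_mem_nhds him)
  obtain ⟨m, ⟨⟨hm1, hm2⟩, hm3⟩, hm0⟩ := (((hre'.and him').and hN).and
    (eventually_gt_atTop 0)).exists
  have hb1 := norm_integral_cexp_increments_le hw hT hm0
    (fun x y => (quadMatrix α n T N m x y).re) (fun x y => by rw [quadMatrix_comm]) ξ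
  have hb2 := norm_integral_cexp_increments_le hw hT hm0
    (fun x y => (quadMatrix α n T N m x y).im) (fun x y => by rw [quadMatrix_comm]) ξ
  have hre2 : ∀ ω, (meshQuad α n T (pathOf w ω) N m).re = ∑ x, ∑ y,
      (quadMatrix α n T N m x y).re * meshIncrement w T N m ω x * meshIncrement w T N m ω y := by
    intro ω
    simp only [meshQuad_eq_sum_meshIncrement, Complex.re_sum, Complex.re_mul_ofReal]
  have him2 : ∀ ω, (meshQuad α n T (pathOf w ω) N m).im = ∑ x, ∑ y,
      (quadMatrix α n T N m x y).im * meshIncrement w T N m ω x * meshIncrement w T N m ω y := by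
    intro ω
    simp only [meshQuad_eq_sum_meshIncrement, Complex.im_sum, Complex.im_mul_ofReal]
  simp only [hre2] at hm1
  simp only [him2] at hm2
  have hsum : ∑ x, ∑ y, ‖quadMatrix α n T N m x y‖ ^ 2
      = ∑ x, ∑ y, (quadMatrix α n T N m x y).re ^ 2 + ∑ x, ∑ y, (quadMatrix α n T N m x y).im ^ 2 := by
    rw [← Finset.sum_add_distrib]
    refine Finset.sum_congr rfl fun x _ => ?_
    rw [← Finset.sum_add_distrib]
    refine Finset.sum_congr rfl fun y _ => ?_
    rw [← Complex.normSq_eq_norm_sq, Complex.normSq_apply, sq, sq]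
  rw [hsum, mul_add] at hm3
  have key : ∀ r S : ℝ, 1 / 2 < r → 0 ≤ S → r ^ 4 * (1 + 4 * ξ ^ 2 * S) ≤ 1 →
      4 * ξ ^ 2 * S ≤ 15 := by
    intro r S hr hS h
    have h1 : (1 / 2 : ℝ) ^ 4 ≤ r ^ 4 := by gcongr
    have h2 : 0 ≤ 1 + 4 * ξ ^ 2 * S := by positivity
    nlinarith [mul_le_mul_of_nonneg_right h1 h2]
  have k1 := key _ _ hm1 (mul_nonneg (sq_nonneg _) (Finset.sum_nonneg fun x _ =>
    Finset.sum_nonneg fun y _ => sq_nonneg _)) hb1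
  have k2 := key _ _ hm2 (mul_nonneg (sq_nonneg _) (Finset.sum_nonneg fun x _ =>
    Finset.sum_nonneg fun y _ => sq_nonneg _)) hb2
  have hξ2 : 0 < ξ ^ 2 := by positivity
  have h8 : 4 * ξ ^ 2 * (8 / ξ ^ 2) = 32 := by
    field_simp
    norm_num
  have := mul_le_mul_of_nonneg_left hm3 (by positivity : 0 ≤ 4 * ξ ^ 2)
  linarith

/-- The Fourier coefficients do not converge almost surely. -/
theorem not_ae_tendsto_pathQuad (hw : IsContinuousNoise w P) {α : ℝ} (hα : 1 / 2 ≤ α)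
    (n : ℤ × ℤ) {T : ℝ} (hT : 0 < T) (D : ℕ → ℂ) :
    ¬ ∀ᵐ ω ∂P, ∃ c, Tendsto (fun N => pathQuad α n T (pathOf w ω) N - D N) atTop (𝓝 c) := by
  intro hae
  have hXm : ∀ N, Measurable fun ω => pathQuad α n T (pathOf w ω) N := fun N =>
    measurable_pathQuad hw.measurable hw.continuous hw.zero α n hT N
  obtain ⟨X, hX, hlim⟩ := measurable_limit_of_tendsto_metrizable_ae
    (fun N => ((hXm N).sub_const (D N)).aemeasurable) hae
  have hcont : ∀ f : ℂ → ℝ, Continuous f → ∀ᶠ ξ : ℝ in 𝓝 0,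
      1 / 2 < ‖∫ ω, Complex.exp (Complex.I * (ξ * f (X ω) : ℝ)) ∂P‖ := by
    intro f hf
    have h1 : Tendsto (fun ξ : ℝ => ‖∫ ω, Complex.exp (Complex.I * (ξ * f (X ω) : ℝ)) ∂P‖) (𝓝 0)
        (𝓝 ‖∫ ω, Complex.exp (Complex.I * ((0 : ℝ) * f (X ω) : ℝ)) ∂P‖) := by
      refine Tendsto.norm ?_
      refine tendsto_integral_filter_of_dominated_convergence (fun _ => 1)
        (Eventually.of_forall fun ξ => ?_) (Eventually.of_forall fun ξ =>
        Eventually.of_forall fun ω => ?_) (integrable_const _) (Eventually.of_forall fun ω => ?_)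
      · exact (measurable_cexp_I_mul (hf.measurable.comp hX) ξ).aestronglyMeasurable
      · rw [mul_comm, Complex.norm_exp_ofReal_mul_I]
      · exact (by fun_prop : Continuous fun ξ : ℝ =>
          Complex.exp (Complex.I * (ξ * f (X ω) : ℝ))).tendsto 0
    refine h1.eventually (lt_mem_nhds ?_)
    simp
    norm_num
  -- A single nonzero `ξ` near `0` serving the real and the imaginary part; at `ξ = 0` the quadratic
  -- form bound is void.
  obtain ⟨ξ, hξ, hξ0⟩ := ((((hcont Complex.re Complex.continuous_re).and
    (hcont Complex.im Complex.continuous_im)).filter_mono nhdsWithin_le_nhds).and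
    (eventually_mem_nhdsWithin (a := (0 : ℝ)) (s := {0}ᶜ))).exists
  have hφ : ∀ f : ℂ → ℝ, Continuous f → (∀ z z', f (z - z') = f z - f z') →
      Tendsto (fun N => ‖∫ ω, Complex.exp (Complex.I *
        (ξ * f (pathQuad α n T (pathOf w ω) N) : ℝ)) ∂P‖) atTop
      (𝓝 ‖∫ ω, Complex.exp (Complex.I * (ξ * f (X ω) : ℝ)) ∂P‖) := by
    intro f hf hsub
    -- A deterministic shift only multiplies the characteristic function by a phase, so no
    -- renormalization by constants can help.
    have h1 : ∀ N, ‖∫ ω, Complex.exp (Complex.I *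
        (ξ * f (pathQuad α n T (pathOf w ω) N) : ℝ)) ∂P‖
        = ‖∫ ω, Complex.exp (Complex.I *
        (ξ * f (pathQuad α n T (pathOf w ω) N - D N) : ℝ)) ∂P‖ := by
      intro N
      have h2 : ∀ ω, Complex.exp (Complex.I * (ξ * f (pathQuad α n T (pathOf w ω) N) : ℝ))
          = Complex.exp ((ξ * f (D N) : ℝ) * Complex.I) * Complex.exp (Complex.I *
            (ξ * f (pathQuad α n T (pathOf w ω) N - D N) : ℝ)) := by
        intro ω
        rw [hsub, ← Complex.exp_add]
        congr 1
        push_cast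
        ring
      simp_rw [h2]
      rw [integral_const_mul, norm_mul, Complex.norm_exp_ofReal_mul_I, one_mul]
    simp_rw [h1]
    refine Tendsto.norm ?_
    refine tendsto_integral_of_dominated_convergence (fun _ => 1) (fun N => ?_)
      (integrable_const _) (fun N => Eventually.of_forall fun ω => ?_) ?_
    · exact (measurable_cexp_I_mul (hf.measurable.comp
        ((hXm N).sub_const (D N))) ξ).aestronglyMeasurable
    · rw [mul_comm, Complex.norm_exp_ofReal_mul_I]
    · filter_upwards [hlim] with ω hω
      have h2 : Continuous fun z : ℂ => Complex.exp (Complex.I * (ξ * f z : ℝ)) := by fun_prop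
      exact (h2.tendsto _).comp hω
  obtain ⟨N, hN, h1, h2⟩ := ((eventually_norm_integral_cexp_le hw hα n hT hξ0).and
    (((hφ Complex.re Complex.continuous_re Complex.sub_re).eventually (lt_mem_nhds hξ.1)).and
    ((hφ Complex.im Complex.continuous_im Complex.sub_im).eventually (lt_mem_nhds hξ.2)))).exists
  rcases hN with hN | hN <;> linarith

-- The zero-one law.

/-- Setting finitely many of the real components to `0` changes the Fourier coefficients by an
eventually constant amount. -/
theorem eventually_pathQuad_sub_eq (α : ℝ) (n : ℤ × ℤ) (T : ℝ) {u v : ℤ × ℤ → ℝ → ℝ}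
    {S : Set (ℤ × ℤ)} (hS : S.Finite) (huv : ∀ k ∉ S, u k = v k) :
    ∃ c, ∀ᶠ N in atTop, pathQuad α n T u N - pathQuad α n T v N = c := by
  set f : ℤ × ℤ → ℂ := fun k =>
    duhamelProduct α (jb n) T (jb k) (jb (n - k)) (fourierPath u k) (fourierPath u (n - k))
    - duhamelProduct α (jb n) T (jb k) (jb (n - k)) (fourierPath v k) (fourierPath v (n - k)) with hf
  -- The complex path at `k` involves the real components `k` and `-k`, and the summand at `k`
  -- involves the paths at `k` and `n - k`. So only finitely many summands are affected, and all of
  -- them belong to `pairs n N` for large `N`.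
  set R : Set (ℤ × ℤ) := S ∪ (fun k => -k) '' S with hR
  have hRf : R.Finite := hS.union (hS.image _)
  have hpath : ∀ k ∉ R, fourierPath u k = fourierPath v k := by
    intro k hk
    have h1 : k ∉ S := fun h => hk (Or.inl h)
    have h2 : -k ∉ S := fun h => hk (Or.inr ⟨-k, h, neg_neg k⟩)
    ext s
    rw [fourierPath, fourierPath, huv k h1, huv (-k) h2]
  set B : Set (ℤ × ℤ) := R ∪ (fun k => n - k) '' R with hB
  have hBf : B.Finite := hRf.union (hRf.image _)
  have hf0 : ∀ k ∉ B, f k = 0 := by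
    intro k hk
    have h1 : k ∉ R := fun h => hk (Or.inl h)
    have h2 : n - k ∉ R := fun h => hk (Or.inr ⟨n - k, h, by simp⟩)
    simp only [hf, hpath k h1, hpath _ h2, sub_self]
  refine ⟨((2 * Real.pi)⁻¹ : ℝ) * ∑ k ∈ hBf.toFinset, f k, ?_⟩
  have h1 : ∀ᶠ N in atTop, hBf.toFinset ⊆ pairs n N := by
    have := (Finset.eventually_all hBf.toFinset).2 fun k _ => eventually_mem_pairs n k
    filter_upwards [this] with N hN k hk using hN k hk
  filter_upwards [h1] with N hN
  rw [pathQuad, pathQuad, ← mul_sub, ← Finset.sum_sub_distrib]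
  congr 1
  symm
  refine Finset.sum_subset hN fun k _ hk => hf0 k ?_
  simpa using hk

/-- The Fourier coefficients almost surely have no limit. -/
theorem ae_not_tendsto_pathQuad (hw : IsContinuousNoise w P) {α : ℝ} (hα : 1 / 2 ≤ α)
    (n : ℤ × ℤ) {T : ℝ} (hT : 0 < T) (D : ℕ → ℂ) :
    ∀ᵐ ω ∂P, ¬ ∃ c, Tendsto (fun N => pathQuad α n T (pathOf w ω) N - D N) atTop (𝓝 c) := by
  set E : Set Ω := {ω | ∃ c, Tendsto (fun N => pathQuad α n T (pathOf w ω) N - D N) atTop (𝓝 c)}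
    with hE
  set s : ℤ × ℤ → MeasurableSpace Ω := fun k =>
    MeasurableSpace.comap (fun ω t => w k t ω) MeasurableSpace.pi with hs
  have hsle : ∀ k, s k ≤ ‹MeasurableSpace Ω› := fun k =>
    (measurable_pi_lambda _ fun t => hw.measurable k t).comap_le
  -- For each finite `S`, zeroing the components in `S` does not change whether the sequence
  -- converges, so `E` is measurable with respect to the remaining components.
  have hEtail : MeasurableSet[limsup s cofinite] E := by
    rw [hasBasis_cofinite.limsup_eq_iInf_iSup]
    simp only [MeasurableSpace.measurableSet_iInf]
    intro S hS
    classical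
    set v : ℤ × ℤ → ℝ≥0 → Ω → ℝ := fun k => if k ∈ S then fun _ _ => 0 else w k with hv
    have hvm : ∀ k t, Measurable[⨆ a ∈ Sᶜ, s a] (v k t) := by
      intro k t
      by_cases hk : k ∈ S
      · simp only [hv, if_pos hk]
        exact measurable_const
      · simp only [hv, if_neg hk]
        have h1 : Measurable[s k] (w k t) :=
          (measurable_pi_apply t).comp (comap_measurable (fun ω t => w k t ω))
        exact h1.mono (le_iSup₂_of_le k hk le_rfl) le_rfl
    have hvc : ∀ k ω, Continuous fun t => v k t ω := by
      intro k ω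
      by_cases hk : k ∈ S
      · simp only [hv, if_pos hk]
        exact continuous_const
      · simp only [hv, if_neg hk]
        exact hw.continuous k ω
    have hv0 : ∀ k ω, v k 0 ω = 0 := by
      intro k ω
      by_cases hk : k ∈ S
      · simp only [hv, if_pos hk]
      · simp only [hv, if_neg hk]
        exact hw.zero k ω
    have hEv : E = {ω | ∃ c, Tendsto (fun N => pathQuad α n T (pathOf v ω) N - D N) atTop (𝓝 c)} := by
      ext ω
      obtain ⟨c₀, hc₀⟩ := eventually_pathQuad_sub_eq α n T (u := pathOf w ω) (v := pathOf v ω) hS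
        (fun k hk => by
          ext t
          simp only [pathOf, hv, if_neg hk])
      constructor
      · rintro ⟨c, hc⟩
        refine ⟨c - c₀, (hc.sub_const c₀).congr' ?_⟩
        filter_upwards [hc₀] with N hN
        rw [← hN]
        ring
      · rintro ⟨c, hc⟩
        refine ⟨c + c₀, (hc.add_const c₀).congr' ?_⟩
        filter_upwards [hc₀] with N hN
        rw [← hN]
        ring
    rw [hEv]
    let : MeasurableSpace Ω := ⨆ a ∈ Sᶜ, s a
    exact measurableSet_exists_tendsto fun N =>
      (measurable_pathQuad hvm hvc hv0 α n hT N).sub_const (D N)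
  have h01 : P E = 0 ∨ P E = 1 := by
    refine measure_zero_or_one_of_measurableSet_limsup (p := fun S : Set (ℤ × ℤ) => S.Finite)
      (ns := fun S : Finset (ℤ × ℤ) => (S : Set (ℤ × ℤ))) hsle hw.indep.iIndep ?_ ?_ ?_ ?_ hEtail
    · exact fun t ht => ht.compl_mem_cofinite
    · exact directed_of_isDirected_le fun a b hab => Finset.coe_subset.2 hab
    · exact fun a => a.finite_toSet
    · exact fun k => ⟨{k}, by simp⟩
  rcases h01 with h | h
  · rw [ae_iff]
    simpa using h
  · exfalso
    have hEm : MeasurableSet E := by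
      refine measurableSet_exists_tendsto fun N => ?_
      exact (measurable_pathQuad hw.measurable hw.continuous hw.zero α n hT N).sub_const (D N)
    exact not_ae_tendsto_pathQuad hw hα n hT D ((prob_compl_eq_zero_iff hEm).2 h)

end

-- Fourier coefficients of the second order term.

theorem continuous_e (n : ℤ × ℤ) : Continuous (e n) := by
  unfold e
  fun_prop

theorem integrableOn_cell {f : ℝ × ℝ → ℂ} (hf : Continuous f) : IntegrableOn f cell := by
  have h1 : IsCompact (Set.Icc (0 : ℝ) (2 * Real.pi) ×ˢ Set.Icc (0 : ℝ) (2 * Real.pi)) :=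
    isCompact_Icc.prod isCompact_Icc
  exact (hf.continuousOn.integrableOn_compact h1).mono_set
    (Set.prod_mono Set.Ioc_subset_Icc_self Set.Ioc_subset_Icc_self)

theorem integral_exp_int_mul (k : ℤ) :
    ∫ x in Set.Ioc 0 (2 * Real.pi), Complex.exp (Complex.I * k * x)
      = if k = 0 then (2 * Real.pi : ℂ) else 0 := by
  rw [← intervalIntegral.integral_of_le (by positivity)]
  by_cases hk : k = 0
  · subst hk
    simp
  · have hk' : Complex.I * k ≠ 0 := mul_ne_zero Complex.I_ne_zero (by exact_mod_cast hk)
    rw [integral_exp_mul_complex hk', if_neg hk]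
    have : Complex.exp (Complex.I * k * ((2 * Real.pi : ℝ) : ℂ)) = 1 := by
      rw [Complex.exp_eq_one_iff]
      refine ⟨k, ?_⟩
      push_cast
      ring
    rw [this]
    simp

theorem e_mul_conj_e (p n : ℤ × ℤ) (x : ℝ × ℝ) :
    e p x * (starRingEnd ℂ) (e n x) = (1 / (2 * Real.pi) : ℂ) ^ 2 *
      (Complex.exp (Complex.I * (p.1 - n.1 : ℤ) * x.1)
        * Complex.exp (Complex.I * (p.2 - n.2 : ℤ) * x.2)) := by
  simp only [e, map_mul, ← Complex.exp_conj, map_add, map_div₀, map_one, map_ofNat,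
    Complex.conj_ofReal, Complex.conj_I, map_intCast]
  rw [mul_mul_mul_comm, ← Complex.exp_add, ← Complex.exp_add, ← sq]
  congr 2
  push_cast
  ring

theorem integral_e_mul_conj_e (p n : ℤ × ℤ) :
    ∫ x in cell, e p x * (starRingEnd ℂ) (e n x) = if p = n then 1 else 0 := by
  simp_rw [e_mul_conj_e]
  rw [integral_const_mul, cell, Measure.volume_eq_prod, setIntegral_prod_mul
    (fun x : ℝ => Complex.exp (Complex.I * (p.1 - n.1 : ℤ) * x))
    (fun x : ℝ => Complex.exp (Complex.I * (p.2 - n.2 : ℤ) * x)),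
    integral_exp_int_mul, integral_exp_int_mul]
  have hpi : (Real.pi : ℂ) ≠ 0 := by exact_mod_cast Real.pi_ne_zero
  by_cases h : p = n
  · subst h
    simp only [sub_self, if_true]
    field_simp
  · rw [if_neg h]
    have h2 : p.1 - n.1 ≠ 0 ∨ p.2 - n.2 ≠ 0 := by
      by_contra! h3
      exact h (Prod.ext (by omega) (by omega))
    rcases h2 with h2 | h2
    · rw [if_neg h2]
      simp
    · rw [if_neg h2]
      simp

/-- The trigonometric polynomial with frequencies in `F` and coefficients `c`. -/
def trigPoly (F : Finset (ℤ × ℤ)) (c : ℤ × ℤ → ℂ) (x : ℝ × ℝ) : ℂ := ∑ p ∈ F, c p * e p x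

theorem coeff_trigPoly (F : Finset (ℤ × ℤ)) (c : ℤ × ℤ → ℂ) (n : ℤ × ℤ) :
    coeff (trigPoly F c) n = if n ∈ F then c n else 0 := by
  unfold coeff trigPoly
  simp_rw [Finset.sum_mul]
  rw [integral_finsetSum]
  · simp_rw [mul_assoc, integral_const_mul, integral_e_mul_conj_e]
    simp
  · intro p _
    have h1 := continuous_e p
    have h2 := continuous_e n
    exact integrableOn_cell ((continuous_const.mul h1).mul (Complex.continuous_conj.comp h2))

theorem multiplier_trigPoly (m : ℤ × ℤ → ℝ) (F : Finset (ℤ × ℤ)) (c : ℤ × ℤ → ℂ) :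
    multiplier m (trigPoly F c) = trigPoly F (fun p => m p * c p) := by
  ext x
  unfold multiplier
  rw [tsum_eq_sum (s := F)]
  · refine Finset.sum_congr rfl fun p hp => ?_
    rw [coeff_trigPoly, if_pos hp]
  · intro p hp
    rw [coeff_trigPoly, if_neg hp]
    simp

/-- The Fourier coefficient of the Duhamel integral. -/
def duhamelCoeff (p : ℤ × ℤ) (c : ℝ → ℂ) (t : ℝ) : ℂ :=
  ∫ t' in (0 : ℝ)..t, ((Real.sin ((t - t') * jb p) / jb p : ℝ) : ℂ) * c t'

theorem continuous_duhamelCoeff (p : ℤ × ℤ) {c : ℝ → ℂ} (hc : Continuous c) :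
    Continuous (duhamelCoeff p c) :=
  intervalIntegral.continuous_parametric_intervalIntegral_of_continuous
    (f := fun t t' => ((Real.sin ((t - t') * jb p) / jb p : ℝ) : ℂ) * c t') (by fun_prop)
    continuous_id

theorem duhamel_eq_trigPoly {G : ℝ → ℝ × ℝ → ℂ} {F : Finset (ℤ × ℤ)} {c : ℤ × ℤ → ℝ → ℂ}
    (hc : ∀ p, Continuous (c p)) (hG : ∀ t, 0 ≤ t → G t = trigPoly F fun p => c p t) {t : ℝ}
    (ht : 0 ≤ t) : duhamel G t = trigPoly F fun p => duhamelCoeff p (c p) t := by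
  ext x
  unfold duhamel
  have h1 : (∫ t' in (0 : ℝ)..t, multiplier (fun n => Real.sin ((t - t') * jb n) / jb n) (G t') x)
      = ∫ t' in (0 : ℝ)..t, ∑ p ∈ F,
        (((Real.sin ((t - t') * jb p) / jb p : ℝ) : ℂ) * c p t') * e p x := by
    refine intervalIntegral.integral_congr fun t' ht' => ?_
    rw [Set.uIcc_of_le ht] at ht'
    simp only [hG t' ht'.1, multiplier_trigPoly, trigPoly]
  rw [h1, intervalIntegral.integral_finsetSum]
  · refine Finset.sum_congr rfl fun p _ => ?_
    rw [intervalIntegral.integral_mul_const]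
    rfl
  · intro p _
    have := hc p
    exact Continuous.intervalIntegrable (by fun_prop) _ _

theorem e_mul_e (k l : ℤ × ℤ) (x : ℝ × ℝ) :
    e k x * e l x = ((2 * Real.pi)⁻¹ : ℝ) * e (k + l) x := by
  simp only [e]
  rw [mul_mul_mul_comm, ← Complex.exp_add, mul_assoc, ← mul_assoc]
  push_cast
  rw [one_div, mul_assoc]
  congr 4
  simp only [Prod.fst_add, Prod.snd_add]
  push_cast
  ring

theorem add_mem_freq {N : ℕ} {k l : ℤ × ℤ} (hk : k ∈ freq N) (hl : l ∈ freq N) :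
    k + l ∈ freq (2 * N) := by
  rw [mem_freq] at hk hl ⊢
  simp only [Prod.fst_add, Prod.snd_add]
  push_cast
  nlinarith [sq_nonneg (k.1 - l.1), sq_nonneg (k.2 - l.2)]

theorem trigPoly_sq (N : ℕ) (c : ℤ × ℤ → ℂ) (x : ℝ × ℝ) :
    trigPoly (freq N) c x ^ 2 = trigPoly (freq (2 * N))
      (fun p => ((2 * Real.pi)⁻¹ : ℝ) * ∑ k ∈ pairs p N, c k * c (p - k)) x := by
  unfold trigPoly
  rw [sq, Finset.sum_mul_sum, ← Finset.sum_product',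
    ← Finset.sum_fiberwise_of_maps_to (t := freq (2 * N)) (g := fun z => z.1 + z.2)
      (fun z hz => add_mem_freq (Finset.mem_product.1 hz).1 (Finset.mem_product.1 hz).2)]
  refine Finset.sum_congr rfl fun p _ => ?_
  beta_reduce
  rw [Finset.mul_sum, Finset.sum_mul]
  refine Finset.sum_bij' (fun z _ => z.1) (fun k _ => (k, p - k)) ?_ ?_ ?_ ?_ ?_
  · intro z hz
    simp only [Finset.mem_filter, Finset.mem_product] at hz
    rw [mem_pairs, ← hz.2, add_sub_cancel_left]
    exact hz.1
  · intro k hk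
    simp only [Finset.mem_filter, Finset.mem_product]
    exact ⟨mem_pairs.1 hk, by abel⟩
  · intro z hz
    simp only [Finset.mem_filter, Finset.mem_product] at hz
    rw [← hz.2, add_sub_cancel_left]
  · intro k _
    rfl
  · intro z hz
    simp only [Finset.mem_filter, Finset.mem_product] at hz
    have : p - z.1 = z.2 := by rw [← hz.2, add_sub_cancel_left]
    rw [this, mul_mul_mul_comm, e_mul_e, hz.2]
    ring

theorem const_eq_trigPoly {F : Finset (ℤ × ℤ)} (h0 : (0 : ℤ × ℤ) ∈ F) (a : ℂ) (x : ℝ × ℝ) :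
    a = trigPoly F (fun p => if p = 0 then 2 * Real.pi * a else 0) x := by
  have hpi : (Real.pi : ℂ) ≠ 0 := by exact_mod_cast Real.pi_ne_zero
  simp only [trigPoly, ite_mul, zero_mul, Finset.sum_ite_eq', h0, if_true, e]
  simp
  field_simp

theorem zero_mem_freq (N : ℕ) : (0 : ℤ × ℤ) ∈ freq N := by
  rw [mem_freq]
  simp

theorem continuous_sigma (α : ℝ) (N : ℕ) : Continuous (sigma α N) := by
  unfold sigma
  refine continuous_const.mul (continuous_finsetSum _ fun n _ => ?_)
  exact intervalIntegral.continuous_parametric_intervalIntegral_of_continuous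
    (f := fun t t' => (Real.sin ((t - t') * jb n) / jb n ^ (1 - α)) ^ 2) (by fun_prop)
    continuous_id

/-- Both boundary terms of the integration by parts vanish: the sine is zero at `t' = t` and the
path is zero at `0`. Differentiating the sine turns `⟨n⟩^(α-1)` into `⟨n⟩^α`. -/
theorem convCoeff_eq_pathConv {Ω : Type*} (α : ℝ) {β : ℤ × ℤ → ℝ≥0 → Ω → ℂ} {n : ℤ × ℤ} {ω : Ω}
    {b : ℝ → ℂ} (hb : Continuous b) (hb0 : b 0 = 0) (hβ : ∀ s : ℝ, β n s.toNNReal ω = b s) {t : ℝ}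
    (ht : 0 ≤ t) : convCoeff α β n t ω = pathConv α (jb n) b t := by
  have hj := jb_pos n
  have hβ' : ∀ s : ℝ≥0, β n s ω = b s := fun s => by
    rw [← hβ, Real.toNNReal_coe]
  have hcont : Continuous fun s => β n s ω := by
    simp only [hβ']
    exact hb.comp NNReal.continuous_coe
  have hd : ∀ s, HasDerivAt (fun t' => Real.sin ((t - t') * jb n) / jb n ^ (1 - α))
      (-(jb n ^ α * Real.cos ((t - s) * jb n))) s := by
    intro s
    have h1 : HasDerivAt (fun s : ℝ => (t - s) * jb n) (-1 * jb n) s :=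
      ((hasDerivAt_id s).const_sub t).mul_const _
    refine (h1.sin.div_const _).congr_deriv ?_
    have h2 : jb n ^ (1 - α) * jb n ^ α = jb n := by
      rw [← Real.rpow_add hj]
      simp
    have h3 : jb n ^ (1 - α) ≠ 0 := (Real.rpow_pos_of_pos hj _).ne'
    rw [div_eq_iff h3]
    linear_combination Real.cos ((t - s) * jb n) * h2
  have hf : ContDiff ℝ 1 fun t' => Real.sin ((t - t') * jb n) / jb n ^ (1 - α) := by fun_prop
  unfold convCoeff
  rw [wienerIntegral_eq hf hcont ht]
  have h0 : β n 0 ω = 0 := by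
    have := hβ 0
    rwa [Real.toNNReal_zero, hb0] at this
  rw [h0]
  simp only [sub_self, zero_mul, Real.sin_zero, zero_div, Complex.ofReal_zero, mul_zero, zero_sub,
    pathConv, (hd _).deriv, hβ]
  rw [← intervalIntegral.integral_neg, ← intervalIntegral.integral_const_mul]
  refine intervalIntegral.integral_congr fun s _ => ?_
  push_cast
  ring

/-- The Fourier coefficients of the truncated Wick square. -/
def wickCoeff (α : ℝ) (b : ℤ × ℤ → ℝ → ℂ) (N : ℕ) (p : ℤ × ℤ) (t : ℝ) : ℂ :=
  ((2 * Real.pi)⁻¹ : ℝ) * ∑ k ∈ pairs p N,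
    pathConv α (jb k) (b k) t * pathConv α (jb (p - k)) (b (p - k)) t
  - if p = 0 then 2 * Real.pi * (sigma α N t : ℂ) else 0

theorem continuous_wickCoeff (α : ℝ) {b : ℤ × ℤ → ℝ → ℂ} (hb : ∀ k, Continuous (b k)) (N : ℕ)
    (p : ℤ × ℤ) : Continuous (wickCoeff α b N p) := by
  refine (continuous_const.mul (continuous_finsetSum _ fun k _ =>
    (continuous_pathConv (hb _) _ _).mul (continuous_pathConv (hb _) _ _))).sub ?_
  split_ifs
  · exact continuous_const.mul (Complex.continuous_ofReal.comp (continuous_sigma α N))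
  · exact continuous_const

section

variable {Ω : Type*} {β : ℤ × ℤ → ℝ≥0 → Ω → ℂ} {ω : Ω} {b : ℤ × ℤ → ℝ → ℂ}

theorem wickSquare_eq_trigPoly (α : ℝ) (hb : ∀ k, Continuous (b k)) (hb0 : ∀ k, b k 0 = 0)
    (hβ : ∀ k, ∀ s : ℝ, β k s.toNNReal ω = b k s) (N : ℕ) {t : ℝ} (ht : 0 ≤ t) :
    wickSquare α β N ω t = trigPoly (freq (2 * N)) fun p => wickCoeff α b N p t := by
  ext x
  have h1 : stochConv α β N ω t x = trigPoly (freq N) (fun k => pathConv α (jb k) (b k) t) x := by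
    refine Finset.sum_congr rfl fun k _ => ?_
    rw [convCoeff_eq_pathConv α (hb k) (hb0 k) (hβ k) ht]
  unfold wickSquare
  rw [h1, trigPoly_sq]
  conv_lhs => rw [const_eq_trigPoly (zero_mem_freq (2 * N)) (sigma α N t : ℂ) x]
  simp only [trigPoly, wickCoeff, sub_mul, Finset.sum_sub_distrib]

theorem secondOrder_eq_trigPoly (α : ℝ) (hb : ∀ k, Continuous (b k)) (hb0 : ∀ k, b k 0 = 0)
    (hβ : ∀ k, ∀ s : ℝ, β k s.toNNReal ω = b k s) (N : ℕ) {t : ℝ} (ht : 0 ≤ t) :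
    secondOrder α β N ω t
      = trigPoly (freq (2 * N)) fun p => duhamelCoeff p (wickCoeff α b N p) t :=
  duhamel_eq_trigPoly (fun p => continuous_wickCoeff α hb N p)
    (fun _ ht' => wickSquare_eq_trigPoly α hb hb0 hβ N ht') ht

/-- The deterministic part of the Fourier coefficients, coming from the renormalization. -/
def renormCoeff (α : ℝ) (n : ℤ × ℤ) (t : ℝ) (N : ℕ) : ℂ :=
  duhamelCoeff n (fun t' => if n = 0 then 2 * Real.pi * (sigma α N t' : ℂ) else 0) t

/-- Renormalization contributes only the deterministic `renormCoeff`, which plays the role of `D` in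
the non-convergence results. -/
theorem duhamelCoeff_wickCoeff (α : ℝ) {w : ℤ × ℤ → ℝ → ℝ} (hw : ∀ k, Continuous (w k)) (N : ℕ)
    (n : ℤ × ℤ) (t : ℝ) :
    duhamelCoeff n (wickCoeff α (fourierPath w) N n) t = pathQuad α n t w N - renormCoeff α n t N := by
  have hb := continuous_fourierPath hw
  set S : ℝ → ℂ := fun t' => ((Real.sin ((t - t') * jb n) / jb n : ℝ) : ℂ) with hS
  have hSc : Continuous S := by fun_prop
  have hG := fun k => continuous_pathConv (hb k) α (jb k)
  have hr : Continuous fun t' => if n = 0 then 2 * Real.pi * (sigma α N t' : ℂ) else 0 := by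
    split_ifs
    · exact continuous_const.mul (Complex.continuous_ofReal.comp (continuous_sigma α N))
    · exact continuous_const
  have h1 : duhamelCoeff n (wickCoeff α (fourierPath w) N n) t
      = ∫ t' in (0 : ℝ)..t, ((((2 * Real.pi)⁻¹ : ℝ) : ℂ) * ∑ k ∈ pairs n N,
        S t' * (pathConv α (jb k) (fourierPath w k) t'
          * pathConv α (jb (n - k)) (fourierPath w (n - k)) t')
        - S t' * if n = 0 then 2 * Real.pi * (sigma α N t' : ℂ) else 0) := by
    refine intervalIntegral.integral_congr fun t' _ => ?_
    simp only [wickCoeff, ← Finset.mul_sum, hS]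
    ring
  have hint : ∀ k, Continuous fun t' => S t' * (pathConv α (jb k) (fourierPath w k) t'
          * pathConv α (jb (n - k)) (fourierPath w (n - k)) t') := fun k =>
    hSc.mul ((hG k).mul (hG (n - k)))
  have i1 : Continuous fun t' => (((2 * Real.pi)⁻¹ : ℝ) : ℂ) * ∑ k ∈ pairs n N,
        S t' * (pathConv α (jb k) (fourierPath w k) t'
          * pathConv α (jb (n - k)) (fourierPath w (n - k)) t') :=
    continuous_const.mul (continuous_finsetSum _ fun k _ => hint k)
  have i2 : Continuous fun t' => S t' * if n = 0 then 2 * Real.pi * (sigma α N t' : ℂ) else 0 :=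
    hSc.mul hr
  rw [h1, intervalIntegral.integral_sub (i1.intervalIntegrable _ _) (i2.intervalIntegrable _ _),
    intervalIntegral.integral_const_mul,
    intervalIntegral.integral_finsetSum fun k _ => (hint k).intervalIntegrable _ _]
  rfl

end

/-! ### Periodic distributions -/

theorem TestFunction.continuous (φ : TestFunction) : Continuous φ := φ.2.1.continuous

theorem TestFunction.tendstoUniformly (φ : TestFunction) :
    TendstoUniformly (fun (ψ : TestFunction) (x : ℝ × ℝ) => ψ x) (fun x => φ x) (𝓝 φ) := by
  have h1 : Continuous fun ψ : TestFunction => UniformFun.ofFun (iteratedFDeriv ℝ 0 ψ) :=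
    continuous_iff_le_induced.2 (iInf_le _ 0)
  have h2 := UniformFun.tendsto_iff_tendstoUniformly.1 (h1.tendsto φ)
  have h3 := (continuousMultilinearCurryFin0 ℝ (ℝ × ℝ) ℂ).isometry.uniformContinuous.comp_tendstoUniformly h2
  exact h3

theorem integrableOn_basis_mul (p : ℤ × ℤ) (φ : TestFunction) :
    IntegrableOn (fun x => e p x * φ x) cell :=
  integrableOn_cell ((continuous_e p).mul φ.continuous)

/-- The pairing with the Fourier basis, as a distribution. -/
def basisDistribution (p : ℤ × ℤ) : TorusDistribution where
  toFun φ := ∫ x in cell, e p x * φ x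
  map_add' φ ψ := by
    refine (integral_congr_ae (Eventually.of_forall fun x => ?_)).trans
      (integral_add (integrableOn_basis_mul p φ) (integrableOn_basis_mul p ψ))
    exact mul_add _ _ _
  map_smul' c φ := by
    rw [RingHom.id_apply, smul_eq_mul, ← integral_const_mul]
    refine integral_congr_ae (Eventually.of_forall fun x => ?_)
    exact mul_left_comm _ _ _
  cont := by
    refine continuous_iff_continuousAt.2 fun φ => Metric.tendsto_nhds.2 fun ε hε => ?_
    have hvol : volume cell < ⊤ := by
      refine lt_of_le_of_lt (measure_mono (Set.prod_mono Set.Ioc_subset_Icc_self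
        Set.Ioc_subset_Icc_self)) (isCompact_Icc.prod isCompact_Icc).measure_lt_top
    have hV : 0 ≤ volume.real cell := measureReal_nonneg
    set δ := ε / (volume.real cell + 1) with hδ
    have hδ0 : 0 < δ := by positivity
    filter_upwards [Metric.tendstoUniformly_iff.1 φ.tendstoUniformly δ hδ0] with ψ hψ
    rw [dist_eq_norm]
    have hsub := integral_sub (integrableOn_basis_mul p ψ) (integrableOn_basis_mul p φ)
    refine (congrArg norm hsub).symm.trans_lt ?_
    have hb : ∀ x ∈ cell, ‖e p x * ψ x - e p x * φ x‖ ≤ δ := by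
      intro x _
      rw [← mul_sub, norm_mul]
      have h1 : ‖e p x‖ ≤ 1 := by
        have h2 : Complex.exp (Complex.I * (p.1 * x.1 + p.2 * x.2))
            = Complex.exp ((p.1 * x.1 + p.2 * x.2 : ℝ) * Complex.I) := by
          push_cast
          rw [mul_comm]
        rw [e, norm_mul, h2, Complex.norm_exp_ofReal_mul_I, mul_one, norm_div, norm_one,
          norm_mul, Complex.norm_real, Real.norm_of_nonneg Real.pi_pos.le]
        rw [div_le_one (by simp [Real.pi_pos])]
        simp only [Complex.norm_ofNat]
        linarith [Real.pi_gt_three]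
      have h3 := (hψ x).le
      rw [dist_comm, dist_eq_norm] at h3
      exact (mul_le_mul h1 h3 (norm_nonneg _) zero_le_one).trans (one_mul δ).le
    refine (norm_setIntegral_le_of_norm_le_const hvol hb).trans_lt ?_
    rw [hδ, div_mul_eq_mul_div, div_lt_iff₀ (by positivity)]
    nlinarith

theorem integral_trigPoly_mul (F : Finset (ℤ × ℤ)) (c : ℤ × ℤ → ℂ) (φ : TestFunction) :
    ∫ x in cell, trigPoly F c x * φ x = (∑ p ∈ F, c p • basisDistribution p) φ := by
  rw [sum_apply]
  unfold trigPoly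
  simp_rw [Finset.sum_mul]
  rw [integral_finsetSum]
  · refine Finset.sum_congr rfl fun p _ => ?_
    simp_rw [mul_assoc]
    rw [integral_const_mul]
    rfl
  · intro p _
    exact integrableOn_cell ((continuous_const.mul (continuous_e p)).mul φ.continuous)

/-- The constant test functions. -/
def constTest (a : ℂ) : TestFunction := ⟨fun _ => a, contDiff_const, fun _ _ => rfl⟩

theorem continuous_constTest : Continuous constTest := by
  refine continuous_iInf_rng.2 fun k => continuous_induced_rng.2 ?_
  refine continuous_iff_continuousAt.2 fun a => UniformFun.tendsto_iff_tendstoUniformly.2 ?_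
  rcases Nat.eq_zero_or_pos k with rfl | hk
  · rw [Metric.tendstoUniformly_iff]
    intro ε hε
    filter_upwards [Metric.ball_mem_nhds a hε] with b hb x
    rw [dist_comm, ← (continuousMultilinearCurryFin0 ℝ (ℝ × ℝ) ℂ).isometry.dist_eq]
    exact hb
  · rw [Metric.tendstoUniformly_iff]
    intro ε hε
    refine Eventually.of_forall fun b x => ?_
    have h1 : ∀ b : ℂ, iteratedFDeriv ℝ k (constTest b) = 0 := fun b =>
      iteratedFDeriv_const_of_ne hk.ne' b
    simp only [Function.comp, UniformFun.toFun_ofFun, h1]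
    simpa using hε

/-- Evaluation at a constant test function is continuous for the strong dual topology once the
singleton is bounded. Absorption follows from the continuity of `c ↦ constTest (c * a)` at `0`. -/
theorem isVonNBounded_singleton_constTest (a : ℂ) :
    Bornology.IsVonNBounded ℂ ({constTest a} : Set TestFunction) := by
  intro V hV
  rw [absorbs_iff_eventually_nhds_zero (mem_of_mem_nhds hV)]
  have h1 : Tendsto (fun c : ℂ => constTest (c * a)) (𝓝 0) (𝓝 0) := by
    have := (continuous_constTest.comp (continuous_mul_const a)).tendsto 0
    simp only [Function.comp, zero_mul] at this
    exact this
  filter_upwards [h1 hV] with c hc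
  intro φ hφ
  rw [Set.mem_singleton_iff.1 hφ]
  exact hc

theorem tendsto_apply_constTest {ι : Type*} {l : Filter ι} {u : ι → TorusDistribution}
    {v : TorusDistribution} (h : Tendsto u l (𝓝 v)) (a : ℂ) :
    Tendsto (fun i => u i (constTest a)) l (𝓝 (v (constTest a))) := by
  have h1 := (UniformConvergenceCLM.tendsto_iff_tendstoUniformlyOn (RingHom.id ℂ) ℂ
    {S : Set TestFunction | Bornology.IsVonNBounded ℂ S}).1 h
  exact (h1 _ (isVonNBounded_singleton_constTest a)).tendsto_at rfl

end SNLW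

end

theorem mainTheorem3 {Ω : Type*} [MeasurableSpace Ω] (P : Measure Ω) [IsProbabilityMeasure P]
    (β : ℤ × ℤ → ℝ≥0 → Ω → ℂ) (hβ : SNLW.IsCylindricalWiener β P)
    (α : ℝ) (hα : 1 / 2 ≤ α) :
    (∀ T : ℝ, 0 < T → ∀ᵐ ω ∂P, ∃ y : ℕ → C(Set.Icc (0 : ℝ) T, SNLW.TorusDistribution),
      (∀ (N : ℕ) (t : Set.Icc (0 : ℝ) T) (φ : SNLW.TestFunction),
        y N t φ = ∫ x in SNLW.cell, SNLW.secondOrder α β N ω t x * φ x) ∧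
      ¬ ∃ u : C(Set.Icc (0 : ℝ) T, SNLW.TorusDistribution), Tendsto y atTop (𝓝 u)) ∧
    (∀ (n : ℤ × ℤ) (t : ℝ), 0 < t → ∀ᵐ ω ∂P,
      ¬ ∃ c : ℂ, Tendsto (fun N : ℕ => SNLW.coeff (SNLW.secondOrder α β N ω t) n)
        atTop (𝓝 c)) := by
  open SNLW in
  obtain ⟨w, hw, hβw⟩ := hβ.exists_continuousNoise
  have hso : ∀ᵐ ω ∂P, ∀ N t, 0 ≤ t → secondOrder α β N ω t = trigPoly (freq (2 * N))
      fun p => duhamelCoeff p (wickCoeff α (fourierPath (pathOf w ω)) N p) t := by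
    filter_upwards [hβw] with ω hω N t ht
    exact secondOrder_eq_trigPoly α (continuous_fourierPath (continuous_pathOf hw.continuous ω))
      (fourierPath_zero (pathOf_zero hw.zero ω)) hω N ht
  have hcoeff : ∀ (n : ℤ × ℤ) (t : ℝ), 0 < t → ∀ᵐ ω ∂P,
      ¬ ∃ c : ℂ, Tendsto (fun N : ℕ => coeff (secondOrder α β N ω t) n) atTop (𝓝 c) := by
    intro n t ht
    filter_upwards [hso, ae_not_tendsto_pathQuad hw hα n ht (renormCoeff α n t)] with ω hω hn
    rintro ⟨c, hc⟩
    refine hn ⟨c, hc.congr' ?_⟩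
    -- The square of a polynomial with frequencies `|k| ≤ N` is expanded over `|p| ≤ 2N`, so the
    -- coefficient at `n` can be read off once `|n| ≤ 2N`.
    have h2 : ∀ᶠ N : ℕ in atTop, n ∈ freq (2 * N) :=
      (tendsto_atTop_mono (fun N : ℕ => (by omega : N ≤ 2 * N)) tendsto_id).eventually
        (eventually_mem_freq n)
    filter_upwards [h2] with N hN
    rw [hω N t ht.le, coeff_trigPoly, if_pos hN,
      duhamelCoeff_wickCoeff α (continuous_pathOf hw.continuous ω)]
  refine ⟨fun T hT => ?_, hcoeff⟩
  filter_upwards [hso, hcoeff 0 T hT] with ω hω hnot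
  have hb := continuous_fourierPath (continuous_pathOf hw.continuous ω)
  refine ⟨fun N => ⟨fun t => ∑ p ∈ freq (2 * N),
    duhamelCoeff p (wickCoeff α (fourierPath (pathOf w ω)) N p) t • basisDistribution p, ?_⟩, ?_, ?_⟩
  · refine continuous_finsetSum _ fun p _ => ?_
    exact ((continuous_duhamelCoeff p (continuous_wickCoeff α hb N p)).comp
      continuous_subtype_val).smul continuous_const
  · intro N t φ
    rw [hω N t t.2.1, integral_trigPoly_mul]
    rfl
  · rintro ⟨u, hu⟩
    -- The constant `1/(2π)` is the conjugate of `e 0`, so a limit in the path space would give a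
    -- limit of the zeroth Fourier coefficient at time `T`.
    refine hnot ⟨u ⟨T, hT.le, le_rfl⟩ (constTest (1 / (2 * Real.pi))), ?_⟩
    have h1 := tendsto_apply_constTest (((ContinuousEvalConst.continuous_eval_const
      (⟨T, hT.le, le_rfl⟩ : Set.Icc (0 : ℝ) T)).tendsto u).comp hu) (1 / (2 * Real.pi))
    refine h1.congr fun N => ?_
    rw [hω N T hT.le]
    change (∑ p ∈ freq (2 * N), duhamelCoeff p (wickCoeff α (fourierPath (pathOf w ω)) N p) T •
      basisDistribution p) _ = _
    rw [← integral_trigPoly_mul]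
    refine integral_congr_ae (Eventually.of_forall fun x => ?_)
    simp [constTest, e, -mul_eq_mul_left_iff, Complex.conj_ofNat]
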